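/- Let $R$ be a commutative ring, $h,t\in R$, $A=R[X]/(X^2-hX-t)$ the Frobenius algebra with counit $\epsilon(1)=0$, $\epsilon(X)=1$, and $U\colon A\to A$ multiplication by $2X-h$. For a link diagram $D$ let $CKh(D)$ be the Khovanov complex of $D$ obtained from $A$, and $Kh(D)=\bigoplus_r Kh^r(D)$ its homology. Let $U_1$ be the crossingless diagram of the unknot and $T^*_{2,n}$ the diagram of the negative $(2,n)$-torus link given by the closure of the $2$-braid with $n$ negative crossings. Let $k$ be a positive integer and $s_-$ an integer with $0\le s_-\le k$. Consider an immersed oriented cobordism $S$ from $U_1$ to $T^*_{2,2k+1}$, of genus $g=k-s_-$ and with $s_-$ negative double points, given by a sequence $$U_1\xrightarrow{\ R1\ }T^*_{2,1}\to T^*_{2,3}\to\cdots\to T^*_{2,2k+1},$$ where the first move creates the negative crossing of $T^*_{2,1}$ and each of the $k$ following arrows $T^*_{2,n}\to T^*_{2,n+2}$ is of one of two kinds. Both begin with an R2 move that inserts a positive and a negative crossing of the two strands. For $g$ of the arrows (embedded, genus one) it is followed by a saddle next to the positive crossing that turns this crossing into a kink of one strand, an R1 move that removes the kink, an R1 move that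 creates a negative kink in its place, and the reverse saddle that turns this kink into a crossing of the two strands. For the other $s_-$ arrows (genus zero, one negative double point) it is followed by the change of the positive crossing to a negative one. Let $Kh^{\mathrm{low}}(S)\colon Kh(U_1)\to Kh(T^*_{2,2k+1})$ be induced by the composition of the standard chain maps of the Reidemeister moves and saddles and, for each crossing change, the crossing change map $f_0$ of homological degree $-2$. Here $f_0$ maps the $1$-resolution at the positive crossing to the $0$-resolution at the negative crossing, which is the same diagram, by the difference of the multiplications by $X$ on the circles of the two arcs at the crossing, taken in either order, and is zero on the $0$-resolution. Then $Kh(U_1)\cong A$, and the image of $Kh^{\mathrm{low}}(S)$ is exactly $Kh^{-2s_-}(T^*_{2,2k+1})$, where $$Kh^{-2s_-}(T^*_{2,2k+1})\cong A/\operatorname{Im}(U)\ \text{ if } s_->0,\qquad Kh^{0}(T^*_{2,2k+1})\cong A\ \text{ if } s_-=0,$$ as $R$-modules. -/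

import Mathlib

open scoped TensorProduct

namespace Khovanov

/-! ### The Frobenius algebra and its tensor powers -/

/-- The Frobenius algebra `A = R[X]/(X² - hX - t)`; an element is `⟨a, b⟩ = a + bX`. -/
abbrev FrobAlg (R : Type*) [CommRing R] (h t : R) : Type _ := QuadraticAlgebra R t h

section Frobenius

variable {R : Type*} [CommRing R] (h t : R)

/-- The generator `X`. -/
def genX : FrobAlg R h t := ⟨0, 1⟩

/-- The counit `ε : A → R`, with `ε(1) = 0` and `ε(X) = 1`. -/
def counit : FrobAlg R h t →ₗ[R] R where
  toFun a := a.im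
  map_add' _ _ := rfl
  map_smul' _ _ := rfl

/-- The endomorphism `U` of `A`, multiplication by `2X - h`. -/
def mapU : FrobAlg R h t →ₗ[R] FrobAlg R h t :=
  LinearMap.mulLeft R (2 * genX h t - algebraMap R (FrobAlg R h t) h)

/-- The tensor power `A^{⊗ι}` over `R`, the value of the TQFT on a collection `ι` of circles. -/
def TensorPow (ι : Type) : Type _ := ⨂[R] _ : ι, FrobAlg R h t

noncomputable instance (ι : Type) : CommRing (TensorPow h t ι) :=
  inferInstanceAs (CommRing (⨂[R] _ : ι, FrobAlg R h t))

noncomputable instance (ι : Type) : Algebra R (TensorPow h t ι) :=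
  inferInstanceAs (Algebra R (⨂[R] _ : ι, FrobAlg R h t))

open Classical in
/-- The element of `A^{⊗ι}` with `a` on the circle `c` and `1` on the other circles, as an algebra
map in `a`. -/
noncomputable def label {ι : Type} (c : ι) : FrobAlg R h t →ₐ[R] TensorPow h t ι :=
  PiTensorProduct.singleAlgHom (R := R) (A := fun _ : ι => FrobAlg R h t) c

/-- The element with `X` on the circle `c` and `1` on the other circles. Multiplication by it is
the action of a dot on `c`. -/
noncomputable def dot {ι : Type} (c : ι) : TensorPow h t ι := label h t c (genX h t)

/-- The algebra map `A^{⊗ι} → A^{⊗κ}` induced by a map of circles `f`: the labels of the circles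
in a fibre of `f` are multiplied, and circles outside the image get the label `1`. It is the
relabelling for a bijection, the merge map if `f` identifies two circles, and the birth map if `f`
misses one circle. -/
noncomputable def push {ι κ : Type} [Finite ι] (f : ι → κ) :
    TensorPow h t ι →ₐ[R] TensorPow h t κ :=
  letI := Fintype.ofFinite ι
  PiTensorProduct.liftAlgHom (S := TensorPow h t κ)
    ((MultilinearMap.mkPiAlgebra R ι (TensorPow h t κ)).compLinearMap fun i =>
      (label h t (f i)).toLinearMap)
    (by simp [MultilinearMap.mkPiAlgebra_apply])
    (by intro x y; simp [MultilinearMap.mkPiAlgebra_apply, Finset.prod_mul_distrib])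

open Classical in
/-- Apply `ε` to the label of the circle `c`, and put the label `1` there. -/
noncomputable def counitAt {ι : Type} (c : ι) : TensorPow h t ι →ₗ[R] TensorPow h t ι :=
  PiTensorProduct.map (R := R) (s := fun _ : ι => FrobAlg R h t) fun j =>
    if j = c then (Algebra.linearMap R (FrobAlg R h t)) ∘ₗ counit h t else LinearMap.id

end Frobenius

/-! ### Oriented link diagrams -/

/-- A crossing in planar diagram notation: the four corners `a, b, c, d` in counterclockwise order,
starting with the incoming end `a` of the under-strand. The under-strand runs from `a` to `c`; the
over-strand runs from `d` to `b` if the crossing is positive and from `b` to `d` if it is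
negative. -/
structure Crossing (P : Type) where
  a : P
  b : P
  c : P
  d : P
  positive : Bool

namespace Crossing

variable {P : Type} (x : Crossing P)

/-- The incoming end of the over-strand. -/
def overIn : P := if x.positive then x.d else x.b

/-- The outgoing end of the over-strand. -/
def overOut : P := if x.positive then x.b else x.d

/-- The two arcs of the `0`-resolution (`false`) join `a, b` and `c, d`; those of the
`1`-resolution (`true`) join `b, c` and `d, a`. -/
def joins (x : Crossing P) : Bool → P → P → Prop
  | false => fun p q => (p = x.a ∧ q = x.b) ∨ (p = x.c ∧ q = x.d)
  | true => fun p q => (p = x.b ∧ q = x.c) ∨ (p = x.d ∧ q = x.a)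

end Crossing

/-- An oriented link diagram: finitely many marked points on the link, `n` ordered crossings, and
oriented crossingless arcs (`joint`). The marked points cut the link into pieces: the arcs and
the under- and over-strands at the crossings. Each marked point is the start of exactly one piece
and the end of exactly one piece. -/
structure Diagram where
  Pt : Type
  finitePt : Finite Pt
  n : ℕ
  crossing : Fin n → Crossing Pt
  Joint : Type
  joint : Joint → Pt × Pt
  start_bijective : Function.Bijective (Sum.elim (fun j => (joint j).1)
    (Sum.elim (fun i => (crossing i).a) (fun i => (crossing i).overIn)))
  end_bijective : Function.Bijective (Sum.elim (fun j => (joint j).2)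
    (Sum.elim (fun i => (crossing i).c) (fun i => (crossing i).overOut)))

namespace Diagram

attribute [instance] Diagram.finitePt

/-- A choice of resolution at each crossing. -/
abbrev State (D : Diagram) : Type := Fin D.n → Bool

/-- Two marked points are equivalent if they lie on the same circle of the resolution `s`. -/
def smoothing (D : Diagram) (s : D.State) : Setoid D.Pt :=
  Relation.EqvGen.setoid fun p q =>
    (∃ j, D.joint j = (p, q)) ∨ ∃ i, (D.crossing i).joins (s i) p q

/-- The circles of the resolution `s`. -/
abbrev Circle (D : Diagram) (s : D.State) : Type := Quotient (D.smoothing s)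

/-- The circle through a marked point. -/
def circle (D : Diagram) (s : D.State) (p : D.Pt) : D.Circle s := Quotient.mk (D.smoothing s) p

/-- The homological degree of the vertex `s` of the cube: the number of `1`-resolutions minus the
number of negative crossings. -/
def degree (D : Diagram) (s : D.State) : ℤ :=
  ((Finset.univ.filter fun i => s i = true).card : ℤ) -
    ((Finset.univ.filter fun i => (D.crossing i).positive = false).card : ℤ)

end Diagram

section Complex

variable {R : Type*} [CommRing R] (h t : R)

/-- The map on labels induced by a map `f` of marked points that sends circles to circles (up to
the cutting of circles): each circle of `s` is sent to the circle of `s'` through the image of one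
of its points. -/
noncomputable def carry (D D' : Diagram) (f : D.Pt → D'.Pt) (s : D.State) (s' : D'.State) :
    TensorPow h t (D.Circle s) →ₐ[R] TensorPow h t (D'.Circle s') :=
  push h t fun c => D'.circle s' (f c.out)

open Classical in
/-- The map of a saddle (identifying points by `f`). Here `p`, `q` are points on the two arcs before
the surgery and `p'`, `q'` are points on the two arcs after it. If two circles merge, it is the
multiplication of `A`. If one circle splits into the circles of `p'` and `q'`, it is the
comultiplication `Δ(a) = (a ⊗ 1)(X ⊗ 1 + 1 ⊗ X - h)`. -/
noncomputable def saddle (D D' : Diagram) (f : D.Pt → D'.Pt) (s : D.State) (s' : D'.State)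
    (p q : D.Pt) (p' q' : D'.Pt) :
    TensorPow h t (D.Circle s) →ₗ[R] TensorPow h t (D'.Circle s') :=
  if D.circle s p ≠ D.circle s q ∧ D'.circle s' p' = D'.circle s' q' then
    (carry h t D D' f s s').toLinearMap
  else if D.circle s p = D.circle s q ∧ D'.circle s' p' ≠ D'.circle s' q' then
    LinearMap.mulLeft R (dot h t (D'.circle s' p') + dot h t (D'.circle s' q') -
      algebraMap R (TensorPow h t (D'.Circle s')) h) ∘ₗ (carry h t D D' f s s').toLinearMap
  else 0

/-- The chain module `CKh(D)`: the direct sum over the vertices `s` of the cube of resolutions. -/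
abbrev Chain (D : Diagram) : Type _ := (s : D.State) → TensorPow h t (D.Circle s)

/-- The sign of the edge of the cube at the crossing `i`, for the ordering of the crossings by
decreasing index: `(-1)` to the number of `1`-resolutions at crossings of larger index. -/
def edgeSign (D : Diagram) (s : D.State) (i : Fin D.n) : ℤ :=
  (-1) ^ (Finset.univ.filter fun j => i < j ∧ s j = true).card

/-- The differential of `CKh(D)`: the signed sum of the saddle maps along the edges of the cube. -/
noncomputable def differential (D : Diagram) : Chain h t D →ₗ[R] Chain h t D :=
  LinearMap.pi fun s' => ∑ i : Fin D.n,
    if s' i = true then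
      edgeSign D s' i • (saddle h t D D id (Function.update s' i false) s'
        (D.crossing i).a (D.crossing i).c (D.crossing i).a (D.crossing i).c ∘ₗ
          LinearMap.proj (Function.update s' i false))
    else 0

/-- The homological grading `r` part of `CKh(D)`. -/
def chainGr (D : Diagram) (r : ℤ) : Submodule R (Chain h t D) where
  carrier := {v | ∀ s, D.degree s ≠ r → v s = 0}
  zero_mem' := fun _ _ => rfl
  add_mem' := fun hv hw s hs => by simp [hv s hs, hw s hs]
  smul_mem' := fun a v hv s hs => by simp [hv s hs]

/-- The cycles of `CKh(D)`. -/
noncomputable abbrev cycles (D : Diagram) : Submodule R (Chain h t D) :=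
  LinearMap.ker (differential h t D)

/-- The boundaries, inside the module of cycles. -/
noncomputable abbrev boundaries (D : Diagram) : Submodule R (cycles h t D) :=
  (LinearMap.range (differential h t D)).comap (cycles h t D).subtype

/-- Khovanov homology `Kh(D)`: cycles modulo boundaries. -/
abbrev Kh (D : Diagram) : Type _ := cycles h t D ⧸ boundaries h t D

/-- The homological grading `r` part of `Kh(D)`: the classes of the cycles of degree `r`. -/
noncomputable def KhGr (D : Diagram) (r : ℤ) : Submodule R (Kh h t D) :=
  ((chainGr h t D r).comap (cycles h t D).subtype).map (boundaries h t D).mkQ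

/-- Compatibility of a map with the differentials. -/
def IsChainMap {D D' : Diagram} (φ : Chain h t D →ₗ[R] Chain h t D') : Prop :=
  ∀ v, φ (differential h t D v) = differential h t D' (φ v)

/-- The map on Khovanov homology induced by a chain map. -/
noncomputable def KhMap {D D' : Diagram} (φ : Chain h t D →ₗ[R] Chain h t D')
    (hφ : IsChainMap h t φ) : Kh h t D →ₗ[R] Kh h t D' :=
  (boundaries h t D).mapQ (boundaries h t D')
    (φ.restrict (p := cycles h t D) (q := cycles h t D') fun v hv => by
      rw [LinearMap.mem_ker] at hv ⊢
      rw [← hφ v, hv, map_zero])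
    (by
      rintro ⟨v, hv⟩ ⟨w, hw⟩
      refine ⟨φ w, ?_⟩
      rw [← hφ w, hw]
      rfl)

end Complex

/-! ### The diagrams of the movie -/

/-- The diagram of the unknot without crossings: one marked point and one arc. -/
def unknot : Diagram where
  Pt := Unit
  finitePt := inferInstance
  n := 0
  crossing := Fin.elim0
  Joint := Unit
  joint := fun _ => ((), ())
  start_bijective := by
    constructor
    · rintro (_ | i | i) (_ | j | j) _
      all_goals first | rfl | exact i.elim0 | exact j.elim0
    · intro _; exact ⟨Sum.inl (), rfl⟩
  end_bijective := by
    constructor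
    · rintro (_ | i | i) (_ | j | j) _
      all_goals first | rfl | exact i.elim0 | exact j.elim0
    · intro _; exact ⟨Sum.inl (), rfl⟩

/-- The elementary pieces of two vertical strands, both oriented upwards: a negative or positive
crossing of the two strands, or a negative or positive kink on the left strand with its loop on the
right, next to a vertical right strand. -/
inductive Slot
  | neg
  | pos
  | negKink
  | posKink

/-- Is the crossing of the piece positive? -/
def Slot.positive : Slot → Bool
  | neg => false
  | pos => true
  | negKink => false
  | posKink => true

/-- Is the piece a kink? -/
def Slot.kink : Slot → Bool
  | neg => false
  | pos => false
  | negKink => true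
  | posKink => true

/-- The marked points of a piece: its lower left and lower right ends `L`, `R`, and the lower right
and upper right corners `P`, `Q` of its crossing. The lower left corner of the crossing is `L`. The
upper ends of a piece are the points `L`, `R` of the piece above it. -/
inductive Mark
  | L
  | R
  | P
  | Q

instance : Finite Mark :=
  Finite.of_injective
    (fun m : Mark => match m with
      | .L => (0 : Fin 4)
      | .R => 1
      | .P => 2
      | .Q => 3)
    (by intro a b; cases a <;> cases b <;> simp)

/-- The crossing of the `i`-th of `n` pieces stacked cyclically from bottom to top. A negative
crossing has its under-strand from lower left to upper right, a positive one has its under-strand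
from lower right to upper left. -/
def slotCrossing {n : ℕ} (x : Slot) (i : Fin n) : Crossing (Fin n × Mark) :=
  if x.positive then ⟨(i, .P), (i, .Q), (finRotate n i, .L), (i, .L), true⟩
  else ⟨(i, .L), (i, .P), (i, .Q), (finRotate n i, .L), false⟩

/-- The two crossingless arcs of the `i`-th of `n` pieces. If it is a crossing, they join the right
corners of the crossing to the right ends of the piece. If it is a kink, they are the right strand
and the arc that closes the loop. -/
def slotJoint {n : ℕ} (x : Slot) (i : Fin n) : Bool → (Fin n × Mark) × (Fin n × Mark)
  | false => if x.kink then ((i, .R), (finRotate n i, .R)) else ((i, .R), (i, .P))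
  | true => if x.kink then ((i, .Q), (i, .P)) else ((i, .Q), (finRotate n i, .R))

/-- The closure of the stack of pieces `l`, listed from bottom to top: the upper ends of the last
piece are joined to the lower ends of the first piece, as in the closure of a braid. -/
def closure (l : List Slot) : Diagram where
  Pt := Fin l.length × Mark
  finitePt := inferInstance
  n := l.length
  crossing := fun i => slotCrossing (l.get i) i
  Joint := Fin l.length × Bool
  joint := fun j => slotJoint (l.get j.1) j.1 j.2
  start_bijective := by
    constructor
    · rintro (⟨i, _ | _⟩ | i | i) (⟨j, _ | _⟩ | j | j) hij
      all_goals
        revert hij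
        dsimp only [Sum.elim_inl, Sum.elim_inr, slotJoint, slotCrossing, Crossing.overIn]
        cases hi : l.get i <;> cases hj : l.get j <;>
          simp [Slot.kink, Slot.positive] <;> rintro rfl <;> simp_all
    · rintro ⟨i, m⟩
      cases hi : l.get i <;> cases m
      all_goals
        first
        | exact ⟨Sum.inl (i, false), by simp only [Sum.elim_inl, slotJoint, hi, Slot.kink]; rfl⟩
        | exact ⟨Sum.inl (i, true), by simp only [Sum.elim_inl, slotJoint, hi, Slot.kink]; rfl⟩
        | exact ⟨Sum.inr (Sum.inl i), by
            simp only [Sum.elim_inl, Sum.elim_inr, slotCrossing, hi, Slot.positive]; rfl⟩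
        | exact ⟨Sum.inr (Sum.inr i), by
            simp only [Sum.elim_inr, slotCrossing, hi, Slot.positive, Crossing.overIn]; rfl⟩
  end_bijective := by
    constructor
    · rintro (⟨i, _ | _⟩ | i | i) (⟨j, _ | _⟩ | j | j) hij
      all_goals
        revert hij
        dsimp only [Sum.elim_inl, Sum.elim_inr, slotJoint, slotCrossing, Crossing.overOut]
        cases hi : l.get i <;> cases hj : l.get j <;>
          simp [Slot.kink, Slot.positive] <;> rintro rfl <;> simp_all
    · rintro ⟨i, m⟩
      obtain ⟨k, rfl⟩ := (finRotate l.length).surjective i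
      cases m
      case P =>
        cases hi : l.get (finRotate l.length k)
        all_goals
          first
          | exact ⟨Sum.inl (finRotate l.length k, false), by
              simp only [Sum.elim_inl, slotJoint, hi, Slot.kink]; rfl⟩
          | exact ⟨Sum.inl (finRotate l.length k, true), by
              simp only [Sum.elim_inl, slotJoint, hi, Slot.kink]; rfl⟩
      case Q =>
        cases hi : l.get (finRotate l.length k)
        all_goals
          first
          | exact ⟨Sum.inr (Sum.inl (finRotate l.length k)), by
              simp only [Sum.elim_inl, Sum.elim_inr, slotCrossing, hi, Slot.positive]; rfl⟩
          | exact ⟨Sum.inr (Sum.inr (finRotate l.length k)), by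
              simp only [Sum.elim_inr, slotCrossing, hi, Slot.positive, Crossing.overOut]; rfl⟩
      case L =>
        cases hi : l.get k
        all_goals
          first
          | exact ⟨Sum.inr (Sum.inl k), by
              simp only [Sum.elim_inl, Sum.elim_inr, slotCrossing, hi, Slot.positive]; rfl⟩
          | exact ⟨Sum.inr (Sum.inr k), by
              simp only [Sum.elim_inr, slotCrossing, hi, Slot.positive, Crossing.overOut]; rfl⟩
      case R =>
        cases hi : l.get k
        all_goals
          first
          | exact ⟨Sum.inl (k, false), by simp only [Sum.elim_inl, slotJoint, hi, Slot.kink]; rfl⟩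
          | exact ⟨Sum.inl (k, true), by simp only [Sum.elim_inl, slotJoint, hi, Slot.kink]; rfl⟩

/-- The standard diagram of the negative torus link `T*_{2,n}`: the closure of `n` negative
crossings. -/
def torusLink (n : ℕ) : Diagram := closure (List.replicate n Slot.neg)

/-! ### The chain maps of the elementary moves

All moves take place in the bottom pieces of a stack. -/

/-- The marked point `m` of the piece `i`. -/
def pt {l : List Slot} (i : Fin l.length) (m : Mark) : (closure l).Pt := (i, m)

/-- The marked points of a stack, as marked points of the stack with a new bottom piece. -/
def raise {l : List Slot} (x : Slot) (p : (closure l).Pt) : (closure (x :: l)).Pt :=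
  (Fin.succ p.1, p.2)

/-- The marked points of a stack with bottom piece `x`, as points of the stack without it, if `x`
is a kink: the strands through `x` are contracted. -/
def lower {l : List Slot} (x y : Slot) (p : (closure (x :: y :: l)).Pt) : (closure (y :: l)).Pt :=
  (Fin.cases (0 : Fin (l.length + 1)) id p.1,
    Fin.cases (motive := fun _ => Mark) (if p.2 matches .R then .R else .L) (fun _ => p.2) p.1)

/-- The state that resolves the new bottom piece by `b` and the others by `s`. -/
def consState {l : List Slot} (x : Slot) (b : Bool) (s : (closure l).State) :
    (closure (x :: l)).State :=
  Fin.cons (α := fun _ => Bool) b s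

/-- The resolution of the bottom piece. -/
def headState {l : List Slot} {x : Slot} (s : (closure (x :: l)).State) : Bool :=
  s (0 : Fin (l.length + 1))

/-- The resolutions of the pieces above the bottom piece. -/
def tailState {l : List Slot} {x : Slot} (s : (closure (x :: l)).State) : (closure l).State :=
  fun i => s (Fin.succ i)

section Moves

variable {R : Type*} [CommRing R] (h t : R)

/-- The map of the R1 move from the crossingless unknot to the closure of one negative crossing.
The unknot becomes the left circle of the `1`-resolution, and the right circle is born. -/
noncomputable def mapR1Unknot : Chain h t unknot →ₗ[R] Chain h t (torusLink 1) :=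
  LinearMap.pi fun s' =>
    if headState s' = true then
      (carry h t unknot (torusLink 1) (fun _ => pt (l := [.neg]) 0 .L) Fin.elim0 s').toLinearMap ∘ₗ
        LinearMap.proj Fin.elim0
    else 0

/-- The map of the R1 move that adds a negative kink: in its `1`-resolution, the circle of the loop
is born. -/
noncomputable def mapR1 (l : List Slot) :
    Chain h t (closure l) →ₗ[R] Chain h t (closure (.negKink :: l)) :=
  LinearMap.pi fun s' =>
    if headState s' = true then
      (carry h t (closure l) (closure (.negKink :: l)) (raise .negKink)
        (tailState s') s').toLinearMap ∘ₗ LinearMap.proj (tailState s')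
    else 0

/-- The map of the inverse R1 move that removes a positive kink: in its `0`-resolution, the circle
of the loop dies. -/
noncomputable def mapR1Inv (x : Slot) (l : List Slot) :
    Chain h t (closure (.posKink :: x :: l)) →ₗ[R] Chain h t (closure (x :: l)) :=
  LinearMap.pi fun s =>
    let s' := consState .posKink false s
    (carry h t (closure (.posKink :: x :: l)) (closure (x :: l)) (lower .posKink x)
        s' s).toLinearMap ∘ₗ
      counitAt h t ((closure (.posKink :: x :: l)).circle s' (pt (l := .posKink :: x :: l)
        (0 : Fin (l.length + 2)) .P)) ∘ₗ
      LinearMap.proj s'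

/-- The map of the R2 move that adds a positive crossing and a negative crossing above it. To the
resolution of both into two vertical strands it is the identity. To the resolution of both into a
lower and an upper arc, with a circle in between, it is the saddle map followed by the birth of that
circle. -/
noncomputable def mapR2 (x : Slot) (l : List Slot) :
    Chain h t (closure (x :: l)) →ₗ[R] Chain h t (closure (.pos :: .neg :: x :: l)) :=
  let D := closure (x :: l)
  let D' := closure (.pos :: .neg :: x :: l)
  LinearMap.pi fun s' =>
    let s := tailState (tailState s')
    if headState s' = false ∧ headState (tailState s') = true then
      (carry h t D D' (fun p => raise .pos (raise .neg p)) s s').toLinearMap ∘ₗ LinearMap.proj s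
    else if headState s' = true ∧ headState (tailState s') = false then
      saddle h t D D' (fun p => raise .pos (raise .neg p)) s s'
          (pt (l := x :: l) (0 : Fin (l.length + 1)) .L)
          (pt (l := x :: l) (0 : Fin (l.length + 1)) .R)
          (pt (l := .pos :: .neg :: x :: l) (0 : Fin (l.length + 3)) .L)
          (pt (l := .pos :: .neg :: x :: l) (2 : Fin (l.length + 3)) .L) ∘ₗ
        LinearMap.proj s
    else 0

/-- The map of the saddle move to the right of the bottom crossing, that exchanges a crossing and a
kink of the same sign (`x` and `y`). -/
noncomputable def mapSaddle (x y : Slot) (l : List Slot) :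
    Chain h t (closure (x :: l)) →ₗ[R] Chain h t (closure (y :: l)) :=
  LinearMap.pi fun s =>
    saddle h t (closure (x :: l)) (closure (y :: l)) id s s
        (pt (l := x :: l) (0 : Fin (l.length + 1)) .R)
        (pt (l := x :: l) (0 : Fin (l.length + 1)) .Q)
        (pt (l := y :: l) (0 : Fin (l.length + 1)) .R)
        (pt (l := y :: l) (0 : Fin (l.length + 1)) .Q) ∘ₗ
      LinearMap.proj s

/-- The crossing change map `f₀` of lowest homological degree, from positive to negative, at the
bottom crossing. Both the `1`-resolution of the positive crossing and the `0`-resolution of the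
negative crossing consist of a lower and an upper arc; between these, `f₀` is the difference of a
dot on one arc and a dot on the other, in the order given by the direction `up`. -/
noncomputable def mapCrossingChange (up : Bool) (l : List Slot) :
    Chain h t (closure (.pos :: l)) →ₗ[R] Chain h t (closure (.neg :: l)) :=
  let D := closure (.pos :: l)
  let D' := closure (.neg :: l)
  LinearMap.pi fun s' =>
    if headState s' = false then
      let s := consState .pos true (tailState s')
      let lo := dot h t (D'.circle s' (pt (l := .neg :: l) (0 : Fin (l.length + 1)) .P))
      let hi := dot h t (D'.circle s' (pt (l := .neg :: l) (0 : Fin (l.length + 1)) .Q))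
      LinearMap.mulLeft R (if up then lo - hi else hi - lo) ∘ₗ
        (carry h t D D' id s s').toLinearMap ∘ₗ LinearMap.proj s
    else 0

/-! ### The immersed cobordism -/

/-- The two kinds of steps from `T*_{2,n}` to `T*_{2,n+2}`: the embedded cobordism of genus one,
and the immersed cobordism of genus zero with one negative double point, with a direction. -/
inductive Step
  | embedded
  | immersed (up : Bool)

/-- Does the step have a double point? -/
def Step.isImmersed : Step → Bool
  | embedded => false
  | immersed _ => true

/-- The chain map of lowest homological degree of one step. Both kinds begin with an R2 move. The
embedded one continues with a saddle that turns the positive crossing into a kink, the removal of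
this kink, the creation of a negative kink, and a saddle that turns it into a crossing. The
immersed one continues with a crossing change from positive to negative. -/
noncomputable def mapStep (S : Step) (n : ℕ) :
    Chain h t (torusLink (n + 1)) →ₗ[R] Chain h t (torusLink (n + 3)) :=
  let l := List.replicate n Slot.neg
  match S with
  | .embedded =>
    mapSaddle h t .negKink .neg (.neg :: .neg :: l) ∘ₗ mapR1 h t (.neg :: .neg :: l) ∘ₗ
      mapR1Inv h t .neg (.neg :: l) ∘ₗ mapSaddle h t .pos .posKink (.neg :: .neg :: l) ∘ₗ
      mapR2 h t .neg l
  | .immersed up => mapCrossingChange h t up (.neg :: .neg :: l) ∘ₗ mapR2 h t .neg l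

/-- The chain map of lowest homological degree of the immersed cobordism from the unknot to
`T*_{2,2k+1}` that consists of an R1 move and the steps `S 0, …, S (k - 1)`. -/
noncomputable def mapLow : (k : ℕ) → (Fin k → Step) →
    (Chain h t unknot →ₗ[R] Chain h t (torusLink (2 * k + 1)))
  | 0, _ => mapR1Unknot h t
  | k + 1, S => mapStep h t (S (Fin.last k)) (2 * k) ∘ₗ mapLow k (fun i => S i.castSucc)

end Moves

end Khovanov

/-! A resolution of the closed negative braid is a cyclic word of horizontal (`0`) and vertical
(`1`) crossings. If some crossing is horizontal, the circles are the strands between cyclically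
consecutive horizontal crossings, and turning a horizontal crossing vertical merges the two strands
that meet there. The only exceptions are the edges into the all-vertical resolution, where one
circle splits into two. The degree is minus the number of horizontal crossings. Write `x_i` for the
dot on the circle through the lower left end of crossing `i`.

Cycles at one vertex: an element killed by the merge at `q` is a multiple of `x_q - x_{q+1}`. Hence
an element killed by the merges at all horizontal crossings other than a base crossing `p` is a
label `a ∈ A` on the strand at `p` times the product of the differences `x_r - x_{r+1}`
(`exists_eq_strandClass`), and `a` is unique (`strandClass_injective`). Because `(x - y)(x + y - h)
= 0`, passing a horizontal crossing replaces `x` by `h - x` on such a product. If the number of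
horizontal crossings is even, the merge at `p` therefore kills the element too
(`merge_strandClass`). A merge at the base crossing that goes from an odd to an even number produces
the additional factor `x_p - x_{p+1}`, which acts as `2x_p - h`, that is, as `U`
(`exists_merge_strandClass_update`).

Reduction to one vertex: every merge is split surjective, so the part of the cube where `p` is
horizontal and the crossings of `W` are vertical is exact except in its lowest degree
(`exists_differential_eq`). Consequently a cycle can be moved by boundaries to any one vertex of its
degree, and a chain whose boundary sits at one vertex can be moved to a neighbour of that vertex
(`exists_sub_differential`). With the previous paragraph, the homology in degree `-2m` is `A / Im U`
for `m > 0`; a vertical crossing is needed here, and exists because the number of crossings is odd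
(`single_strandClass_mem_range_iff`). For `m = 0` only the all-vertical vertex is left, and `A ⊗ A`
modulo the image of the comultiplication is `A` (`single_label_mem_range_iff`).

The cobordism: the R1 move puts the label on the left circle of the all-vertical resolution. An
embedded step adds two vertical crossings and changes nothing else (`embedded_apply`). An immersed
step adds two horizontal crossings and multiplies by `x_0 - x_1`, up to sign, and by the factor of
the R2 saddle, which is `1` or `x_0 + x_2 - h` (`exists_immersed_apply`). In the second case the
identity `(x_0 - x_1)(x_0 + x_2 - h) = -(x_0 - x_1)(x_1 - x_2)` shows that the result has precisely
the two new difference factors. So already on chains the image is the whole family of cycles above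
at one vertex (`isLowRange_mapLow`), and that family generates the homology of its degree. As the
complex of the unknot has zero differential, it suffices for the chain map property that the image
consists of cycles. -/

namespace Khovanov

/-! ### Tensor powers of `A`: generation by dots, and the counit. -/

section Algebra

variable {R : Type*} [CommRing R] {h t : R}

lemma genX_mul_genX : genX h t * genX h t =
    algebraMap R (FrobAlg R h t) t + algebraMap R (FrobAlg R h t) h * genX h t := by
  ext <;> simp [genX]

lemma dot_mul_dot {ι : Type} (c : ι) : dot h t c * dot h t c =
    algebraMap R (TensorPow h t ι) t + algebraMap R (TensorPow h t ι) h * dot h t c := by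
  simp only [dot, ← map_mul, genX_mul_genX, map_add, AlgHom.commutes]
  rw [map_mul, AlgHom.commutes]

lemma FrobAlg.algHom_ext {B : Type*} [Ring B] [Algebra R B] {f g : FrobAlg R h t →ₐ[R] B}
    (hfg : f (genX h t) = g (genX h t)) : f = g :=
  QuadraticAlgebra.algHom_ext hfg

/-- The algebra map out of `A` that sends `X` to `y`. -/
def liftX {B : Type*} [CommRing B] [Algebra R B] (y : B)
    (hy : y * y = algebraMap R B t + algebraMap R B h * y) : FrobAlg R h t →ₐ[R] B :=
  QuadraticAlgebra.lift ⟨y, by rw [hy, Algebra.smul_def, Algebra.smul_def, mul_one]⟩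

lemma liftX_genX {B : Type*} [CommRing B] [Algebra R B] (y : B)
    (hy : y * y = algebraMap R B t + algebraMap R B h * y) :
    liftX (h := h) (t := t) y hy (genX h t) = y := by
  simp [liftX, QuadraticAlgebra.lift, genX]

lemma TensorPow.algHom_ext {ι : Type} [Finite ι] {B : Type*} [Ring B] [Algebra R B]
    {f g : TensorPow h t ι →ₐ[R] B} (hfg : ∀ c, f (dot h t c) = g (dot h t c)) : f = g := by
  classical
  refine PiTensorProduct.algHom_ext (R := R) (A := fun _ : ι => FrobAlg R h t) fun c => ?_
  refine FrobAlg.algHom_ext ?_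
  have := hfg c
  unfold dot label at this
  convert this using 1 <;> rfl

open Classical in
lemma label_eq_tprod {ι : Type} (c : ι) (a : FrobAlg R h t) :
    label h t c a = PiTensorProduct.tprod R (Pi.mulSingle c a : ι → FrobAlg R h t) := rfl

/-- The algebra map out of `A^{⊗ι}` that sends the dot on `c` to `y c`. -/
noncomputable def liftDots {ι : Type} [Finite ι] {B : Type*} [CommRing B] [Algebra R B] (y : ι → B)
    (hy : ∀ c, y c * y c = algebraMap R B t + algebraMap R B h * y c) :
    TensorPow h t ι →ₐ[R] B :=
  letI := Fintype.ofFinite ι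
  PiTensorProduct.liftAlgHom (S := B)
    ((MultilinearMap.mkPiAlgebra R ι B).compLinearMap fun i =>
      (liftX (h := h) (t := t) (y i) (hy i)).toLinearMap)
    (by simp [MultilinearMap.mkPiAlgebra_apply])
    (by intro x y; simp [MultilinearMap.mkPiAlgebra_apply, Finset.prod_mul_distrib])

lemma liftDots_dot {ι : Type} [Finite ι] {B : Type*} [CommRing B] [Algebra R B] (y : ι → B)
    (hy : ∀ c, y c * y c = algebraMap R B t + algebraMap R B h * y c) (c : ι) :
    liftDots y hy (dot h t c) = y c := by
  classical
  let := Fintype.ofFinite ι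
  have h1 : liftDots y hy (dot h t c) = ∏ i, liftX (h := h) (t := t) (y i) (hy i)
      ((Pi.mulSingle c (genX h t) : ι → FrobAlg R h t) i) := by
    rw [dot, label_eq_tprod]
    exact PiTensorProduct.lift.tprod _
  rw [h1, Finset.prod_eq_single c]
  · rw [Pi.mulSingle_eq_same, liftX_genX]
  · intro b _ hb
    rw [Pi.mulSingle_eq_of_ne hb, map_one]
  · simp

lemma push_label {ι κ : Type} [Finite ι] (f : ι → κ) (c : ι) (a : FrobAlg R h t) :
    push h t f (label h t c a) = label h t (f c) a := by
  classical
  let := Fintype.ofFinite ι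
  have h1 : push h t f (label h t c a) = ∏ i, label h t (f i)
      ((Pi.mulSingle c a : ι → FrobAlg R h t) i) := by
    rw [label_eq_tprod]
    exact PiTensorProduct.lift.tprod _
  rw [h1, Finset.prod_eq_single c]
  · rw [Pi.mulSingle_eq_same]
  · intro b _ hb
    rw [Pi.mulSingle_eq_of_ne hb, map_one]
  · simp

lemma push_dot {ι κ : Type} [Finite ι] (f : ι → κ) (c : ι) :
    push h t f (dot h t c) = dot h t (f c) := push_label f c _

/-- The universal property gives a map into the subalgebra that fixes the dots. Followed by the
inclusion it is the identity, so the inclusion is onto. -/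
lemma TensorPow.adjoin_dots {ι : Type} [Finite ι] :
    Algebra.adjoin R (Set.range (dot h t (ι := ι))) = ⊤ := by
  set S := Algebra.adjoin R (Set.range (dot h t (ι := ι))) with hS
  let f : TensorPow h t ι →ₐ[R] S :=
    liftDots (fun c => ⟨dot h t c, Algebra.subset_adjoin ⟨c, rfl⟩⟩)
      (fun c => Subtype.ext (dot_mul_dot c))
  have hf : S.val.comp f = AlgHom.id R _ :=
    TensorPow.algHom_ext fun c => by simp [f, liftDots_dot]
  refine eq_top_iff.2 fun v _ => ?_
  have := DFunLike.congr_fun hf v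
  rw [AlgHom.comp_apply, AlgHom.id_apply] at this
  rw [← this]
  exact (f v).2

/-- Induction on elements of `A^{⊗ι}`: it is generated by dots. -/
lemma TensorPow.induction {ι : Type} [Finite ι] {P : TensorPow h t ι → Prop}
    (v : TensorPow h t ι) (halg : ∀ r, P (algebraMap R _ r)) (hdot : ∀ c, P (dot h t c))
    (hadd : ∀ v w, P v → P w → P (v + w)) (hmul : ∀ v w, P v → P w → P (v * w)) : P v := by
  have hv : v ∈ Algebra.adjoin R (Set.range (dot h t (ι := ι))) := by
    rw [TensorPow.adjoin_dots]; trivial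
  induction hv using Algebra.adjoin_induction with
  | mem x hx => obtain ⟨c, rfl⟩ := hx; exact hdot c
  | algebraMap r => exact halg r
  | add x y _ _ hx hy => exact hadd x y hx hy
  | mul x y _ _ hx hy => exact hmul x y hx hy

/-- The counit acts only in the tensor factor of `c`, so it is linear over labels in the other
factors. This is what allows a capped circle to be evaluated separately from the rest. -/
lemma counitAt_label_mul_of_ne {ι : Type} {c d : ι} (hcd : d ≠ c) (a : FrobAlg R h t)
    (v : TensorPow h t ι) :
    counitAt h t c (label h t d a * v) = label h t d a * counitAt h t c v := by
  classical
  suffices H : (counitAt h t c) ∘ₗ LinearMap.mulLeft R (label h t d a) =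
      LinearMap.mulLeft R (label h t d a) ∘ₗ counitAt h t c from LinearMap.congr_fun H v
  refine PiTensorProduct.ext (R := R) (s := fun _ : ι => FrobAlg R h t) ?_
  refine MultilinearMap.ext fun m => ?_
  change PiTensorProduct.map _ (PiTensorProduct.tprod R (Pi.mulSingle d a : ι → FrobAlg R h t) *
    PiTensorProduct.tprod R m) = PiTensorProduct.tprod R (Pi.mulSingle d a : ι → FrobAlg R h t) *
      PiTensorProduct.map _ (PiTensorProduct.tprod R m)
  rw [PiTensorProduct.tprod_mul_tprod, PiTensorProduct.map_tprod, PiTensorProduct.map_tprod,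
    PiTensorProduct.tprod_mul_tprod]
  congr 1
  funext j
  by_cases hjc : j = c
  · subst hjc
    simp [Pi.mulSingle_eq_of_ne (Ne.symm hcd)]
  · simp [hjc]

lemma counitAt_one {ι : Type} (c : ι) : counitAt h t c (1 : TensorPow h t ι) = 0 := by
  classical
  change PiTensorProduct.map _ (PiTensorProduct.tprod R (1 : ι → FrobAlg R h t)) = _
  rw [PiTensorProduct.map_tprod]
  refine MultilinearMap.map_coord_zero _ c ?_
  ext <;> simp [counit, QuadraticAlgebra.im_one]

lemma counitAt_dot {ι : Type} (c : ι) : counitAt h t c (dot h t c) = 1 := by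
  classical
  rw [dot, label_eq_tprod]
  change PiTensorProduct.map _ (PiTensorProduct.tprod R _) = PiTensorProduct.tprod R 1
  rw [PiTensorProduct.map_tprod]
  congr 1
  funext j
  by_cases hj : j = c
  · subst hj
    simp [counit, genX]
  · simp [hj]

end Algebra

/-! ### The cyclic order of the crossings. -/

section Cyclic

/-- The cyclic distance from the successor of `p`. -/
lemma exists_cyclicDist {n : ℕ} (p : Fin n) : ∃ d : Fin n → ℕ, Function.Injective d ∧
    d (finRotate n p) = 0 ∧ (∀ i, i ≠ p → d (finRotate n i) = d i + 1) ∧ ∀ i, d i ≤ d p := by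
  obtain _ | m := n
  · exact p.elim0
  refine ⟨fun i => (i - (p + 1)).val, fun i j hij => ?_, ?_, fun i hi => ?_, fun i => ?_⟩
  · simpa using Fin.val_injective hij
  · simp
  · have h1 : finRotate (m + 1) i - (p + 1) = (i - (p + 1)) + 1 := by
      rw [finRotate_apply]; abel
    have h2 : i - (p + 1) ≠ Fin.last m := by
      intro h3
      apply hi
      have h4 : i - (p + 1) + 1 = 0 := by rw [h3]; simp
      have : i - p = 0 := by rw [← h4]; abel
      exact sub_eq_zero.1 this
    change (finRotate (m + 1) i - (p + 1)).val = _
    rw [h1, Fin.val_add_one, if_neg h2]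
  · have : p - (p + 1) = Fin.last m := by
      have h4 : p - (p + 1) + 1 = 0 := by abel
      have h5 : Fin.last m + 1 = 0 := by simp
      exact add_right_cancel (h4.trans h5.symm)
    change (i - (p + 1)).val ≤ (p - (p + 1)).val
    rw [this]
    exact Fin.le_last _

/-- Induction around the closed braid, cut open just above `p`: no step is required at `p` itself.
-/
lemma finRotate_induction {n : ℕ} {P : Fin n → Prop} (p : Fin n) (h0 : P (finRotate n p))
    (hs : ∀ i, i ≠ p → P i → P (finRotate n i)) (i : Fin n) : P i := by
  obtain ⟨d, hinj, hd0, hds, hdp⟩ := exists_cyclicDist p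
  induction hk : d i using Nat.strong_induction_on generalizing i with
  | _ k ih =>
    obtain ⟨j, rfl⟩ := (finRotate n).surjective i
    by_cases hj : j = p
    · rwa [hj]
    · exact hs j hj (ih _ (by rw [← hk, hds j hj]; omega) j rfl)

lemma finRotate_induction' {n : ℕ} {P : Fin n → Prop} (p : Fin n) (h0 : P p)
    (hs : ∀ i, P i → P (finRotate n i)) (i : Fin n) : P i :=
  finRotate_induction p (hs p h0) (fun i _ => hs i) i

/-- The band of positions from the successor of `p` up to the next position `q` outside `W`. -/
structure IsBand {n : ℕ} (W : Finset (Fin n)) (p q : Fin n) (B : Set (Fin n)) : Prop where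
  notMem : q ∉ W
  ne : q ≠ p
  succ_mem : finRotate n p ∈ B
  top_mem : q ∈ B
  bot_notMem : p ∉ B
  succ_notMem : finRotate n q ∉ B
  iff_succ : ∀ i, i ≠ p → i ≠ q → (i ∈ B ↔ finRotate n i ∈ B)
  mem_of_mem : ∀ i ∈ B, i ≠ q → i ∈ W

/-- Take for `q` the position outside `W` nearest to the successor of `p` in cyclic distance, and
for the band the positions that are at most as far as `q`. -/
lemma exists_isBand {n : ℕ} {W : Finset (Fin n)} {p : Fin n} (h : ∃ j, j ≠ p ∧ j ∉ W) :
    ∃ q B, IsBand W p q B := by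
  obtain ⟨d, hinj, hd0, hds, hdp⟩ := exists_cyclicDist p
  obtain ⟨j, hjp, hjW⟩ := h
  obtain ⟨q, hq, hmin⟩ := Finset.exists_min_image Wᶜ d ⟨j, by simpa using hjW⟩
  rw [Finset.mem_compl] at hq
  have hmin' : ∀ i, i ∉ W → d q ≤ d i := fun i hi => hmin i (by simpa using hi)
  have hqp : q ≠ p := by
    -- The position `p` has the largest distance of all, so it could only be nearest if no other
    -- position were outside `W`.
    rintro rfl
    exact hjp (hinj (le_antisymm (hdp j) (hmin' j hjW)))
  have hdq : d q < d p := lt_of_le_of_ne (hdp q) fun h => hqp (hinj h)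
  refine ⟨q, {i | d i ≤ d q}, hq, hqp, ?_, le_refl (d q), ?_, ?_, ?_, ?_⟩
  · simp only [Set.mem_ofPred_eq, hd0, zero_le]
  · simpa using hdq
  · simp only [Set.mem_ofPred_eq, hds q hqp]; omega
  · intro i hi hiq
    have : d i ≠ d q := fun h => hiq (hinj h)
    simp only [Set.mem_ofPred_eq, hds i hi]
    omega
  · intro i hi hiq
    by_contra hiW
    exact hiq (hinj (le_antisymm hi (hmin' i hiW)))

end Cyclic

/-! ### Circles of a resolution, detected by locally constant functions. -/

section Circles

/-- The generating relation of the circles of a resolution. -/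
def Diagram.Joined (D : Diagram) (s : D.State) (p q : D.Pt) : Prop :=
  (∃ j, D.joint j = (p, q)) ∨ ∃ i, (D.crossing i).joins (s i) p q

lemma Diagram.Joined.circle_eq {D : Diagram} {s : D.State} {p q : D.Pt} (h : D.Joined s p q) :
    D.circle s p = D.circle s q :=
  Quotient.sound (Relation.EqvGen.rel _ _ h)

/-- The main tool for circles. With `g` the circle map of another resolution it shows that circles
are carried to circles; with `g` a predicate it shows that two circles are different. -/
lemma Diagram.eq_of_circle_eq {D : Diagram} {s : D.State} {β : Sort*} {g : D.Pt → β}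
    (hg : ∀ p q, D.Joined s p q → g p = g q) {p q : D.Pt} (h : D.circle s p = D.circle s q) :
    g p = g q := by
  have h' : Relation.EqvGen (D.Joined s) p q := Quotient.exact h
  induction h' with
  | rel _ _ h1 => exact hg _ _ h1
  | refl => rfl
  | symm _ _ h1 ih => exact (ih (Quotient.sound h1)).symm
  | trans _ _ _ h1 h2 ih1 ih2 => exact (ih1 (Quotient.sound h1)).trans (ih2 (Quotient.sound h2))

/-- A function `g` on the marked points of a piece, with values `gL` and `gR` at its upper ends, is
constant on the components of the resolution `b` of the piece. -/
def SlotConst {β : Sort*} (x : Slot) (b : Bool) (g : Mark → β) (gL gR : β) : Prop :=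
  (if x.kink then g .R = gR ∧ g .Q = g .P else g .R = g .P ∧ g .Q = gR) ∧
  (if b = x.positive then g .L = g .P ∧ g .Q = gL else g .P = g .Q ∧ g .L = gL)

/-- Every generating relation stays within one piece and the lower ends of the next, so being
constant on circles can be tested one piece at a time. -/
lemma closure_const_iff {l : List Slot} {s : (closure l).State} {β : Sort*}
    {g : (closure l).Pt → β} : (∀ p q, (closure l).Joined s p q → g p = g q) ↔
    ∀ i : Fin l.length, SlotConst (l.get i) (s i) (fun m => g (i, m)) (g (finRotate _ i, .L))
      (g (finRotate _ i, .R)) := by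
  constructor
  · intro H i
    have hj : ∀ b, g (slotJoint (l.get i) i b).1 = g (slotJoint (l.get i) i b).2 :=
      fun b => H _ _ (Or.inl ⟨(i, b), rfl⟩)
    have hc : ∀ p q, (slotCrossing (l.get i) i).joins (s i) p q → g p = g q :=
      fun p q h => H _ _ (Or.inr ⟨i, h⟩)
    have h1 := hj false
    have h2 := hj true
    generalize s i = b at hc ⊢
    revert h1 h2 hc
    cases l.get i <;> cases b <;>
      simp +contextual [SlotConst, slotJoint, slotCrossing, Slot.kink, Slot.positive,
        Crossing.joins, -finRotate_apply] <;> grind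
  · rintro H p q (⟨⟨i, b⟩, hj⟩ | ⟨(i : Fin l.length), hc⟩)
    · have hi := H i
      change slotJoint (l.get i) i b = (p, q) at hj
      obtain ⟨rfl, rfl⟩ := Prod.ext_iff.1 hj
      clear H
      revert hi
      generalize s i = b'
      cases l.get i <;> cases b <;> cases b' <;>
        simp only [SlotConst, slotJoint, Slot.kink, Slot.positive, if_true,
          reduceIte, Bool.false_eq_true, reduceCtorEq] <;>
        rintro ⟨⟨h1, h2⟩, h3, h4⟩ <;> first | exact h1 | exact h2
    · have hi := H i
      change (slotCrossing (l.get i) i).joins (s i) p q at hc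
      clear H
      revert hi hc
      generalize s i = b'
      cases l.get i <;> cases b' <;>
        simp only [SlotConst, slotCrossing, Slot.kink, Slot.positive, Crossing.joins, if_true,
          reduceIte, Bool.false_eq_true, reduceCtorEq] <;>
        rintro ⟨⟨h1, h2⟩, h3, h4⟩ (⟨rfl, rfl⟩ | ⟨rfl, rfl⟩) <;> grind

lemma closure_eq_of_circle_eq {l : List Slot} {s : (closure l).State} {β : Sort*}
    {g : (closure l).Pt → β}
    (hg : ∀ i : Fin l.length, SlotConst (l.get i) (s i) (fun m => g (i, m))
      (g (finRotate _ i, .L)) (g (finRotate _ i, .R)))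
    {p q : (closure l).Pt} (h : (closure l).circle s p = (closure l).circle s q) : g p = g q :=
  Diagram.eq_of_circle_eq (closure_const_iff.2 hg) h

lemma circle_slotConst {l : List Slot} (s : (closure l).State) (i : Fin l.length) :
    SlotConst (l.get i) (s i) (fun m => (closure l).circle s (i, m))
      ((closure l).circle s (finRotate _ i, .L)) ((closure l).circle s (finRotate _ i, .R)) :=
  closure_const_iff.1 (fun _ _ h => h.circle_eq) i

end Circles

/-! ### Induced maps on dots. -/

section Carry

variable {R : Type*} [CommRing R] {h t : R}

/-- The map `carry` evaluates `f` at an arbitrary representative of each circle. The factor `e`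
covers the case of a split, where `f` does not respect circles but multiplication by the
comultiplication factor removes the dependence on the representative. -/
lemma mul_carry_dot {D D' : Diagram} {f : D.Pt → D'.Pt} {s : D.State} {s' : D'.State}
    {e : TensorPow h t (D'.Circle s')}
    (H : ∀ p q, D.Joined s p q →
      e * dot h t (D'.circle s' (f p)) = e * dot h t (D'.circle s' (f q))) (p : D.Pt) :
    e * carry h t D D' f s s' (dot h t (D.circle s p)) = e * dot h t (D'.circle s' (f p)) := by
  rw [carry, push_dot]
  exact Diagram.eq_of_circle_eq (g := fun p => e * dot h t (D'.circle s' (f p))) H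
    (Quotient.out_eq (D.circle s p))

lemma carry_dot {D D' : Diagram} {f : D.Pt → D'.Pt} {s : D.State} {s' : D'.State}
    (H : ∀ p q, D.Joined s p q → D'.circle s' (f p) = D'.circle s' (f q)) (p : D.Pt) :
    carry h t D D' f s s' (dot h t (D.circle s p)) = dot h t (D'.circle s' (f p)) := by
  have := mul_carry_dot (h := h) (t := t) (e := 1) (fun p q hpq => by rw [H p q hpq]) p
  simpa using this

end Carry

/-! ### Circles of stacks without kinks. -/

section Braids

variable {l : List Slot} (hk : ∀ i : Fin l.length, (l.get i).kink = false)
  {s : (closure l).State}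

include hk

lemma circle_of_vertical {i : Fin l.length} (hi : s i ≠ (l.get i).positive) :
    (closure l).circle s (i, .L) = (closure l).circle s (finRotate _ i, .L) ∧
    (closure l).circle s (i, .R) = (closure l).circle s (finRotate _ i, .R) ∧
    (closure l).circle s (i, .P) = (closure l).circle s (i, .R) ∧
    (closure l).circle s (i, .Q) = (closure l).circle s (i, .R) := by
  have h := circle_slotConst s i
  rw [SlotConst, if_neg hi, hk i] at h
  obtain ⟨⟨h1, h2⟩, h3, h4⟩ := h
  exact ⟨h4, h1.trans (h3.trans h2), h1.symm, (h1.trans h3).symm⟩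

lemma circle_of_horizontal {i : Fin l.length} (hi : s i = (l.get i).positive) :
    (closure l).circle s (i, .R) = (closure l).circle s (i, .L) ∧
    (closure l).circle s (i, .P) = (closure l).circle s (i, .L) ∧
    (closure l).circle s (i, .Q) = (closure l).circle s (finRotate _ i, .L) ∧
    (closure l).circle s (finRotate _ i, .R) = (closure l).circle s (finRotate _ i, .L) := by
  have h := circle_slotConst s i
  rw [SlotConst, if_pos hi, hk i] at h
  obtain ⟨⟨h1, h2⟩, h3, h4⟩ := h
  exact ⟨h1.trans h3.symm, h3.symm, h4, h2.symm.trans h4⟩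

/-- A function of the height is constant on circles if it is constant along the vertical
resolutions. -/
lemma eq_of_circle_eq_of_vertical {β : Sort*} {y : Fin l.length → β}
    (hy : ∀ i, s i ≠ (l.get i).positive → y i = y (finRotate _ i)) {i j : Fin l.length}
    {m m' : Mark} (hm : m ≠ .Q) (hm' : m' ≠ .Q)
    (h : (closure l).circle s (i, m) = (closure l).circle s (j, m')) : y i = y j := by
  have := closure_eq_of_circle_eq (s := s)
    -- The corner `Q` lies above its crossing and is given the height of the next piece.
    (g := fun p => y (if p.2 matches .Q then finRotate _ p.1 else p.1)) (fun i => ?_) h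
  · cases m <;> cases m' <;> simp_all
  · rw [SlotConst, hk i]
    by_cases hi : s i = (l.get i).positive
    · rw [if_pos hi]; simp
    · rw [if_neg hi]; simpa using (hy i hi)

/-- A horizontal crossing joins left and right just below and just above itself. The vertical
crossings above transport this relation until the next horizontal one. -/
lemma circle_R_eq_L (h0 : ∃ i, s i = (l.get i).positive) (i : Fin l.length) :
    (closure l).circle s (i, .R) = (closure l).circle s (i, .L) := by
  obtain ⟨z, hz⟩ := h0
  refine finRotate_induction' (P := fun i => (closure l).circle s (i, .R) =
    (closure l).circle s (i, .L)) z (circle_of_horizontal hk hz).1 (fun i hi => ?_) i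
  by_cases hv : s i = (l.get i).positive
  · exact (circle_of_horizontal hk hv).2.2.2
  · have := circle_of_vertical hk hv
    rw [← this.1, ← this.2.1, hi]

lemma circle_eq_L (h0 : ∃ i, s i = (l.get i).positive) (p : (closure l).Pt) :
    (closure l).circle s p =
      (closure l).circle s ((if p.2 matches .Q then finRotate _ p.1 else p.1), .L) := by
  obtain ⟨i, m⟩ := p
  have hR := circle_R_eq_L hk h0 i
  by_cases hv : s i = (l.get i).positive
  · have := circle_of_horizontal hk hv
    cases m
    · rfl
    · exact hR
    · exact this.2.1
    · exact this.2.2.1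
  · have := circle_of_vertical hk hv
    cases m
    · rfl
    · exact hR
    · exact this.2.2.1.trans hR
    · exact this.2.2.2.trans (hR.trans this.1)

omit hk in
-- If everything is vertical, the left side of the braid is constant along each circle, and it tells
-- the two ends apart.
lemma circle_L_ne_R (hs : ∀ i, s i ≠ (l.get i).positive) (i j : Fin l.length) :
    (closure l).circle s (i, .L) ≠ (closure l).circle s (j, .R) := by
  intro h
  have := closure_eq_of_circle_eq (s := s) (g := fun p => p.2 matches .L) (fun i => ?_) h
  · simp at this
  · rw [SlotConst, if_neg (hs i)]
    split_ifs <;> simp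

end Braids

/-- The properties of the resolutions of the closure of a negative 2-braid that are needed to
compute its homology. The points `pL i` and `pR i` are the lower ends of the `i`-th crossing. -/
structure Diagram.IsNegTwoBraid (D : Diagram) (pL pR : Fin D.n → D.Pt) : Prop where
  positive_eq : ∀ i, (D.crossing i).positive = false
  a_eq : ∀ i, (D.crossing i).a = pL i
  circle_c_zero : ∀ s i, s i = false → D.circle s (D.crossing i).c = D.circle s (pL (finRotate _ i))
  circle_c_one : ∀ s i, s i = true → D.circle s (D.crossing i).c = D.circle s (pR i)
  circle_L : ∀ s i, s i = true → D.circle s (pL i) = D.circle s (pL (finRotate _ i))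
  circle_R : ∀ s i, s i = true → D.circle s (pR i) = D.circle s (pR (finRotate _ i))
  const : ∀ s (y : Fin D.n → Prop), (∀ i, s i = true → y i = y (finRotate _ i)) →
    ∀ i j, D.circle s (pL i) = D.circle s (pL j) → y i = y j
  exists_L : ∀ s, (∃ i, s i = false) → ∀ p, ∃ i, D.circle s p = D.circle s (pL i)
  exists_L_or_R : ∀ s p, ∃ i, D.circle s p = D.circle s (pL i) ∨ D.circle s p = D.circle s (pR i)
  R_eq_L : ∀ s, (∃ i, s i = false) → ∀ i, D.circle s (pR i) = D.circle s (pL i)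
  L_ne_R : ∀ s, (∀ i, s i = true) → ∀ i j, D.circle s (pL i) ≠ D.circle s (pR j)
  mono : ∀ s s', (∀ i, s i = true → s' i = true) → (∃ i, s' i = false) →
    ∀ p q, D.circle s p = D.circle s q → D.circle s' p = D.circle s' q

lemma closure_isNegTwoBraid {l : List Slot} (hl : ∀ i : Fin l.length, l.get i = .neg) :
    (closure l).IsNegTwoBraid (fun i => (i, .L)) (fun i => (i, .R)) := by
  have hk : ∀ i : Fin l.length, (l.get i).kink = false := fun i => by rw [hl i]; rfl
  have hp : ∀ i : Fin l.length, (l.get i).positive = false := fun i => by rw [hl i]; rfl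
  have hc : ∀ i : Fin l.length, (closure l).crossing i =
      ⟨(i, .L), (i, .P), (i, .Q), (finRotate _ i, .L), false⟩ := fun i => by
    change slotCrossing (l.get i) i = _
    rw [hl i]
    rfl
  have h0 : ∀ {s : (closure l).State}, (∃ i, s i = false) →
      ∃ i : Fin l.length, s i = (l.get i).positive := by
    rintro s ⟨i, hi⟩
    exact ⟨i, hi.trans (hp i).symm⟩
  have hh : ∀ {s : (closure l).State} {i : Fin l.length}, s i = false →
      s i = (l.get i).positive := fun {s i} h => h.trans (hp i).symm
  have hv : ∀ {s : (closure l).State} {i : Fin l.length}, s i = true →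
      s i ≠ (l.get i).positive := fun {s i} h => by rw [h, hp i]; simp
  have hv' : ∀ {s : (closure l).State} {i : Fin l.length}, s i ≠ (l.get i).positive →
      s i = true := fun {s i} h => by rw [hp i] at h; simpa using h
  refine ⟨fun i => by rw [hc i], fun i => by rw [hc i], fun s i hi => ?_, fun s i hi => ?_,
    fun s i hi => (circle_of_vertical hk (hv hi)).1,
    fun s i hi => (circle_of_vertical hk (hv hi)).2.1, fun s y hy i j hij => ?_,
    fun s hs p => ⟨_, circle_eq_L hk (h0 hs) p⟩, fun s p => ?_,
    fun s hs i => circle_R_eq_L hk (h0 hs) i, fun s hs i j => ?_, fun s s' hs hs' p q hpq => ?_⟩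
  · rw [hc i]
    exact (circle_of_horizontal hk (hh hi)).2.2.1
  · rw [hc i]
    exact (circle_of_vertical hk (hv hi)).2.2.2
  · exact eq_of_circle_eq_of_vertical hk (fun i hi => hy i (hv' hi)) (by simp) (by simp) hij
  · by_cases hs : ∃ i, s i = false
    · exact ⟨_, Or.inl (circle_eq_L hk (h0 hs) p)⟩
    · obtain ⟨i, m⟩ := p
      have hi : s i = true := by
        by_contra h
        exact hs ⟨i, by simpa using h⟩
      refine ⟨i, ?_⟩
      cases m
      · exact Or.inl rfl
      · exact Or.inr rfl
      · exact Or.inr (circle_of_vertical hk (hv hi)).2.2.1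
      · exact Or.inr (circle_of_vertical hk (hv hi)).2.2.2
  · exact circle_L_ne_R (fun i => hv (hs i)) i j
  · rw [circle_eq_L hk (h0 hs') p, circle_eq_L hk (h0 hs') q]
    refine closure_eq_of_circle_eq (s := s) (g := fun p => (closure l).circle s'
      ((if p.2 matches .Q then finRotate _ p.1 else p.1), .L)) (fun i => ?_) hpq
    rw [SlotConst, hk i]
    by_cases hi : s i = (l.get i).positive
    · rw [if_pos hi]; simp
    · rw [if_neg hi]
      simpa using (circle_of_vertical hk (hv (hs i (hv' hi)))).1

/-! ### Relations between dots. -/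

section Labels

variable {R : Type*} [CommRing R] {h t : R}

lemma label_eq {ι : Type} (c : ι) (a : FrobAlg R h t) : label h t c a =
    algebraMap R _ a.re + algebraMap R _ a.im * dot h t c := by
  have ha : a = algebraMap R _ a.re + algebraMap R _ a.im * genX h t := by
    ext <;> simp [genX]
  conv_lhs => rw [ha]
  rw [map_add, map_mul, AlgHom.commutes, AlgHom.commutes, dot]

lemma map_label {ι : Type} {B : Type*} [CommRing B] [Algebra R B] (φ : TensorPow h t ι →ₐ[R] B)
    (c : ι) (a : FrobAlg R h t) :
    φ (label h t c a) = algebraMap R _ a.re + algebraMap R _ a.im * φ (dot h t c) := by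
  rw [label_eq, map_add, map_mul, AlgHom.commutes, AlgHom.commutes]

/-- Subtracting the quadratic relations of the two dots gives `(x - y)(x + y - h) = 0`. Thus
multiples of `x - y` see `y` as the conjugate of `x`, the source of all parity phenomena below. -/
lemma dot_mul_dot_sub {ι : Type} (c d : ι) :
    dot h t d * (dot h t c - dot h t d) =
      (algebraMap R _ h - dot h t c) * (dot h t c - dot h t d) := by
  linear_combination (-1 : TensorPow h t ι) * dot_mul_dot (h := h) (t := t) d +
    dot_mul_dot (h := h) (t := t) c

/-- The comultiplication factor identifies the dots on its two circles. -/
lemma split_mul_dot {ι : Type} (c d : ι) :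
    (dot h t c + dot h t d - algebraMap R _ h) * dot h t c =
      (dot h t c + dot h t d - algebraMap R _ h) * dot h t d := by
  linear_combination dot_mul_dot (h := h) (t := t) c - dot_mul_dot (h := h) (t := t) d

/-- The conjugation `X ↦ h - X`. -/
lemma exists_conj (a : FrobAlg R h t) : ∃ a' : FrobAlg R h t, ∀ {ι : Type}
    (x y z : TensorPow h t ι), x * z = (algebraMap R _ h - y) * z →
    (algebraMap R _ a.re + algebraMap R _ a.im * x) * z =
      (algebraMap R _ a'.re + algebraMap R _ a'.im * y) * z := by
  refine ⟨⟨a.re + h * a.im, -a.im⟩, fun x y z hxy => ?_⟩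
  simp only [map_add, map_mul, map_neg]
  linear_combination (algebraMap R _ a.im) * hxy

end Labels

/-! ### Splitting the tensor power at a horizontal crossing. -/

section Strands

variable {R : Type*} [CommRing R] {h t : R} {D : Diagram} {pL pR : Fin D.n → D.Pt}

variable (h t pL) in
/-- The dot on the circle through `pL i`. -/
noncomputable def strandDot (s : D.State) (i : Fin D.n) : TensorPow h t (D.Circle s) :=
  dot h t (D.circle s (pL i))

variable (h t D) in
/-- The merge map between resolutions of the same diagram. -/
noncomputable abbrev merge (s s' : D.State) :
    TensorPow h t (D.Circle s) →ₐ[R] TensorPow h t (D.Circle s') :=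
  carry h t D D id s s'

variable (h t) in
/-- The quadratic extension `S[X]/(X² - hX - t)` of an `R`-algebra `S`. -/
abbrev QuadExt (S : Type*) [CommRing S] [Algebra R S] : Type _ :=
  QuadraticAlgebra S (algebraMap R S t) (algebraMap R S h)

variable (hD : D.IsNegTwoBraid pL pR) {s s' s₁ s₁' : D.State} {p q : Fin D.n}

include hD

lemma strandDot_succ {i : Fin D.n} (hi : s i = true) :
    strandDot h t pL s i = strandDot h t pL s (finRotate _ i) := by
  rw [strandDot, hD.circle_L s i hi, strandDot]

lemma merge_strandDot (hss : ∀ i, s i = true → s' i = true) (h0 : ∃ i, s' i = false) (i : Fin D.n) :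
    merge h t D s s' (strandDot h t pL s i) = strandDot h t pL s' i :=
  carry_dot (fun p q hpq => hD.mono s s' hss h0 p q hpq.circle_eq) _

lemma strand_algHom_ext (h0 : ∃ i, s i = false) {B : Type*} [Ring B] [Algebra R B]
    {f g : TensorPow h t (D.Circle s) →ₐ[R] B}
    (hfg : ∀ i, f (strandDot h t pL s i) = g (strandDot h t pL s i)) : f = g := by
  refine TensorPow.algHom_ext fun c => ?_
  obtain ⟨p, rfl⟩ := Quotient.exists_rep c
  obtain ⟨i, hi⟩ := hD.exists_L s h0 p
  have := hfg i
  rw [strandDot, ← hi] at this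
  exact this

/-- Each circle contains some lower left end, and two of them on the same circle are linked by
vertical crossings. Hence a value that is constant along vertical crossings depends only on the
circle. -/
lemma exists_lift_strands (h0 : ∃ i, s i = false) {B : Type*} [CommRing B] [Algebra R B]
    (y : Fin D.n → B) (hy : ∀ i, y i * y i = algebraMap R B t + algebraMap R B h * y i)
    (hs : ∀ i, s i = true → y i = y (finRotate _ i)) :
    ∃ φ : TensorPow h t (D.Circle s) →ₐ[R] B, ∀ i, φ (strandDot h t pL s i) = y i := by
  have H : ∀ c : D.Circle s, ∃ i, c = D.circle s (pL i) := fun c => by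
    obtain ⟨p, rfl⟩ := Quotient.exists_rep c
    exact hD.exists_L s h0 p
  choose r hr using H
  refine ⟨liftDots (fun c => y (r c)) (fun c => hy _), fun i => ?_⟩
  rw [strandDot, liftDots_dot]
  exact (hD.const s (fun j => y j = y (r (D.circle s (pL i))))
    (fun j hj => by rw [hs j hj]) _ _ (hr (D.circle s (pL i))).symm).mp rfl |>.symm

/-- The data of a splitting of `A^{⊗}` at a vertex `s` over the vertex `s₁` where a crossing `q` of
`s` is resolved vertically. -/
structure IsSplitting (pL : Fin D.n → D.Pt) (q : Fin D.n) (B : Set (Fin D.n)) (s s₁ : D.State)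
    (ι : TensorPow h t (D.Circle s₁) →ₐ[R] TensorPow h t (D.Circle s))
    (ε : TensorPow h t (D.Circle s) →ₗ[R] TensorPow h t (D.Circle s₁)) : Prop where
  dot_mem : ∀ i ∈ B, ι (strandDot h t pL s₁ i) = strandDot h t pL s (finRotate _ q)
  dot_notMem : ∀ i ∉ B, ι (strandDot h t pL s₁ i) = strandDot h t pL s i
  decomp : ∀ v, ∃ y, v = ι y + strandDot h t pL s q * ι (ε v)
  proj : ∀ y z, ε (ι y + strandDot h t pL s q * ι z) = z

/-- The hypotheses under which the splitting at `q` exists. -/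
structure SplitsAt (W : Finset (Fin D.n)) (p q : Fin D.n) (B : Set (Fin D.n))
    (s s₁ : D.State) : Prop where
  band : IsBand W p q B
  hp : s p = false
  hq : s q = false
  hW : ∀ w ∈ W, s w = true
  eq : s₁ = Function.update s q true

omit hD in
lemma SplitsAt.p_one {W B} (hs : SplitsAt W p q B s s₁) : s₁ p = false := by
  rw [hs.eq, Function.update_of_ne hs.band.ne.symm, hs.hp]

omit hD in
lemma SplitsAt.q_one {W B} (hs : SplitsAt W p q B s s₁) : s₁ q = true := by
  rw [hs.eq, Function.update_self]

omit hD in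
lemma SplitsAt.of_ne {W B} (hs : SplitsAt W p q B s s₁) {i : Fin D.n} (hi : i ≠ q) :
    s₁ i = s i := by
  rw [hs.eq, Function.update_of_ne hi]

omit hD in
lemma SplitsAt.le {W B} (hs : SplitsAt W p q B s s₁) (i : Fin D.n) (hi : s i = true) :
    s₁ i = true := by
  by_cases hiq : i = q
  · rw [hiq, hs.q_one]
  · rw [hs.of_ne hiq, hi]

/-- At `s` the band `B` is one strand, from `p` up to `q`; at `s₁` it is merged with the strand
above `q`. Forgetting the band strand leaves the circles of `s₁`, so the ring at `s` is the ring at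
`s₁` with the dot of the band adjoined as root of the quadratic. Then `ι` is the inclusion, with the
merged circle placed on the strand above `q`, and `ε` is the coefficient of the adjoined dot. -/
lemma exists_isSplitting {W : Finset (Fin D.n)} {B : Set (Fin D.n)}
    (hs : SplitsAt W p q B s s₁) : ∃ ι ε, IsSplitting (h := h) (t := t) pL q B s s₁ ι ε := by
  classical
  have h0 : ∃ i, s i = false := ⟨p, hs.hp⟩
  have h1 : ∃ i, s₁ i = false := ⟨p, hs.p_one⟩
  obtain ⟨ι, hι⟩ := exists_lift_strands (h := h) (t := t) hD h1
    (fun i => if i ∈ B then strandDot h t pL s (finRotate _ q) else strandDot h t pL s i)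
    (fun i => by split_ifs <;> exact dot_mul_dot _) (fun i hi => by
      have hip : i ≠ p := fun hip => by rw [hip, hs.p_one] at hi; simp at hi
      by_cases hiq : i = q
      · subst hiq
        rw [if_pos hs.band.top_mem, if_neg hs.band.succ_notMem]
      · rw [← strandDot_succ hD (i := i) (by rw [← hs.of_ne hiq, hi])]
        exact if_congr (hs.band.iff_succ i hip hiq) rfl rfl)
  -- The identification with the quadratic extension: the dot of the band goes to the adjoined root,
  -- all other dots to themselves.
  obtain ⟨Φ, hΦ⟩ := exists_lift_strands (h := h) (t := t) hD h0 (B := QuadExt h t (TensorPow h t (D.Circle s₁)))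
    (fun i => if i ∈ B then ⟨0, 1⟩ else ⟨strandDot h t pL s₁ i, 0⟩)
    (fun i => by
      have hd := dot_mul_dot (h := h) (t := t) (D.circle s₁ (pL i))
      rw [← strandDot] at hd
      split_ifs
      · ext <;> simp [IsScalarTower.algebraMap_apply R (TensorPow h t (D.Circle s₁))
      (QuadExt h t (TensorPow h t (D.Circle s₁)))]
      · ext <;> simp [IsScalarTower.algebraMap_apply R (TensorPow h t (D.Circle s₁))
      (QuadExt h t (TensorPow h t (D.Circle s₁)))]
        simpa using hd)
    (fun i hi => by
      have hip : i ≠ p := fun hip => by rw [hip, hs.hp] at hi; simp at hi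
      have hiq : i ≠ q := fun hiq => by rw [hiq, hs.hq] at hi; simp at hi
      rw [← strandDot_succ hD (i := i) (hs.le i hi)]
      exact if_congr (hs.band.iff_succ i hip hiq) rfl rfl)
  have hΦι : ∀ y, Φ (ι y) = ⟨y, 0⟩ := by
    suffices H : Φ.comp ι = IsScalarTower.toAlgHom R (TensorPow h t (D.Circle s₁))
      (QuadExt h t (TensorPow h t (D.Circle s₁))) from
      fun y => DFunLike.congr_fun H y
    refine strand_algHom_ext hD h1 fun i => ?_
    rw [AlgHom.comp_apply, hι]
    by_cases hi : i ∈ B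
    · rw [if_pos hi, hΦ, if_neg hs.band.succ_notMem, ← strandDot_succ hD hs.q_one]
      have : strandDot h t pL s₁ i = strandDot h t pL s₁ q := by
        have key : ∀ i, i ∈ B → strandDot h t pL s₁ i = strandDot h t pL s₁ (finRotate _ p) := by
          refine finRotate_induction p (fun _ => rfl) fun i hip ih hi' => ?_
          by_cases hiq : i = q
          · subst hiq
            exact absurd hi' hs.band.succ_notMem
          · have hiB := (hs.band.iff_succ i hip hiq).2 hi'
            rw [← ih hiB, ← strandDot_succ hD]
            exact hs.le i (hs.hW i (hs.band.mem_of_mem i hiB hiq))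
        rw [key i hi, key q hs.band.top_mem]
      rw [this]; rfl
    · rw [if_neg hi, hΦ, if_neg hi]; rfl
  have hΦq : Φ (strandDot h t pL s q) = ⟨0, 1⟩ := by rw [hΦ, if_pos hs.band.top_mem]
  have hproj : ∀ y z, Φ (ι y + strandDot h t pL s q * ι z) = ⟨y, z⟩ := by
    intro y z
    rw [map_add, map_mul, hΦι, hΦι, hΦq]
    ext <;> simp
  refine ⟨ι, (QuadraticAlgebra.imₗ _ _).restrictScalars R ∘ₗ Φ.toLinearMap,
    fun i hi => by rw [hι, if_pos hi], fun i hi => by rw [hι, if_neg hi], fun v => ?_,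
    fun y z => by simp [hproj]⟩
  refine ⟨(Φ v).re, ?_⟩
  change v = ι (Φ v).re + strandDot h t pL s q * ι (Φ v).im
  have hq2 : strandDot h t pL s q * strandDot h t pL s q = algebraMap R _ t +
    algebraMap R _ h * strandDot h t pL s q := dot_mul_dot _
  -- The identity holds on dots and passes to products by the quadratic relation of `x_q`.
  induction v using TensorPow.induction with
  | halg r =>
    rw [AlgHom.commutes, IsScalarTower.algebraMap_apply R (TensorPow h t (D.Circle s₁))
      (QuadExt h t (TensorPow h t (D.Circle s₁)))]
    simp
  | hdot c =>
    obtain ⟨x, rfl⟩ := Quotient.exists_rep c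
    obtain ⟨i, hi⟩ := hD.exists_L s h0 x
    have hc : dot h t (Quotient.mk (D.smoothing s) x) = strandDot h t pL s i := by
      rw [strandDot, ← hi]; rfl
    rw [hc, hΦ]
    by_cases hiB : i ∈ B
    · rw [if_pos hiB]
      have key : ∀ i, i ∈ B → strandDot h t pL s i = strandDot h t pL s (finRotate _ p) := by
        refine finRotate_induction p (fun _ => rfl) fun i hip ih hi' => ?_
        by_cases hiq : i = q
        · subst hiq
          exact absurd hi' hs.band.succ_notMem
        · have hiB := (hs.band.iff_succ i hip hiq).2 hi'
          rw [← ih hiB, ← strandDot_succ hD]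
          exact hs.hW i (hs.band.mem_of_mem i hiB hiq)
      simp [key i hiB, key q hs.band.top_mem]
    · rw [if_neg hiB]
      simp [hι, hiB]
  | hadd v w hv hw =>
    rw [map_add]
    simp only [QuadraticAlgebra.re_add, QuadraticAlgebra.im_add, map_add]
    linear_combination hv + hw
  | hmul v w hv hw =>
    rw [map_mul]
    simp only [QuadraticAlgebra.re_mul, QuadraticAlgebra.im_mul, map_add, map_mul, AlgHom.commutes]
    conv_lhs => rw [hv, hw]
    linear_combination (ι (Φ v).im * ι (Φ w).im) * hq2

end Strands

/-! ### Counting horizontal crossings along the braid. -/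

section Cyclic

/-- A count of the elements of `Z` met on the way from the successor of `p`. -/
lemma exists_cyclicCount {n : ℕ} (Z : Fin n → Prop) [DecidablePred Z] (p : Fin n) :
    ∃ c : Fin n → ℕ, c (finRotate n p) = 0 ∧
      (∀ i, i ≠ p → c (finRotate n i) = c i + if Z i then 1 else 0) ∧
      c p = (Finset.univ.filter fun r => Z r ∧ r ≠ p).card := by
  obtain ⟨d, hinj, hd0, hds, hdp⟩ := exists_cyclicDist p
  refine ⟨fun i => (Finset.univ.filter fun r => Z r ∧ d r < d i).card, ?_, fun i hi => ?_, ?_⟩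
  · simp [hd0, -finRotate_apply]
  · have hset : (Finset.univ.filter fun r => Z r ∧ d r < d (finRotate n i)) =
        (Finset.univ.filter fun r => Z r ∧ d r < d i) ∪
          Finset.univ.filter fun r => Z r ∧ r = i := by
      ext r
      simp only [Finset.mem_filter, Finset.mem_union, Finset.mem_univ, true_and, hds i hi,
        Nat.lt_succ_iff_lt_or_eq, ← and_or_left, hinj.eq_iff]
    have hdisj : Disjoint (Finset.univ.filter fun r => Z r ∧ d r < d i)
        (Finset.univ.filter fun r => Z r ∧ r = i) := by
      rw [Finset.disjoint_filter]
      rintro r _ ⟨_, hr⟩ ⟨_, rfl⟩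
      exact lt_irrefl _ hr
    dsimp only
    rw [hset, Finset.card_union_of_disjoint hdisj]
    congr 1
    by_cases hZ : Z i
    · rw [if_pos hZ, Finset.card_eq_one]
      exact ⟨i, by ext r; simp only [Finset.mem_filter, Finset.mem_univ, true_and,
        Finset.mem_singleton]; exact ⟨fun h => h.2, fun h => ⟨h ▸ hZ, h⟩⟩⟩
    · rw [if_neg hZ, Finset.card_eq_zero, Finset.filter_eq_empty_iff]
      rintro r _ ⟨hr, rfl⟩
      exact hZ hr
  · dsimp only
    congr 1
    ext r
    simp only [Finset.mem_filter, Finset.mem_univ, true_and, and_congr_right_iff]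
    intro _
    exact ⟨fun hr hrp => by simp [hrp] at hr, fun hr => lt_of_le_of_ne (hdp r)
      fun h => hr (hinj h)⟩

end Cyclic

/-! ### The classes `strandClass` and their behaviour under merges. -/

section Strands

variable {R : Type*} [CommRing R] {h t : R} {D : Diagram} {pL pR : Fin D.n → D.Pt}

variable (h t pL) in
/-- The product of the differences of the dots below and above each horizontally resolved crossing
other than `p`. -/
noncomputable def strandProd (s : D.State) (p : Fin D.n) : TensorPow h t (D.Circle s) :=
  ∏ r, if s r = false ∧ r ≠ p then
    strandDot h t pL s r - strandDot h t pL s (finRotate _ r) else 1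

variable (h t pL) in
/-- The label `a` on the circle through `pL p`, with the differences of dots at all horizontally
resolved crossings other than `p`. -/
noncomputable def strandClass (s : D.State) (p : Fin D.n) :
    FrobAlg R h t →ₗ[R] TensorPow h t (D.Circle s) :=
  LinearMap.mulRight R (strandProd h t pL s p) ∘ₗ (label h t (D.circle s (pL p))).toLinearMap

lemma strandClass_apply (s : D.State) (p : Fin D.n) (a : FrobAlg R h t) :
    strandClass h t pL s p a = label h t (D.circle s (pL p)) a * strandProd h t pL s p := rfl

variable (hD : D.IsNegTwoBraid pL pR) {s s' s₁ s₁' : D.State} {p q : Fin D.n}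

lemma exists_strandProd_eq {r : Fin D.n} (hr : s r = false) (hrp : r ≠ p) :
    strandProd h t pL s p = (strandDot h t pL s r - strandDot h t pL s (finRotate _ r)) *
      ∏ j ∈ Finset.univ.erase r, if s j = false ∧ j ≠ p then
        strandDot h t pL s j - strandDot h t pL s (finRotate _ j) else 1 := by
  rw [strandProd, ← Finset.mul_prod_erase _ _ (Finset.mem_univ r), if_pos ⟨hr, hrp⟩]

section Splitting

variable {W : Finset (Fin D.n)} {B : Set (Fin D.n)}
  {ι : TensorPow h t (D.Circle s₁) →ₐ[R] TensorPow h t (D.Circle s)}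
  {ε : TensorPow h t (D.Circle s) →ₗ[R] TensorPow h t (D.Circle s₁)}
  {ι' : TensorPow h t (D.Circle s₁') →ₐ[R] TensorPow h t (D.Circle s')}
  {ε' : TensorPow h t (D.Circle s') →ₗ[R] TensorPow h t (D.Circle s₁')}

include hD

/-- The dot that `ι` places above `q` returns, after the merge, to the circle from which it came; so
the merge is split surjective. -/
lemma merge_splitting (hs : SplitsAt W p q B s s₁) (hι : IsSplitting pL q B s s₁ ι ε)
    (y : TensorPow h t (D.Circle s₁)) : merge h t D s s₁ (ι y) = y := by
  suffices H : (merge h t D s s₁).comp ι = AlgHom.id R _ from DFunLike.congr_fun H y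
  refine strand_algHom_ext hD ⟨p, hs.p_one⟩ fun i => ?_
  rw [AlgHom.comp_apply, AlgHom.id_apply]
  by_cases hi : i ∈ B
  · rw [hι.dot_mem i hi, merge_strandDot hD hs.le ⟨p, hs.p_one⟩, ← strandDot_succ hD hs.q_one]
    have key : ∀ i, i ∈ B → strandDot h t pL s₁ i = strandDot h t pL s₁ (finRotate _ p) := by
      refine finRotate_induction p (fun _ => rfl) fun i hip ih hi' => ?_
      by_cases hiq : i = q
      · subst hiq
        exact absurd hi' hs.band.succ_notMem
      · have hiB := (hs.band.iff_succ i hip hiq).2 hi'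
        rw [← ih hiB, ← strandDot_succ hD]
        exact hs.le i (hs.hW i (hs.band.mem_of_mem i hiB hiq))
    rw [key i hi, key q hs.band.top_mem]
  · rw [hι.dot_notMem i hi, merge_strandDot hD hs.le ⟨p, hs.p_one⟩]

/-- An element killed by the merge at `q` is a multiple of the difference of the dots at `q`. -/
lemma eq_of_merge_eq_zero (hs : SplitsAt W p q B s s₁) (hι : IsSplitting pL q B s s₁ ι ε)
    {v : TensorPow h t (D.Circle s)} (hv : merge h t D s s₁ v = 0) :
    v = (strandDot h t pL s q - strandDot h t pL s (finRotate _ q)) * ι (ε v) := by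
  obtain ⟨y, hy⟩ := hι.decomp v
  have h1 : y = -(strandDot h t pL s₁ q * ε v) := by
    have := hv
    rw [hy, map_add, map_mul, merge_splitting hD hs hι, merge_splitting hD hs hι,
      merge_strandDot hD hs.le ⟨p, hs.p_one⟩] at this
    exact eq_neg_of_add_eq_zero_left this
  have h2 : ι y = -(strandDot h t pL s (finRotate _ q) * ι (ε v)) := by
    conv_lhs => rw [h1]
    rw [map_neg, map_mul, hι.dot_mem q hs.band.top_mem]
  conv_lhs => rw [hy]
  rw [h2]
  ring

lemma merge_dot_sub_mul (hs : SplitsAt W p q B s s₁) (y : TensorPow h t (D.Circle s)) :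
    merge h t D s s₁
      ((strandDot h t pL s q - strandDot h t pL s (finRotate _ q)) * y) = 0 := by
  rw [map_mul, map_sub, merge_strandDot hD hs.le ⟨p, hs.p_one⟩,
    merge_strandDot hD hs.le ⟨p, hs.p_one⟩, ← strandDot_succ hD hs.q_one, sub_self, zero_mul]

omit hD in
lemma proj_dot_sub_mul (hs : SplitsAt W p q B s s₁) (hι : IsSplitting pL q B s s₁ ι ε)
    (y : TensorPow h t (D.Circle s₁)) :
    ε ((strandDot h t pL s q - strandDot h t pL s (finRotate _ q)) * ι y) = y := by
  have : (strandDot h t pL s q - strandDot h t pL s (finRotate _ q)) * ι y =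
      ι (-(strandDot h t pL s₁ q * y)) + strandDot h t pL s q * ι y := by
    rw [map_neg, map_mul, hι.dot_mem q hs.band.top_mem]
    ring
  rw [this, hι.proj]

/-- The band depends on `W`, `p` and `q` but not on the state. The same strand is therefore split
off at both vertices, and the splittings are natural in the remaining crossings. -/
lemma merge_comm_splitting (hs : SplitsAt W p q B s s₁) (hι : IsSplitting pL q B s s₁ ι ε)
    (hs' : SplitsAt W p q B s' s₁') (hι' : IsSplitting pL q B s' s₁' ι' ε')
    (hss : ∀ i, s i = true → s' i = true) (y : TensorPow h t (D.Circle s₁)) :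
    merge h t D s s' (ι y) = ι' (merge h t D s₁ s₁' y) := by
  have hss₁ : ∀ i, s₁ i = true → s₁' i = true := fun i hi => by
    by_cases hiq : i = q
    · rw [hiq, hs'.q_one]
    · rw [hs'.of_ne hiq]
      exact hss i (by rwa [← hs.of_ne hiq])
  suffices H : (merge h t D s s').comp ι = ι'.comp (merge h t D s₁ s₁') from
    DFunLike.congr_fun H y
  refine strand_algHom_ext hD ⟨p, hs.p_one⟩ fun i => ?_
  rw [AlgHom.comp_apply, AlgHom.comp_apply, merge_strandDot hD hss₁ ⟨p, hs'.p_one⟩]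
  by_cases hi : i ∈ B
  · rw [hι.dot_mem i hi, hι'.dot_mem i hi, merge_strandDot hD hss ⟨p, hs'.hp⟩]
  · rw [hι.dot_notMem i hi, hι'.dot_notMem i hi, merge_strandDot hD hss ⟨p, hs'.hp⟩]

lemma merge_comm_proj (hs : SplitsAt W p q B s s₁) (hι : IsSplitting pL q B s s₁ ι ε)
    (hs' : SplitsAt W p q B s' s₁') (hι' : IsSplitting pL q B s' s₁' ι' ε')
    (hss : ∀ i, s i = true → s' i = true) (v : TensorPow h t (D.Circle s)) :
    ε' (merge h t D s s' v) = merge h t D s₁ s₁' (ε v) := by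
  obtain ⟨y, hy⟩ := hι.decomp v
  conv_lhs => rw [hy]
  rw [map_add, map_mul, merge_comm_splitting hD hs hι hs' hι' hss,
    merge_comm_splitting hD hs hι hs' hι' hss, merge_strandDot hD hss ⟨p, hs'.hp⟩, hι'.proj]

omit hD in
lemma splitting_label (hs : SplitsAt W p q B s s₁) (hι : IsSplitting pL q B s s₁ ι ε)
    (a : FrobAlg R h t) :
    ι (label h t (D.circle s₁ (pL p)) a) = label h t (D.circle s (pL p)) a := by
  have := hι.dot_notMem p hs.band.bot_notMem
  rw [strandDot, strandDot] at this
  rw [map_label, this, ← label_eq]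

omit hD in
-- Apart from `q`, the band contains only vertical crossings. Every horizontal crossing other than
-- `p` and `q` thus has both of its strand ends outside the band, where `ι` fixes the dots, so only
-- the factor of `q` is new.
lemma splitting_strandProd (hs : SplitsAt W p q B s s₁) (hι : IsSplitting pL q B s s₁ ι ε) :
    strandProd h t pL s p = (strandDot h t pL s q - strandDot h t pL s (finRotate _ q)) *
      ι (strandProd h t pL s₁ p) := by
  classical
  rw [exists_strandProd_eq hs.hq hs.band.ne, strandProd, map_prod,
    ← Finset.mul_prod_erase _ _ (Finset.mem_univ q), hs.q_one]
  simp only [Bool.true_eq_false, false_and, if_false, map_one, one_mul]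
  congr 1
  refine Finset.prod_congr rfl fun r hr => ?_
  have hrq := Finset.ne_of_mem_erase hr
  rw [hs.of_ne hrq]
  by_cases hc : s r = false ∧ r ≠ p
  · have hrB : r ∉ B := fun hrB => by
      have := hs.hW r (hs.band.mem_of_mem r hrB hrq)
      rw [hc.1] at this
      simp at this
    rw [if_pos hc, if_pos hc, map_sub, hι.dot_notMem r hrB,
      hι.dot_notMem _ fun hB => hrB ((hs.band.iff_succ r hc.2 hrq).2 hB)]
  · rw [if_neg hc, if_neg hc, map_one]

end Splitting

include hD

lemma strandDot_eq_of_unique (hp : ∀ j, j ≠ p → s j = true) (i : Fin D.n) :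
    strandDot h t pL s i = strandDot h t pL s p := by
  have key : ∀ i, strandDot h t pL s i = strandDot h t pL s (finRotate _ p) :=
    finRotate_induction p rfl fun i hi ih => by rw [← strandDot_succ hD (hp i hi), ih]
  rw [key i, key p]

omit hD in
-- Here `W` consists of all vertical crossings of `s`, so `q` is the next horizontal crossing above
-- `p`.
lemma exists_splitsAt (hp : s p = false) (h : ∃ j, j ≠ p ∧ s j = false) :
    ∃ q B, SplitsAt (Finset.univ.filter fun i => s i = true) p q B s
      (Function.update s q true) := by
  obtain ⟨j, hj, hsj⟩ := h
  obtain ⟨q, B, hB⟩ := exists_isBand (W := Finset.univ.filter fun i => s i = true) (p := p)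
    ⟨j, hj, by simp [hsj]⟩
  have := hB.notMem
  exact ⟨q, B, hB, hp, by simpa using this, fun w hw => by simpa using hw, rfl⟩

/-- An element killed by the merges at all horizontally resolved crossings other than `p` comes from
an element of `A`. -/
theorem exists_eq_strandClass (hp : s p = false) (v : TensorPow h t (D.Circle s))
    (hv : ∀ q, q ≠ p → s q = false → merge h t D s (Function.update s q true) v = 0) :
    ∃ a, v = strandClass h t pL s p a := by
  classical
  induction hN : (Finset.univ.filter fun i => s i = false).card using Nat.strong_induction_on
    generalizing s with
  | _ N ih =>
  by_cases hex : ∃ j, j ≠ p ∧ s j = false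
  · obtain ⟨q, B, hs⟩ := exists_splitsAt hp hex
    obtain ⟨ι, ε, hι⟩ := exists_isSplitting (h := h) (t := t) hD hs
    have hvq := eq_of_merge_eq_zero hD hs hι (hv q hs.band.ne hs.hq)
    have hlt : (Finset.univ.filter fun i => Function.update s q true i = false).card < N := by
      rw [← hN]
      refine Finset.card_lt_card ⟨fun i hi => ?_, fun hsub => ?_⟩
      · by_cases hiq : i = q
        · simp [hiq] at hi
        · simpa [hiq] using hi
      · have := hsub (show q ∈ _ by simpa using hs.hq)
        simp at this
    -- The quotient of `v` by the difference at `q` is again killed by the other merges, since the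
    -- projection commutes with them. Induction removes one horizontal crossing at a time.
    obtain ⟨a, ha⟩ := ih _ hlt (s := Function.update s q true) hs.p_one (ε v)
      (fun q' hq'p hq' => by
        have hq'q : q' ≠ q := fun e => by rw [e, hs.q_one] at hq'; simp at hq'
        have hsq' : s q' = false := by rw [← hs.of_ne hq'q, hq']
        -- The band is still that of the vertical crossings of `s`, although one more crossing is
        -- now vertical; naturality requires the same band at both vertices.
        have hs' : SplitsAt (Finset.univ.filter fun i => s i = true) p q B
            (Function.update s q' true)
            (Function.update (Function.update s q true) q' true) := by
          refine ⟨hs.band, ?_, ?_, fun w hw => ?_, Function.update_comm hq'q.symm _ _ _⟩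
          · rw [Function.update_of_ne hq'p.symm, hs.hp]
          · rw [Function.update_of_ne hq'q.symm, hs.hq]
          · by_cases hwq : w = q'
            · rw [hwq, Function.update_self]
            · rw [Function.update_of_ne hwq, hs.hW w hw]
        obtain ⟨ι', ε', hι'⟩ := exists_isSplitting (h := h) (t := t) hD hs'
        rw [← merge_comm_proj hD hs hι hs' hι' (fun i hi => by
          by_cases hwq : i = q'
          · rw [hwq, Function.update_self]
          · rw [Function.update_of_ne hwq, hi]), hv q' hq'p hsq', map_zero]) rfl
    refine ⟨a, ?_⟩
    rw [hvq, ha, strandClass_apply, strandClass_apply, map_mul, splitting_label hs hι,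
      splitting_strandProd hs hι]
    ring
  -- If `p` is the only horizontal crossing, there is a single circle and nothing to divide by.
  · push Not at hex
    have hone : ∀ j, j ≠ p → s j = true := fun j hj => by simpa using hex j hj
    have hprod : strandProd h t pL s p = 1 := Finset.prod_eq_one fun r _ => by
      rw [if_neg]
      rintro ⟨h1, h2⟩
      exact hex r h2 h1
    simp only [strandClass_apply, hprod, mul_one]
    induction v using TensorPow.induction with
    | halg r => exact ⟨algebraMap R _ r, by rw [AlgHom.commutes]⟩
    | hdot c =>
      obtain ⟨x, rfl⟩ := Quotient.exists_rep c
      obtain ⟨i, hi⟩ := hD.exists_L s ⟨p, hp⟩ x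
      refine ⟨genX h t, ?_⟩
      have := strandDot_eq_of_unique (h := h) (t := t) hD hone i
      rw [strandDot, ← hi] at this
      exact this
    | hadd v w ihv ihw =>
      obtain ⟨a, ha⟩ := ihv (fun q hq hsq => absurd hsq (hex q hq))
      obtain ⟨b, hb⟩ := ihw (fun q hq hsq => absurd hsq (hex q hq))
      exact ⟨a + b, by rw [map_add, ha, hb]⟩
    | hmul v w ihv ihw =>
      obtain ⟨a, ha⟩ := ihv (fun q hq hsq => absurd hsq (hex q hq))
      obtain ⟨b, hb⟩ := ihw (fun q hq hsq => absurd hsq (hex q hq))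
      exact ⟨a * b, by rw [map_mul, ha, hb]⟩

/-- The projections `ε` strip off the difference factors one after another. When only `p` is left,
sending every dot to `X` recovers the label. -/
theorem strandClass_injective (hp : s p = false) :
    Function.Injective (strandClass h t pL s p) := by
  classical
  rw [injective_iff_map_eq_zero]
  intro a
  induction hN : (Finset.univ.filter fun i => s i = false).card using Nat.strong_induction_on
    generalizing s with
  | _ N ih =>
  intro ha
  by_cases hex : ∃ j, j ≠ p ∧ s j = false
  · obtain ⟨q, B, hs⟩ := exists_splitsAt hp hex
    obtain ⟨ι, ε, hι⟩ := exists_isSplitting (h := h) (t := t) hD hs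
    have hlt : (Finset.univ.filter fun i => Function.update s q true i = false).card < N := by
      rw [← hN]
      refine Finset.card_lt_card ⟨fun i hi => ?_, fun hsub => ?_⟩
      · by_cases hiq : i = q
        · simp [hiq] at hi
        · simpa [hiq] using hi
      · have := hsub (show q ∈ _ by simpa using hs.hq)
        simp at this
    refine ih _ hlt (s := Function.update s q true) hs.p_one rfl ?_
    rw [← proj_dot_sub_mul hs hι (strandClass h t pL (Function.update s q true) p a),
      ← map_zero ε, ← ha, strandClass_apply, strandClass_apply, map_mul ι, splitting_label hs hι,
      splitting_strandProd hs hι]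
    congr 1
    ring
  · push Not at hex
    have hprod : strandProd h t pL s p = 1 := Finset.prod_eq_one fun r _ => by
      rw [if_neg]
      rintro ⟨h1, h2⟩
      exact hex r h2 h1
    rw [strandClass_apply, hprod, mul_one] at ha
    obtain ⟨φ, hφ⟩ := exists_lift_strands (h := h) (t := t) hD ⟨p, hp⟩
      (fun _ => genX h t) (fun _ => genX_mul_genX) (fun _ _ => rfl)
    have hid : φ.comp (label h t (D.circle s (pL p))) = AlgHom.id R _ :=
      FrobAlg.algHom_ext (by rw [AlgHom.comp_apply]; exact hφ p)
    rw [← AlgHom.id_apply (R := R) a, ← hid, AlgHom.comp_apply, ha, map_zero]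

/-- Going up from `p`, a vertical crossing does not change the circle, while the factor of a
horizontal crossing conjugates the dot. Only the parity of the number of horizontal crossings passed
is relevant. -/
lemma strandDot_mul_strandProd {c : Fin D.n → ℕ} (hc0 : c (finRotate _ p) = 0)
    (hc : ∀ i, i ≠ p → c (finRotate _ i) = c i + if s i = false then 1 else 0) (i : Fin D.n) :
    strandDot h t pL s i * strandProd h t pL s p =
      (if Even (c i) then strandDot h t pL s (finRotate _ p)
        else algebraMap R _ h - strandDot h t pL s (finRotate _ p)) * strandProd h t pL s p := by
  refine finRotate_induction (P := fun i => strandDot h t pL s i * strandProd h t pL s p =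
      (if Even (c i) then strandDot h t pL s (finRotate _ p)
        else algebraMap R _ h - strandDot h t pL s (finRotate _ p)) * strandProd h t pL s p)
    p (by rw [hc0, if_pos (by simp)]) (fun i hip ih => ?_) i
  by_cases hsi : s i = true
  · rw [← strandDot_succ hD hsi, ih, hc i hip, hsi]
    simp
  · rw [Bool.not_eq_true] at hsi
    have h1 : strandDot h t pL s (finRotate _ i) * strandProd h t pL s p =
        (algebraMap R _ h - strandDot h t pL s i) * strandProd h t pL s p := by
      rw [exists_strandProd_eq hsi hip, ← mul_assoc, ← mul_assoc]
      congr 1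
      exact dot_mul_dot_sub _ _
    rw [h1, sub_mul, ih, hc i hip, hsi, if_pos rfl]
    by_cases he : Even (c i)
    · rw [if_pos he, if_neg (by simpa [Nat.even_add_one] using he)]
      ring
    · rw [if_neg he, if_pos (by simpa [Nat.even_add_one] using he)]
      ring

/-- A full turn from above `p` to below `p` meets every other horizontal crossing once. -/
lemma strandDot_mul_strandProd_self :
    strandDot h t pL s p * strandProd h t pL s p =
      (if Even (Finset.univ.filter fun r => s r = false ∧ r ≠ p).card then
          strandDot h t pL s (finRotate _ p)
        else algebraMap R _ h - strandDot h t pL s (finRotate _ p)) * strandProd h t pL s p := by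
  obtain ⟨c, hc0, hc, hcp⟩ := exists_cyclicCount (fun r => s r = false) p
  rw [strandDot_mul_strandProd hD hc0 hc p, hcp]

/-- On multiples of `strandProd`, labels can be moved to any circle. -/
lemma exists_label_mul_strandProd (i j : Fin D.n) (a : FrobAlg R h t) :
    ∃ a', label h t (D.circle s (pL i)) a * strandProd h t pL s p =
      label h t (D.circle s (pL j)) a' * strandProd h t pL s p := by
  obtain ⟨c, hc0, hc, hcp⟩ := exists_cyclicCount (fun r => s r = false) p
  have hi := strandDot_mul_strandProd (h := h) (t := t) hD hc0 hc i
  have hj := strandDot_mul_strandProd (h := h) (t := t) hD hc0 hc j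
  simp only [label_eq]
  rw [strandDot] at hi hj
  have hor : dot h t (D.circle s (pL i)) * strandProd h t pL s p =
      dot h t (D.circle s (pL j)) * strandProd h t pL s p ∨
      dot h t (D.circle s (pL i)) * strandProd h t pL s p =
      (algebraMap R _ h - dot h t (D.circle s (pL j))) * strandProd h t pL s p := by
    rw [sub_mul, hi, hj]
    split_ifs
    · exact Or.inl rfl
    · right; ring
    · right; ring
    · exact Or.inl rfl
  obtain hij | hij := hor
  · exact ⟨a, by linear_combination (algebraMap R _ a.im) * hij⟩
  · obtain ⟨a', ha'⟩ := exists_conj a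
    exact ⟨a', ha' _ _ _ hij⟩

omit hD in
lemma card_zeros_ne (hp : s p = false) :
    (Finset.univ.filter fun r => s r = false ∧ r ≠ p).card + 1 =
      (Finset.univ.filter fun r => s r = false).card := by
  rw [← Finset.card_erase_add_one (s := Finset.univ.filter fun r => s r = false) (a := p)
    (by simpa using hp)]
  congr 2
  ext r
  simp [and_comm]

lemma merge_strandClass_of_ne (hp : s p = false) (hq : s q = false) (hqp : q ≠ p)
    (a : FrobAlg R h t) : merge h t D s (Function.update s q true) (strandClass h t pL s p a) = 0 := by
  have hle : ∀ i, s i = true → Function.update s q true i = true := fun i hi => by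
    by_cases hiq : i = q
    · rw [hiq, Function.update_self]
    · rw [Function.update_of_ne hiq, hi]
  have hp1 : Function.update s q true p = false := by
    rw [Function.update_of_ne (Ne.symm hqp), hp]
  rw [strandClass_apply, map_mul, exists_strandProd_eq hq hqp, map_mul, map_sub,
    merge_strandDot hD hle ⟨p, hp1⟩, merge_strandDot hD hle ⟨p, hp1⟩,
    ← strandDot_succ hD (Function.update_self _ _ _), sub_self, zero_mul, mul_zero]

/-- If the number of horizontally resolved crossings is even, the elements `strandClass` are killed
by all merges. -/
lemma merge_strandClass (hp : s p = false)
    (he : Even (Finset.univ.filter fun r => s r = false).card) (hq : s q = false)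
    (a : FrobAlg R h t) : merge h t D s (Function.update s q true) (strandClass h t pL s p a) = 0 := by
  have hle : ∀ i, s i = true → Function.update s q true i = true := fun i hi => by
    by_cases hiq : i = q
    · rw [hiq, Function.update_self]
    · rw [Function.update_of_ne hiq, hi]
  rw [strandClass_apply, map_mul]
  by_cases hqp : q = p
  · subst hqp
    have hodd := card_zeros_ne hp
    -- The number of horizontal crossings is even and positive, so a second one is available as a
    -- new base point once `q` has become vertical.
    obtain ⟨r, hr⟩ : ∃ r, s r = false ∧ r ≠ q := by
      by_contra hne
      push Not at hne
      rw [Finset.filter_eq_empty_iff.2 fun r _ hr => hr.2 (hne r hr.1)] at hodd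
      rw [← hodd] at he
      simp at he
    have hr1 : Function.update s q true r = false := by rw [Function.update_of_ne hr.2, hr.1]
    have h1 : merge h t D s (Function.update s q true) (strandProd h t pL s q) =
        (strandDot h t pL (Function.update s q true) r -
          strandDot h t pL (Function.update s q true) (finRotate _ r)) *
          strandProd h t pL (Function.update s q true) r := by
      rw [exists_strandProd_eq hr.1 hr.2, map_mul, map_sub, merge_strandDot hD hle ⟨r, hr1⟩,
        merge_strandDot hD hle ⟨r, hr1⟩, map_prod, strandProd,
        ← Finset.mul_prod_erase _ _ (Finset.mem_univ r),
        if_neg (by simp), one_mul]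
      congr 1
      refine Finset.prod_congr rfl fun j hj => ?_
      have hjr := Finset.ne_of_mem_erase hj
      by_cases hjq : j = q
      · simp [hjq]
      · simp only [Function.update_of_ne hjq, hjr, hjq, ne_eq, not_false_eq_true, and_true]
        split_ifs
        · rw [map_sub, merge_strandDot hD hle ⟨r, hr1⟩, merge_strandDot hD hle ⟨r, hr1⟩]
        · rw [map_one]
    have h2 := strandDot_mul_strandProd_self (h := h) (t := t) (s := Function.update s q true)
      (p := r) hD
    -- Without `q` and `r` an even number remains, so a full turn does not conjugate: the dots below
    -- and above `r` act equally, and the factor of `r` gives zero.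
    have h3 : Even (Finset.univ.filter fun j => Function.update s q true j = false ∧ j ≠ r).card := by
      have h4 := card_zeros_ne hr1
      have h5 : (Finset.univ.filter fun r => Function.update s q true r = false) =
          Finset.univ.filter fun r => s r = false ∧ r ≠ q := by
        ext j
        by_cases hjq : j = q
        · simp [hjq]
        · simp [hjq]
      rw [h5] at h4
      have := he
      rw [← hodd, ← h4] at this
      simpa [Nat.even_add_one] using this
    rw [if_pos h3] at h2
    rw [h1, sub_mul, h2, sub_self, mul_zero]
  · rw [← map_mul, ← strandClass_apply]
    exact merge_strandClass_of_ne hD hp hq hqp a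

/-- The merge at the last horizontally resolved crossing, from an odd to an even number of them, is
the map `U`. -/
lemma exists_merge_strandClass_update (hp : s p = false)
    (he : Even (Finset.univ.filter fun r => s r = false).card) (hq : s q = true)
    {s'' : D.State} (hs'' : s'' = Function.update s q false) :
    (∀ a, ∃ a', merge h t D s'' s (strandClass h t pL s'' q a) =
      strandClass h t pL s p (mapU h t a')) ∧
    (∀ a', ∃ a, merge h t D s'' s (strandClass h t pL s'' q a) =
      strandClass h t pL s p (mapU h t a')) := by
  have hle : ∀ i, s'' i = true → s i = true := fun i hi => by
    by_cases hiq : i = q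
    · rw [hiq, hq]
    · rwa [hs'', Function.update_of_ne hiq] at hi
  -- The product based at `q` contains a factor for every horizontal crossing of `s`, one more than
  -- the product based at `p`.
  have h1 : merge h t D s'' s (strandProd h t pL s'' q) =
      (strandDot h t pL s p - strandDot h t pL s (finRotate _ p)) * strandProd h t pL s p := by
    have h2 : merge h t D s'' s (strandProd h t pL s'' q) = ∏ r, if s r = false then
        strandDot h t pL s r - strandDot h t pL s (finRotate _ r) else 1 := by
      rw [strandProd, map_prod]
      refine Finset.prod_congr rfl fun r _ => ?_
      by_cases hrq : r = q
      · simp [hrq, hq]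
      · have hr : s'' r = s r := by rw [hs'', Function.update_of_ne hrq]
        simp only [hr, hrq, ne_eq, not_false_eq_true, and_true]
        split_ifs
        · rw [map_sub, merge_strandDot hD hle ⟨p, hp⟩, merge_strandDot hD hle ⟨p, hp⟩]
        · rw [map_one]
    rw [h2, ← Finset.mul_prod_erase _ _ (Finset.mem_univ p), if_pos hp, strandProd,
      ← Finset.mul_prod_erase _ _ (Finset.mem_univ p), if_neg (by simp), one_mul]
    congr 1
    refine Finset.prod_congr rfl fun r hr => ?_
    simp [Finset.ne_of_mem_erase hr]
  -- Now an odd number of crossings lies between the two sides of `p`, so `x_{p+1}` acts as `h -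
  -- x_p` and the extra factor as `2x_p - h`.
  have h2 := strandDot_mul_strandProd_self (h := h) (t := t) (s := s) (p := p) hD
  rw [if_neg (by rw [← card_zeros_ne hp] at he; simpa [Nat.even_add_one] using he)] at h2
  have h3 : ∀ a b, label h t (D.circle s (pL q)) a * strandProd h t pL s p =
      label h t (D.circle s (pL p)) b * strandProd h t pL s p →
      merge h t D s'' s (strandClass h t pL s'' q a) = strandClass h t pL s p (mapU h t b) := by
    intro a b hab
    have hl : merge h t D s'' s (label h t (D.circle s'' (pL q)) a) =
        label h t (D.circle s (pL q)) a := by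
      have := merge_strandDot (h := h) (t := t) hD hle ⟨p, hp⟩ q
      rw [strandDot, strandDot] at this
      rw [map_label, this, ← label_eq]
    have hU : label h t (D.circle s (pL p)) (mapU h t b) = (2 * strandDot h t pL s p -
        algebraMap R _ h) * label h t (D.circle s (pL p)) b := by
      rw [mapU, LinearMap.mulLeft_apply, map_mul, map_sub, map_mul, AlgHom.commutes, map_ofNat]
      rfl
    rw [strandClass_apply, map_mul, hl, h1, strandClass_apply, hU]
    linear_combination (strandDot h t pL s p - strandDot h t pL s (finRotate _ p)) * hab -
      label h t (D.circle s (pL p)) b * h2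
  refine ⟨fun a => ?_, fun b => ?_⟩
  · obtain ⟨b, hb⟩ := exists_label_mul_strandProd (h := h) (t := t) (s := s) (p := p) hD q p a
    exact ⟨b, h3 a b hb⟩
  · obtain ⟨a, ha⟩ := exists_label_mul_strandProd (h := h) (t := t) (s := s) (p := p) hD p q b
    exact ⟨a, h3 a b ha.symm⟩

end Strands

/-! ### Signs in the cube. -/

section Signs

/-- The sign `(-1)^m`, where `m` is the number of `1`-resolutions at the crossings in `P`. -/
def countSign {n : ℕ} (P : Fin n → Prop) [DecidablePred P] (s : Fin n → Bool) : ℤ :=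
  (-1) ^ (Finset.univ.filter fun j => P j ∧ s j = true).card

variable {n : ℕ} (P : Fin n → Prop) [DecidablePred P] (s : Fin n → Bool)

lemma edgeSign_eq (D : Diagram) (s : D.State) (i : Fin D.n) :
    edgeSign D s i = countSign (fun j => i < j) s := rfl

lemma countSign_mul_self : countSign P s * countSign P s = 1 := by
  rw [countSign, ← mul_pow]; simp

lemma countSign_update_of_not {k : Fin n} (hk : ¬ P k) (b : Bool) :
    countSign P (Function.update s k b) = countSign P s := by
  unfold countSign
  congr 2
  ext j
  by_cases hjk : j = k
  · simp [hjk, hk]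
  · simp [hjk]

lemma countSign_update_false {k : Fin n} (hk : P k) (hs : s k = true) :
    countSign P (Function.update s k false) = -countSign P s := by
  unfold countSign
  have : (Finset.univ.filter fun j => P j ∧ s j = true).card =
      (Finset.univ.filter fun j => P j ∧ Function.update s k false j = true).card + 1 := by
    rw [← Finset.card_erase_add_one (s := Finset.univ.filter fun j => P j ∧ s j = true) (a := k)
      (by simp [hk, hs])]
    congr 2
    ext j
    by_cases hjk : j = k
    · simp [hjk]
    · simp [hjk]
  rw [this, pow_succ]
  simp

/-- Changing the resolution at `q` affects the sign of the edge at `i` exactly if `i < q`. The same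
condition decides whether changing `i` affects the count below `q`, so the two changes compensate.
-/
lemma countSign_swap {i q : Fin n} (hiq : i ≠ q) (hi : s i = true) (hq : s q = true) :
    countSign (fun j => i < j) s * countSign (fun j => j < q) (Function.update s i false) =
      countSign (fun j => j < q) s * countSign (fun j => i < j) (Function.update s q false) := by
  obtain hlt | hlt := lt_or_gt_of_ne hiq
  · rw [countSign_update_false (fun j => j < q) s hlt hi,
      countSign_update_false (fun j => i < j) s hlt hq]
    ring
  · rw [countSign_update_of_not (fun j => j < q) s (not_lt_of_gt hlt),
      countSign_update_of_not (fun j => i < j) s (not_lt_of_gt hlt)]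
    ring

/-- The number of `1`-resolutions. -/
def onesCard (s : Fin n → Bool) : ℕ := (Finset.univ.filter fun j => s j = true).card

lemma onesCard_update_false {k : Fin n} (hs : s k = true) :
    onesCard (Function.update s k false) + 1 = onesCard s := by
  rw [onesCard, onesCard,
    ← Finset.card_erase_add_one (s := Finset.univ.filter fun j => s j = true) (a := k)
      (by simp [hs])]
  congr 2
  ext j
  by_cases hjk : j = k
  · simp [hjk]
  · simp [hjk]

lemma onesCard_update_true {k : Fin n} (hs : s k = false) :
    onesCard (Function.update s k true) = onesCard s + 1 := by
  rw [← onesCard_update_false (Function.update s k true) (Function.update_self _ _ _)]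
  rw [Function.update_idem, ← hs, Function.update_eq_self]

end Signs

/-! ### The differential of the closed braid, and its square. -/

section Differential

variable {R : Type*} [CommRing R] {h t : R} {D : Diagram} {pL pR : Fin D.n → D.Pt}

lemma mul_algHom_congr {ι : Type} [Finite ι] {B : Type*} [CommRing B] [Algebra R B]
    {f g : TensorPow h t ι →ₐ[R] B} {e : B}
    (H : ∀ c, e * f (dot h t c) = e * g (dot h t c)) (v : TensorPow h t ι) :
    e * f v = e * g v := by
  induction v using TensorPow.induction with
  | halg r => rw [AlgHom.commutes, AlgHom.commutes]
  | hdot c => exact H c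
  | hadd v w hv hw => rw [map_add, map_add, mul_add, mul_add, hv, hw]
  | hmul v w hv hw =>
    rw [map_mul, map_mul]
    linear_combination (f w) * hv + (g v) * hw

variable (hD : D.IsNegTwoBraid pL pR) {s s' : D.State}

variable (h t) in
/-- The saddle map at the crossing `i`. -/
noncomputable abbrev edgeMap (i : Fin D.n) (s s' : D.State) :
    TensorPow h t (D.Circle s) →ₗ[R] TensorPow h t (D.Circle s') :=
  saddle h t D D id s s' (D.crossing i).a (D.crossing i).c (D.crossing i).a (D.crossing i).c

variable (h t) in
lemma differential_apply (v : Chain h t D) (s' : D.State) : differential h t D v s' =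
    ∑ i, if s' i = true then edgeSign D s' i • edgeMap h t i (Function.update s' i false) s'
      (v (Function.update s' i false)) else 0 := by
  rw [differential, LinearMap.pi_apply, LinearMap.sum_apply]
  refine Finset.sum_congr rfl fun i _ => ?_
  split_ifs
  · rfl
  · rfl

variable (h t pL pR) in
/-- The factor of the comultiplication at the resolution into two parallel circles. -/
noncomputable def splitFactor (s : D.State) (i : Fin D.n) : TensorPow h t (D.Circle s) :=
  strandDot h t pL s i + strandDot h t pR s i - algebraMap R _ h

include hD

/-- Membership in the band from `i` to the next horizontal crossing is constant on circles and
separates the strand above `i` from the one below. -/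
lemma circle_ne_of_zero {i p : Fin D.n} (hi : s i = false) (hp : s p = false) (hpi : p ≠ i) :
    D.circle s (pL i) ≠ D.circle s (pL (finRotate _ i)) := by
  obtain ⟨q, B, hB⟩ := exists_isBand (W := Finset.univ.filter fun i => s i = true) (p := i)
    ⟨p, hpi, by simp [hp]⟩
  intro hc
  have := hD.const s (fun j => j ∈ B) (fun j hj => propext (hB.iff_succ j
    (fun e => by rw [e, hi] at hj; simp at hj)
    (fun e => hB.notMem (by rw [e] at hj; simpa using hj)))) _ _ hc
  exact hB.bot_notMem (this.mpr hB.succ_mem)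

lemma edgeMap_eq_merge {i : Fin D.n} (hs : s = Function.update s' i false) (hi : s' i = true)
    (h0 : ∃ p, s' p = false) (v : TensorPow h t (D.Circle s)) :
    edgeMap h t i s s' v = merge h t D s s' v := by
  obtain ⟨p, hp⟩ := h0
  have hpi : p ≠ i := fun e => by rw [e, hi] at hp; simp at hp
  have hsi : s i = false := by rw [hs, Function.update_self]
  have hsp : s p = false := by rw [hs, Function.update_of_ne hpi, hp]
  rw [edgeMap, saddle, if_pos]
  · rfl
  rw [hD.a_eq, hD.circle_c_zero s i hsi, hD.circle_c_one s' i hi, hD.R_eq_L s' ⟨p, hp⟩]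
  exact ⟨circle_ne_of_zero hD hsi hsp hpi, rfl⟩

lemma strandDot_eq_of_ones (hs : ∀ i, s i = true) (i j : Fin D.n) :
    strandDot h t pL s i = strandDot h t pL s j ∧ strandDot h t pR s i = strandDot h t pR s j := by
  refine finRotate_induction' (P := fun i => strandDot h t pL s i = strandDot h t pL s j ∧
    strandDot h t pR s i = strandDot h t pR s j) j ⟨rfl, rfl⟩ (fun i hi => ?_) i
  rw [← hi.1, ← hi.2, strandDot, strandDot, strandDot, strandDot, hD.circle_L s i (hs i),
    hD.circle_R s i (hs i)]
  exact ⟨rfl, rfl⟩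

lemma splitFactor_eq (hs : ∀ i, s i = true) (i j : Fin D.n) :
    splitFactor h t pL pR s i = splitFactor h t pL pR s j := by
  rw [splitFactor, splitFactor, (strandDot_eq_of_ones hD hs i j).1,
    (strandDot_eq_of_ones hD hs i j).2]

/-- There are only the left and the right circle, and the comultiplication factor identifies their
dots. -/
lemma splitFactor_mul_dot (hs : ∀ i, s i = true) (i j : Fin D.n) (p : D.Pt) :
    splitFactor h t pL pR s i * dot h t (D.circle s p) =
      splitFactor h t pL pR s i * strandDot h t pL s j := by
  have h1 : splitFactor h t pL pR s i * strandDot h t pL s i =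
      splitFactor h t pL pR s i * strandDot h t pR s i := split_mul_dot _ _
  rw [(strandDot_eq_of_ones hD hs j i).1]
  obtain ⟨k, hk | hk⟩ := hD.exists_L_or_R s p
  · rw [hk, ← strandDot, (strandDot_eq_of_ones hD hs k i).1]
  · rw [hk, ← strandDot, (strandDot_eq_of_ones hD hs k i).2, h1]

lemma splitFactor_mul_carry (hs : ∀ i, s' i = true) (i j : Fin D.n) (c : D.Circle s) :
    splitFactor h t pL pR s' i * carry h t D D id s s' (dot h t c) =
      splitFactor h t pL pR s' i * strandDot h t pL s' j := by
  obtain ⟨p, rfl⟩ := Quotient.exists_rep c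
  rw [← splitFactor_mul_dot hD hs i j p]
  refine mul_carry_dot (fun p q _ => ?_) p
  rw [splitFactor_mul_dot hD hs i j, splitFactor_mul_dot hD hs i j]

/-- With `i` as its only horizontal crossing `s` has one circle; it becomes the left and the right
circle. The factor is the same for all crossings, which permits a free choice of `j`. -/
lemma edgeMap_eq_split {i : Fin D.n} (hs : s = Function.update s' i false)
    (h1 : ∀ p, s' p = true) (j : Fin D.n) (v : TensorPow h t (D.Circle s)) :
    edgeMap h t i s s' v = splitFactor h t pL pR s' j * carry h t D D id s s' v := by
  have hsi : s i = false := by rw [hs, Function.update_self]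
  have hso : ∀ k, k ≠ i → s k = true := fun k hk => by rw [hs, Function.update_of_ne hk, h1]
  have hc : D.circle s (pL i) = D.circle s (pL (finRotate _ i)) := by
    have key : ∀ k, D.circle s (pL k) = D.circle s (pL (finRotate _ i)) :=
      finRotate_induction i rfl fun k hk ih => by rw [← hD.circle_L s k (hso k hk), ih]
    exact key i
  have hne := hD.L_ne_R s' h1 i i
  rw [edgeMap, saddle, hD.a_eq, hD.circle_c_zero s i hsi, hD.circle_c_one s' i (h1 i),
    if_neg (fun hh => hne hh.2), if_pos ⟨hc, hne⟩, splitFactor_eq hD h1 j i]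
  rfl

lemma differential_apply_of_zero (v : Chain h t D) (h0 : ∃ p, s' p = false) :
    differential h t D v s' =
    ∑ i, if s' i = true then edgeSign D s' i • merge h t D (Function.update s' i false) s'
      (v (Function.update s' i false)) else 0 := by
  rw [differential_apply]
  refine Finset.sum_congr rfl fun i _ => ?_
  split_ifs with hi
  · rw [edgeMap_eq_merge hD rfl hi h0]
  · rfl

/-- The inner maps always end at a vertex with a horizontal crossing and are merges. If the outer
ones split, both composites are multiples of the same factor, on which all dots coincide. -/
lemma edgeMap_comm {i j : Fin D.n} {si sj sij : D.State} (hij : i ≠ j) (hi : s' i = true)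
    (hj : s' j = true) (hsi : si = Function.update s' i false)
    (hsj : sj = Function.update s' j false) (hsij : sij = Function.update si j false)
    (hsij' : sij = Function.update sj i false) (v : TensorPow h t (D.Circle sij)) :
    edgeMap h t i si s' (edgeMap h t j sij si v) =
      edgeMap h t j sj s' (edgeMap h t i sij sj v) := by
  have hsii : si i = false := by rw [hsi, Function.update_self]
  have hsjj : sj j = false := by rw [hsj, Function.update_self]
  rw [edgeMap_eq_merge hD hsij (by rw [hsi, Function.update_of_ne hij.symm, hj]) ⟨i, hsii⟩,
    edgeMap_eq_merge hD hsij' (by rw [hsj, Function.update_of_ne hij, hi]) ⟨j, hsjj⟩]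
  have hsijj : sij j = false := by rw [hsij, Function.update_self]
  have hle : ∀ (a b : D.State) k, a = Function.update b k false → ∀ l, a l = true → b l = true := by
    intro a b k hab l hl
    by_cases hlk : l = k
    · rw [hab, hlk, Function.update_self] at hl; simp at hl
    · rwa [hab, Function.update_of_ne hlk] at hl
  by_cases h0 : ∃ p, s' p = false
  · rw [edgeMap_eq_merge hD hsi hi h0, edgeMap_eq_merge hD hsj hj h0]
    suffices H : (merge h t D si s').comp (merge h t D sij si) =
        (merge h t D sj s').comp (merge h t D sij sj) from DFunLike.congr_fun H v
    refine strand_algHom_ext hD ⟨j, hsijj⟩ fun k => ?_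
    rw [AlgHom.comp_apply, AlgHom.comp_apply,
      merge_strandDot hD (hle _ _ _ hsij) ⟨i, hsii⟩, merge_strandDot hD (hle _ _ _ hsij') ⟨j, hsjj⟩,
      merge_strandDot hD (hle _ _ _ hsi) h0, merge_strandDot hD (hle _ _ _ hsj) h0]
  · have h1 : ∀ p, s' p = true := fun p => by
      by_contra hp
      exact h0 ⟨p, by simpa using hp⟩
    rw [edgeMap_eq_split hD hsi h1 i, edgeMap_eq_split hD hsj h1 i]
    refine mul_algHom_congr (f := (carry h t D D id si s').comp (merge h t D sij si))
      (g := (carry h t D D id sj s').comp (merge h t D sij sj)) (fun c => ?_) v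
    obtain ⟨p, rfl⟩ := Quotient.exists_rep c
    obtain ⟨k, hk⟩ := hD.exists_L sij ⟨j, hsijj⟩ p
    have hk' : dot h t (Quotient.mk (D.smoothing sij) p) = strandDot h t pL sij k := by
      rw [strandDot, ← hk]; rfl
    rw [AlgHom.comp_apply, AlgHom.comp_apply, hk',
      merge_strandDot hD (hle _ _ _ hsij) ⟨i, hsii⟩, merge_strandDot hD (hle _ _ _ hsij') ⟨j, hsjj⟩,
      strandDot, strandDot, splitFactor_mul_carry hD h1 i i, splitFactor_mul_carry hD h1 i i]

/-- The square of the differential vanishes. -/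
theorem differential_comp_self (v : Chain h t D) :
    differential h t D (differential h t D v) = 0 := by
  funext s'
  have hF : differential h t D (differential h t D v) s' = ∑ x : Fin D.n × Fin D.n,
      if s' x.1 = true ∧ s' x.2 = true ∧ x.1 ≠ x.2 then
        (edgeSign D s' x.1 * edgeSign D (Function.update s' x.1 false) x.2) •
          edgeMap h t x.1 (Function.update s' x.1 false) s'
          (edgeMap h t x.2 (Function.update (Function.update s' x.1 false) x.2 false)
            (Function.update s' x.1 false)
            (v (Function.update (Function.update s' x.1 false) x.2 false))) else 0 := by
    rw [differential_apply, Fintype.sum_prod_type]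
    refine Finset.sum_congr rfl fun i _ => ?_
    by_cases hi : s' i = true
    · rw [if_pos hi, differential_apply, map_sum, Finset.smul_sum]
      refine Finset.sum_congr rfl fun j _ => ?_
      by_cases hij : i = j
      · subst hij
        simp
      · by_cases hj : s' j = true
        · rw [if_pos (by rwa [Function.update_of_ne (Ne.symm hij)]), if_pos ⟨hi, hj, hij⟩,
            map_zsmul, mul_smul]
        · rw [if_neg (by rwa [Function.update_of_ne (Ne.symm hij)]), if_neg (fun hh => hj hh.2.1),
            map_zero, smul_zero]
    · simp [hi]
  rw [hF, Pi.zero_apply]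
  -- The two ways around each square cancel.
  refine Finset.sum_involution (fun x _ => (x.2, x.1)) (fun x _ => ?_) (fun x _ hx => ?_)
    (fun x _ => Finset.mem_univ _) (fun x _ => rfl)
  · obtain ⟨i, j⟩ := x
    dsimp only
    by_cases hc : s' i = true ∧ s' j = true ∧ i ≠ j
    · obtain ⟨hi, hj, hij⟩ := hc
      have hcomm : Function.update (Function.update s' j false) i false =
        Function.update (Function.update s' i false) j false := Function.update_comm hij.symm _ _ _
      rw [if_pos ⟨hi, hj, hij⟩, if_pos ⟨hj, hi, hij.symm⟩, hcomm,
        edgeMap_comm hD hij hi hj rfl rfl rfl hcomm.symm, ← add_smul]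
      have : edgeSign D s' i * edgeSign D (Function.update s' i false) j +
          edgeSign D s' j * edgeSign D (Function.update s' j false) i = 0 := by
        simp only [edgeSign_eq]
        obtain hlt | hlt := lt_or_gt_of_ne hij
        · rw [countSign_update_of_not (fun k => j < k) s' (not_lt_of_gt hlt),
            countSign_update_false (fun k => i < k) s' hlt hj]
          ring
        · rw [countSign_update_of_not (fun k => i < k) s' (not_lt_of_gt hlt),
            countSign_update_false (fun k => j < k) s' hlt hi]
          ring
      rw [this, zero_smul]
    · rw [if_neg hc, if_neg (fun hh => hc ⟨hh.2.1, hh.1, hh.2.2.symm⟩), add_zero]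
  · intro he
    apply hx
    have : x.1 = x.2 := (congrArg Prod.fst he).symm
    rw [if_neg (fun hh => hh.2.2 this)]

end Differential

/-! ### Exactness of partial cubes, and moving chains to one vertex. -/

section Exactness

variable {R : Type*} [CommRing R] {h t : R} {D : Diagram} {pL pR : Fin D.n → D.Pt}
  (hD : D.IsNegTwoBraid pL pR)

include hD

/-- Edges only turn horizontal crossings vertical, so a vertex with `p` horizontal receives edges
only from vertices of this kind. These vertices form a quotient complex. -/
lemma differential_congr {p : Fin D.n} {v w : Chain h t D} (hvw : ∀ s, s p = false → v s = w s)
    {s' : D.State} (hs' : s' p = false) : differential h t D v s' = differential h t D w s' := by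
  rw [differential_apply_of_zero hD v ⟨p, hs'⟩, differential_apply_of_zero hD w ⟨p, hs'⟩]
  refine Finset.sum_congr rfl fun i _ => ?_
  split_ifs with hi
  · rw [hvw]
    by_cases hip : p = i
    · rw [hip, Function.update_self]
    · rw [Function.update_of_ne hip, hs']
  · rfl

/-- Exactness of the part of the complex where the crossing `p` is resolved horizontally and those
in `W` are resolved vertically, except in lowest degree. -/
theorem exists_differential_eq {W : Finset (Fin D.n)} {p : Fin D.n} (hpW : p ∉ W) {o : ℕ}
    (hWo : W.card ≤ o) {v : Chain h t D}
    (hv : ∀ s, v s ≠ 0 → s p = false ∧ (∀ w ∈ W, s w = true) ∧ onesCard s = o + 1)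
    (hd : ∀ s', s' p = false → differential h t D v s' = 0) :
    ∃ u : Chain h t D,
      (∀ s, u s ≠ 0 → s p = false ∧ (∀ w ∈ W, s w = true) ∧ onesCard s = o) ∧
      ∀ s', s' p = false → differential h t D u s' = v s' := by
  classical
  induction hN : Wᶜ.card using Nat.strong_induction_on generalizing W o v with
  | _ N ih =>
  by_cases hex : ∃ j, j ≠ p ∧ j ∉ W
  swap
  -- Only one vertex has `p` horizontal and `W` vertical. It has `W.card` vertical crossings, fewer
  -- than the degree of `v`, so `v` is zero.
  · push Not at hex
    refine ⟨0, fun s hs => absurd rfl hs, fun s' _ => ?_⟩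
    rw [map_zero]
    by_contra hne
    obtain ⟨h1, h2, h3⟩ := hv s' (Ne.symm hne)
    have : onesCard s' ≤ W.card := by
      refine Finset.card_le_card fun j hj => ?_
      refine hex j fun e => ?_
      rw [e] at hj
      simp [h1] at hj
    omega
  obtain ⟨q, B, hB⟩ := exists_isBand hex
  -- Splittings are chosen for all pairs of states at once; the merge maps are placeholders for
  -- pairs without one.
  have hsplit : ∀ s s₁ : D.State, ∃ ι ε, SplitsAt W p q B s s₁ →
      IsSplitting (h := h) (t := t) pL q B s s₁ ι ε := fun s s₁ => by
    by_cases hs : SplitsAt W p q B s s₁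
    · obtain ⟨ι, ε, hι⟩ := exists_isSplitting (h := h) (t := t) hD hs
      exact ⟨ι, ε, fun _ => hι⟩
    · exact ⟨merge h t D s₁ s, (merge h t D s s₁).toLinearMap, fun hs' => absurd hs' hs⟩
  choose ι ε hι using hsplit
  let C : D.State → Prop := fun s => s q = false ∧ s p = false ∧ ∀ w ∈ W, s w = true
  have hCs : ∀ s, C s → SplitsAt W p q B s (Function.update s q true) := fun s hs =>
    ⟨hB, hs.2.1, hs.1, hs.2.2, rfl⟩
  have hCs' : ∀ s₁, C (Function.update s₁ q false) → s₁ q = true →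
      SplitsAt W p q B (Function.update s₁ q false) s₁ := fun s₁ hs hq =>
    ⟨hB, hs.2.1, hs.1, hs.2.2, by rw [Function.update_idem, ← hq, Function.update_eq_self]⟩
  have hup : ∀ {s : D.State} {i}, s p = false → Function.update s i false p = false := by
    intro s i hs
    by_cases hip : p = i
    · rw [hip, Function.update_self]
    · rw [Function.update_of_ne hip, hs]
  have huW : ∀ {s : D.State} {i}, (∀ w ∈ W, Function.update s i false w = true) →
      ∀ w ∈ W, s w = true := by
    intro s i hs w hw
    have := hs w hw
    by_cases hip : w = i
    · rw [hip, Function.update_self] at this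
      simp at this
    · rwa [Function.update_of_ne hip] at this
  -- first correction
  let u₁ : Chain h t D := fun s => if C s then
    edgeSign D s q • ι s (Function.update s q true) (v (Function.update s q true)) else 0
  have hu₁ : ∀ s, u₁ s ≠ 0 → s p = false ∧ (∀ w ∈ W, s w = true) ∧ onesCard s = o := by
    intro s hs
    by_cases hc : C s
    · refine ⟨hc.2.1, hc.2.2, ?_⟩
      have hne : v (Function.update s q true) ≠ 0 := fun h0 => hs (by simp [u₁, h0])
      have := (hv _ hne).2.2
      rw [onesCard_update_true s hc.1] at this
      omega
    · exact absurd (by simp [u₁, hc]) hs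
  have hdsupp : ∀ (u : Chain h t D) (m : ℕ),
      (∀ s, u s ≠ 0 → s p = false ∧ (∀ w ∈ W, s w = true) ∧ onesCard s = m) →
      ∀ s, s p = false → differential h t D u s ≠ 0 →
        (∀ w ∈ W, s w = true) ∧ onesCard s = m + 1 := by
    intro u m hu s hsp hs
    rw [differential_apply_of_zero hD u ⟨p, hsp⟩] at hs
    obtain ⟨i, _, hi⟩ := Finset.exists_ne_zero_of_sum_ne_zero hs
    by_cases hsi : s i = true
    · rw [if_pos hsi] at hi
      have hne : u (Function.update s i false) ≠ 0 := fun h0 => hi (by simp [h0])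
      obtain ⟨-, h2, h3⟩ := hu _ hne
      refine ⟨huW h2, ?_⟩
      rw [← onesCard_update_false s hsi, h3]
    · exact absurd (if_neg hsi) hi
  let v₁ : Chain h t D := fun s => if s p = false then v s - differential h t D u₁ s else 0
  -- Since `u₁` lives where `q` is horizontal, only the edge at `q` contributes, and there `ι` is a
  -- section of the merge.
  have hdu₁q : ∀ s, s p = false → s q = true → differential h t D u₁ s = v s := by
    intro s hsp hsq
    rw [differential_apply_of_zero hD u₁ ⟨p, hsp⟩, Finset.sum_eq_single q]
    · rw [if_pos hsq]
      have hsb : Function.update (Function.update s q false) q true = s := by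
        rw [Function.update_idem, ← hsq, Function.update_eq_self]
      by_cases hc : C (Function.update s q false)
      · simp only [u₁, if_pos hc]
        rw [map_zsmul, smul_smul, edgeSign_eq, edgeSign_eq,
          countSign_update_of_not _ _ (lt_irrefl q), countSign_mul_self, one_smul]
        have key : ∀ s₂, Function.update (Function.update s q false) q true = s₂ →
            merge h t D (Function.update s q false) s₂
              (ι (Function.update s q false) (Function.update (Function.update s q false) q true)
                (v (Function.update (Function.update s q false) q true))) = v s₂ := by
          rintro _ rfl
          exact merge_splitting hD (hCs _ hc) (hι _ _ (hCs _ hc)) _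
        exact key s hsb
      · simp only [u₁, if_neg hc, map_zero, smul_zero]
        by_contra hne
        obtain ⟨h1, h2, h3⟩ := hv s (Ne.symm hne)
        refine hc ⟨Function.update_self _ _ _, hup hsp, fun w hw => ?_⟩
        rw [Function.update_of_ne (fun e => hB.notMem (by rw [← e]; exact hw)), h2 w hw]
    · intro i _ hiq
      split_ifs with hsi
      · have : ¬ C (Function.update s i false) := fun hc => by
          have := hc.1
          rw [Function.update_of_ne hiq.symm, hsq] at this
          simp at this
        simp [u₁, this]
      · rfl
    · exact fun hq => absurd (Finset.mem_univ q) hq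
  have hv₁ : ∀ s, v₁ s ≠ 0 → C s ∧ onesCard s = o + 1 := by
    intro s hs
    by_cases hsp : s p = false
    swap
    · exact absurd (if_neg hsp) hs
    have hs' : v s - differential h t D u₁ s ≠ 0 := by simpa only [v₁, if_pos hsp] using hs
    have hq : s q = false := by
      by_contra hq
      rw [Bool.not_eq_false] at hq
      rw [hdu₁q s hsp hq, sub_self] at hs'
      exact hs' rfl
    by_cases h0 : v s = 0
    · have hne : differential h t D u₁ s ≠ 0 := fun h1 => hs' (by rw [h0, h1, sub_zero])
      obtain ⟨h2, h3⟩ := hdsupp u₁ o hu₁ s hsp hne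
      exact ⟨⟨hq, hsp, h2⟩, h3⟩
    · obtain ⟨h1, h2, h3⟩ := hv s h0
      exact ⟨⟨hq, hsp, h2⟩, h3⟩
  have hdv₁ : ∀ s', s' p = false → differential h t D v₁ s' = 0 := by
    intro s' hs'
    rw [differential_congr hD (w := v - differential h t D u₁)
      (fun s hs => by simp only [v₁, if_pos hs]; rfl) hs', map_sub, Pi.sub_apply, hd s' hs',
      differential_comp_self hD, Pi.zero_apply, sub_zero]
  -- The remainder vanishes where `q` is vertical, so the component of its boundary at such a vertex
  -- is this merge alone, up to sign.
  have hmv₁ : ∀ s, C s → merge h t D s (Function.update s q true) (v₁ s) = 0 := by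
    intro s hc
    have hp1 : Function.update s q true p = false := by
      rw [Function.update_of_ne hB.ne.symm, hc.2.1]
    have hsum := hdv₁ _ hp1
    rw [differential_apply_of_zero hD v₁ ⟨p, hp1⟩, Finset.sum_eq_single q] at hsum
    · rw [if_pos (Function.update_self _ _ _)] at hsum
      have hsb : Function.update (Function.update s q true) q false = s := by
        rw [Function.update_idem, ← hc.1, Function.update_eq_self]
      rw [hsb] at hsum
      have := congrArg (edgeSign D (Function.update s q true) q • ·) hsum
      rwa [smul_smul, edgeSign_eq, countSign_mul_self, one_smul, smul_zero] at this
    · intro i _ hiq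
      split_ifs with hsi
      · have : v₁ (Function.update (Function.update s q true) i false) = 0 := by
          by_contra hne
          have := (hv₁ _ hne).1.1
          rw [Function.update_of_ne hiq.symm, Function.update_self] at this
          simp at this
        rw [this, map_zero, smul_zero]
      · rfl
    · exact fun hq => absurd (Finset.mem_univ q) hq
  -- the quotient
  let σ : D.State → ℤ := fun s => countSign (fun j => j < q) s
  let y : Chain h t D := fun s₁ => if s₁ q = true then
    σ s₁ • ε (Function.update s₁ q false) s₁ (v₁ (Function.update s₁ q false)) else 0
  have hy : ∀ s, y s ≠ 0 →
      s p = false ∧ (∀ w ∈ insert q W, s w = true) ∧ onesCard s = (o + 1) + 1 := by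
    intro s hs
    by_cases hq : s q = true
    · have hne : v₁ (Function.update s q false) ≠ 0 := fun h0 => hs (by simp [y, h0])
      obtain ⟨h1, h2⟩ := hv₁ _ hne
      refine ⟨?_, fun w hw => ?_, ?_⟩
      · have := h1.2.1
        rwa [Function.update_of_ne hB.ne.symm] at this
      · obtain rfl | hw := Finset.mem_insert.1 hw
        · exact hq
        · exact huW h1.2.2 w hw
      · rw [← onesCard_update_false s hq, h2]
    · exact absurd (if_neg hq) hs
  have hdy : ∀ s₁, s₁ p = false → differential h t D y s₁ = 0 := by
    intro s₁ hp1
    by_cases hq1 : s₁ q = true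
    swap
    · rw [differential_apply_of_zero hD y ⟨p, hp1⟩]
      refine Finset.sum_eq_zero fun i _ => ?_
      split_ifs with hsi
      · have : ¬ Function.update s₁ i false q = true := by
          by_cases hqi : q = i
          · simp [hqi]
          · rwa [Function.update_of_ne hqi]
        simp [y, this]
      · rfl
    have hsp : Function.update s₁ q false p = false := hup hp1
    -- The projection commutes with the merges, and `σ` absorbs the signs that change when `q`
    -- becomes vertical.
    have hterm : differential h t D y s₁ = σ s₁ • ε (Function.update s₁ q false) s₁
        (differential h t D v₁ (Function.update s₁ q false)) := by
      rw [differential_apply_of_zero hD y ⟨p, hp1⟩,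
        differential_apply_of_zero hD v₁ ⟨p, hsp⟩, map_sum, Finset.smul_sum]
      refine Finset.sum_congr rfl fun i _ => ?_
      by_cases hiq : i = q
      · subst hiq
        simp [y]
      · rw [Function.update_of_ne hiq]
        by_cases hsi : s₁ i = true
        swap
        · rw [if_neg hsi, if_neg hsi, map_zero, smul_zero]
        rw [if_pos hsi, if_pos hsi]
        have hcomm : Function.update (Function.update s₁ q false) i false =
          Function.update (Function.update s₁ i false) q false :=
          Function.update_comm (Ne.symm hiq) _ _ _
        have hqi : Function.update s₁ i false q = true := by
          rwa [Function.update_of_ne (Ne.symm hiq)]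
        rw [hcomm]
        simp only [y, if_pos hqi]
        by_cases h0 : v₁ (Function.update (Function.update s₁ i false) q false) = 0
        · simp [h0]
        have hC1 := (hv₁ _ h0).1
        have hC2 : C (Function.update s₁ q false) :=
          ⟨Function.update_self _ _ _, hsp, huW (i := i) (by rw [hcomm]; exact hC1.2.2)⟩
        have hS1 := hCs' (Function.update s₁ i false) hC1 hqi
        have hS2 := hCs' s₁ hC2 hq1
        rw [map_zsmul, map_zsmul, smul_smul, smul_smul,
          merge_comm_proj hD hS1 (hι _ _ hS1) hS2 (hι _ _ hS2) (fun j hj => ?_)]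
        · congr 1
          exact countSign_swap s₁ hiq hsi hq1
        · by_cases hji : j = i
          · rw [hji, ← hcomm, Function.update_self] at hj
            simp at hj
          · rwa [← hcomm, Function.update_of_ne hji] at hj
    rw [hterm, hdv₁ _ hsp, map_zero, smul_zero]
  have hlt : (insert q W)ᶜ.card < N := by
    rw [← hN]
    refine Finset.card_lt_card ⟨fun i hi => ?_, fun hsub => ?_⟩
    · simp only [Finset.mem_compl, Finset.mem_insert, not_or] at hi ⊢
      exact hi.2
    · have := hsub (Finset.mem_compl.2 hB.notMem)
      simp at this
  -- The quotient is a cycle with `q` also vertical. Both its degree and the number of prescribed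
  -- vertical crossings have grown by one, so the degree hypothesis persists.
  obtain ⟨u', hu', hdu'⟩ := ih _ hlt (W := insert q W)
    (by simp only [Finset.mem_insert, not_or]; exact ⟨hB.ne.symm, hpW⟩) (o := o + 1)
    (by rw [Finset.card_insert_of_notMem hB.notMem]; omega) hy hdy rfl
  -- second correction
  let u₂ : Chain h t D := fun s => if C s then
    σ s • ((strandDot h t pL s q - strandDot h t pL s (finRotate _ q)) *
      ι s (Function.update s q true) (u' (Function.update s q true))) else 0
  have hu₂ : ∀ s, u₂ s ≠ 0 → s p = false ∧ (∀ w ∈ W, s w = true) ∧ onesCard s = o := by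
    intro s hs
    by_cases hc : C s
    · refine ⟨hc.2.1, hc.2.2, ?_⟩
      have hne : u' (Function.update s q true) ≠ 0 := fun h0 => hs (by simp [u₂, h0])
      have := (hu' _ hne).2.2
      rw [onesCard_update_true s hc.1] at this
      omega
    · exact absurd (by simp [u₂, hc]) hs
  -- Multiplying by the difference at `q` reverses the division. The edge at `q` kills `u₂`, and
  -- along the other edges its boundary is the quotient times that difference.
  have hdu₂ : ∀ s', s' p = false → differential h t D u₂ s' = v₁ s' := by
    intro s' hsp
    by_cases hsq : s' q = true
    · have hz : v₁ s' = 0 := by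
        by_contra hne
        have := (hv₁ _ hne).1.1
        rw [hsq] at this
        simp at this
      rw [hz, differential_apply_of_zero hD u₂ ⟨p, hsp⟩]
      refine Finset.sum_eq_zero fun i _ => ?_
      split_ifs with hsi
      · by_cases hc : C (Function.update s' i false)
        · have hiq : i = q := by
            by_contra hiq
            have := hc.1
            rw [Function.update_of_ne (Ne.symm hiq), hsq] at this
            simp at this
          subst hiq
          simp only [u₂, if_pos hc]
          rw [map_zsmul, merge_dot_sub_mul hD (hCs' s' hc hsq), smul_zero, smul_zero]
        · simp [u₂, hc]
      · rfl
    rw [Bool.not_eq_true] at hsq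
    by_cases hW : ∀ w ∈ W, s' w = true
    swap
    · have hz : v₁ s' = 0 := by
        by_contra hne
        exact hW (hv₁ _ hne).1.2.2
      rw [hz]
      by_contra hne
      exact hW (hdsupp u₂ o hu₂ s' hsp hne).1
    have hC : C s' := ⟨hsq, hsp, hW⟩
    have hS := hCs s' hC
    have hp1 : Function.update s' q true p = false := hS.p_one
    have hsb : Function.update (Function.update s' q true) q false = s' := by
      rw [Function.update_idem, ← hsq, Function.update_eq_self]
    have hterm : differential h t D u₂ s' =
        (strandDot h t pL s' q - strandDot h t pL s' (finRotate _ q)) *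
        ι s' (Function.update s' q true)
          (σ s' • differential h t D u' (Function.update s' q true)) := by
      rw [differential_apply_of_zero hD u₂ ⟨p, hsp⟩,
        differential_apply_of_zero hD u' ⟨p, hp1⟩, Finset.smul_sum, map_sum, Finset.mul_sum]
      refine Finset.sum_congr rfl fun i _ => ?_
      by_cases hiq : i = q
      · subst hiq
        rw [if_neg (by simp [hsq]), if_pos (Function.update_self _ _ _), hsb]
        have : u' s' = 0 := by
          by_contra hne
          have := (hu' _ hne).2.1 i (Finset.mem_insert_self _ _)
          rw [hsq] at this
          simp at this
        rw [this, map_zero, smul_zero, smul_zero, map_zero, mul_zero]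
      · rw [Function.update_of_ne hiq]
        by_cases hsi : s' i = true
        swap
        · rw [if_neg hsi, if_neg hsi, smul_zero, map_zero, mul_zero]
        rw [if_pos hsi, if_pos hsi]
        have hcomm : Function.update (Function.update s' q true) i false =
          Function.update (Function.update s' i false) q true :=
          Function.update_comm (Ne.symm hiq) _ _ _
        rw [hcomm]
        have hqi : Function.update s' i false q = false := by
          rwa [Function.update_of_ne (Ne.symm hiq)]
        by_cases h0 : u' (Function.update (Function.update s' i false) q true) = 0
        · simp [u₂, h0]
        have hCi : C (Function.update s' i false) := by
          obtain ⟨h1, h2, -⟩ := hu' _ h0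
          refine ⟨hqi, hup hsp, fun w hw => ?_⟩
          have := h2 w (Finset.mem_insert_of_mem hw)
          rwa [Function.update_of_ne (fun e => hB.notMem (by rw [← e]; exact hw))] at this
        have hSi := hCs _ hCi
        have hle : ∀ j, Function.update s' i false j = true → s' j = true := by
          intro j hj
          by_cases hji : j = i
          · rw [hji, Function.update_self] at hj; simp at hj
          · rwa [Function.update_of_ne hji] at hj
        simp only [u₂, if_pos hCi]
        rw [map_zsmul, map_mul, map_sub, merge_strandDot hD hle ⟨p, hsp⟩,
          merge_strandDot hD hle ⟨p, hsp⟩,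
          merge_comm_splitting hD hSi (hι _ _ hSi) hS (hι _ _ hS) hle, map_zsmul, map_zsmul,
          mul_smul_comm, mul_smul_comm, smul_smul, smul_smul]
        congr 1
        have hsw := countSign_swap (Function.update s' q true) hiq
          (by rwa [Function.update_of_ne hiq]) (Function.update_self _ _ _)
        rw [hsb, hcomm, countSign_update_of_not (fun j => j < q) _ (lt_irrefl q),
          countSign_update_of_not (fun j => j < q) s' (lt_irrefl q)] at hsw
        simp only [σ, edgeSign_eq]
        have e1 := countSign_mul_self (fun j => i < j) s'
        have e2 := countSign_mul_self (fun j => i < j) (Function.update s' q true)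
        linear_combination (countSign (fun j => i < j) s' *
          countSign (fun j => i < j) (Function.update s' q true)) * hsw -
          (countSign (fun j => i < j) s' *
            countSign (fun j => j < q) (Function.update s' i false)) * e2 +
          (countSign (fun j => i < j) (Function.update s' q true) *
            countSign (fun j => j < q) s') * e1
    rw [hterm, hdu' _ hp1]
    simp only [y, if_pos (Function.update_self q true s')]
    rw [hsb, smul_smul]
    simp only [σ]
    rw [countSign_update_of_not (fun j => j < q) s' (lt_irrefl q), countSign_mul_self, one_smul]
    exact (eq_of_merge_eq_zero hD hS (hι _ _ hS) (hmv₁ s' hC)).symm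
  refine ⟨u₁ + u₂, fun s hs => ?_, fun s' hs' => ?_⟩
  · by_cases h1 : u₁ s = 0
    · exact hu₂ s fun h2 => hs (by rw [Pi.add_apply, h1, h2, add_zero])
    · exact hu₁ s h1
  · rw [map_add, Pi.add_apply, hdu₂ s' hs']
    simp only [v₁, if_pos hs']
    abel

/-- Modulo boundaries, a chain with `o` crossings resolved vertically can be moved to the vertices
at which the crossings in `V` are resolved vertically. -/
theorem exists_sub_differential {V : Finset (Fin D.n)} {o : ℕ} (hVo : V.card ≤ o)
    {v : Chain h t D} (hv : ∀ s, v s ≠ 0 → onesCard s = o)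
    (hd : ∀ s', (∃ p ∈ V, s' p = false) → differential h t D v s' = 0) :
    ∃ u : Chain h t D, ∀ s, (v - differential h t D u) s ≠ 0 →
      (∀ w ∈ V, s w = true) ∧ onesCard s = o := by
  classical
  induction V using Finset.induction_on with
  | empty => exact ⟨0, fun s hs => ⟨by simp, hv s (by simpa using hs)⟩⟩
  | insert p W hpW ih =>
    rw [Finset.card_insert_of_notMem hpW] at hVo
    obtain ⟨u, hu⟩ := ih (by omega) fun s' ⟨q, hq, hs'⟩ =>
      hd s' ⟨q, Finset.mem_insert_of_mem hq, hs'⟩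
    obtain ⟨o, rfl⟩ : ∃ m, o = m + 1 := ⟨o - 1, by omega⟩
    set v' : Chain h t D := v - differential h t D u with hv'
    have hdv' : differential h t D v' = differential h t D v := by
      rw [hv', map_sub, differential_comp_self hD, sub_zero]
    -- The part with `p` horizontal is a cycle in the quotient complex of such vertices, above the
    -- lowest degree, so a boundary cancels it without leaving the vertices where `W` is vertical.
    let v₀ : Chain h t D := fun s => if s p = false then v' s else 0
    obtain ⟨u₀, hu₀, hdu₀⟩ := exists_differential_eq hD hpW (o := o) (by omega) (v := v₀)
      (fun s hs => by
        by_cases hsp : s p = false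
        · obtain ⟨h1, h2⟩ := hu s (by simpa only [v₀, if_pos hsp] using hs)
          exact ⟨hsp, h1, h2⟩
        · exact absurd (if_neg hsp) hs)
      (fun s' hs' => by
        rw [differential_congr hD (w := v') (fun s hs => by simp only [v₀, if_pos hs]) hs', hdv',
          hd s' ⟨p, Finset.mem_insert_self _ _, hs'⟩])
    refine ⟨u + u₀, fun s hs => ?_⟩
    have hs2 : v' s - differential h t D u₀ s ≠ 0 := by
      have : (v - differential h t D (u + u₀)) s = v' s - differential h t D u₀ s := by
        rw [hv', map_add]
        simp only [Pi.sub_apply, Pi.add_apply]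
        abel
      rwa [this] at hs
    have hsp : s p = true := by
      by_contra hsp
      rw [Bool.not_eq_true] at hsp
      rw [hdu₀ s hsp] at hs2
      simp [v₀, hsp] at hs2
    have hWo : (∀ w ∈ W, s w = true) ∧ onesCard s = o + 1 := by
      by_cases h0 : v' s = 0
      · rw [h0, zero_sub, neg_ne_zero, differential_apply] at hs2
        obtain ⟨i, _, hi⟩ := Finset.exists_ne_zero_of_sum_ne_zero hs2
        by_cases hsi : s i = true
        · rw [if_pos hsi] at hi
          have hne : u₀ (Function.update s i false) ≠ 0 := fun h0 => hi (by simp [h0])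
          obtain ⟨-, h2, h3⟩ := hu₀ _ hne
          refine ⟨fun w hw => ?_, by rw [← onesCard_update_false s hsi, h3]⟩
          have := h2 w hw
          by_cases hwi : w = i
          · rw [hwi, hsi]
          · rwa [Function.update_of_ne hwi] at this
        · exact absurd (if_neg hsi) hi
      · exact hu s h0
    exact ⟨fun w hw => (Finset.mem_insert.1 hw).elim (fun e => e ▸ hsp) (hWo.1 w), hWo.2⟩

end Exactness

/-! ### Circles after a piece is added at the bottom. -/

section Raise

lemma finRotate_succ_of_ne {m : ℕ} {i : Fin (m + 1)} (hi : i ≠ Fin.last m) :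
    finRotate (m + 2) i.succ = (finRotate (m + 1) i).succ := by
  have h1 : i.succ ≠ Fin.last (m + 1) := by
    rw [← Fin.succ_last]
    exact fun h => hi (Fin.succ_injective _ h)
  ext
  rw [coe_finRotate_of_ne_last h1, Fin.val_succ, Fin.val_succ, coe_finRotate_of_ne_last hi]

lemma finRotate_succ_last (m : ℕ) : finRotate (m + 2) (Fin.last m).succ = 0 := by
  rw [Fin.succ_last, finRotate_last]

lemma finRotate_zero' (m : ℕ) : finRotate (m + 2) 0 = (0 : Fin (m + 1)).succ := by
  ext
  rw [finRotate_apply]; simp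

variable {x y : Slot} {l : List Slot}

lemma circle_head_vertical {s : (closure (x :: y :: l)).State} (hx : headState s ≠ x.positive) :
    (closure (x :: y :: l)).circle s ((0 : Fin (l.length + 2)), .L) =
      (closure (x :: y :: l)).circle s ((0 : Fin (l.length + 1)).succ, .L) ∧
    (closure (x :: y :: l)).circle s ((0 : Fin (l.length + 2)), .R) =
      (closure (x :: y :: l)).circle s ((0 : Fin (l.length + 1)).succ, .R) := by
  have h := circle_slotConst s (0 : Fin (l.length + 2))
  have h0 : finRotate (x :: y :: l).length (0 : Fin (l.length + 2)) =
    (0 : Fin (l.length + 1)).succ := finRotate_zero' _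
  have hx0 : (x :: y :: l).get (0 : Fin (l.length + 2)) = x := rfl
  rw [h0, SlotConst, hx0, if_neg (show ¬ s (0 : Fin (l.length + 2)) = _ from hx)] at h
  obtain ⟨h1, h2, h3⟩ := h
  refine ⟨h3, ?_⟩
  split_ifs at h1
  · exact h1.1
  · exact h1.1.trans (h2.trans h1.2)

/-- The circles of a stack are preserved when a vertically resolved piece is added. -/
lemma circle_raise {s' : (closure (x :: y :: l)).State} (hx : headState s' ≠ x.positive)
    {p q : (closure (y :: l)).Pt}
    (h : (closure (y :: l)).circle (tailState s') p = (closure (y :: l)).circle (tailState s') q) :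
    (closure (x :: y :: l)).circle s' (raise x p) =
      (closure (x :: y :: l)).circle s' (raise x q) := by
  refine closure_eq_of_circle_eq (s := tailState s')
    (g := fun p => (closure (x :: y :: l)).circle s' (raise x p)) (fun i => ?_) h
  have hi := circle_slotConst s' (Fin.succ i)
  have hh := circle_head_vertical hx
  have key : (closure (x :: y :: l)).circle s' (finRotate (x :: y :: l).length i.succ, .L) =
        (closure (x :: y :: l)).circle s' ((finRotate (y :: l).length i).succ, .L) ∧
      (closure (x :: y :: l)).circle s' (finRotate (x :: y :: l).length i.succ, .R) =
        (closure (x :: y :: l)).circle s' ((finRotate (y :: l).length i).succ, .R) := by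
    by_cases hil : i = Fin.last l.length
    · have e1 : finRotate (x :: y :: l).length i.succ = (0 : Fin (l.length + 2)) := by
        rw [hil]; exact finRotate_succ_last _
      have e2 : finRotate (y :: l).length i = (0 : Fin (l.length + 1)) := by
        rw [hil]; exact finRotate_last
      rw [e1, e2]
      exact hh
    · have e1 : finRotate (x :: y :: l).length i.succ = (finRotate (y :: l).length i).succ :=
        finRotate_succ_of_ne hil
      rw [e1]
      exact ⟨rfl, rfl⟩
  rw [key.1, key.2] at hi
  exact hi

end Raise

/-! ### Saddles and kinks. -/

section Moves

variable {R : Type*} [CommRing R] {h t : R}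

lemma saddle_of_merge {D D' : Diagram} {f : D.Pt → D'.Pt} {s : D.State} {s' : D'.State}
    {p q : D.Pt} {p' q' : D'.Pt} (h1 : D.circle s p ≠ D.circle s q)
    (h2 : D'.circle s' p' = D'.circle s' q') (v : TensorPow h t (D.Circle s)) :
    saddle h t D D' f s s' p q p' q' v = carry h t D D' f s s' v := by
  rw [saddle, if_pos ⟨h1, h2⟩]; rfl

lemma saddle_of_split {D D' : Diagram} {f : D.Pt → D'.Pt} {s : D.State} {s' : D'.State}
    {p q : D.Pt} {p' q' : D'.Pt} (h1 : D.circle s p = D.circle s q)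
    (h2 : D'.circle s' p' ≠ D'.circle s' q') (v : TensorPow h t (D.Circle s)) :
    saddle h t D D' f s s' p q p' q' v =
      (dot h t (D'.circle s' p') + dot h t (D'.circle s' q') - algebraMap R _ h) *
        carry h t D D' f s s' v := by
  rw [saddle, if_neg (fun hh => hh.1 h1), if_pos ⟨h1, h2⟩]; rfl

/-- Algebra maps from the labels of a resolution are determined by the images of the dots. -/
lemma circle_algHom_ext {D : Diagram} {s : D.State} {B : Type*} [Ring B] [Algebra R B]
    {f g : TensorPow h t (D.Circle s) →ₐ[R] B}
    (hfg : ∀ p, f (dot h t (D.circle s p)) = g (dot h t (D.circle s p))) : f = g :=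
  TensorPow.algHom_ext fun c => by
    obtain ⟨p, rfl⟩ := Quotient.exists_rep c
    exact hfg p

lemma mul_circle_algHom_congr {D : Diagram} {s : D.State} {B : Type*} [CommRing B] [Algebra R B]
    {f g : TensorPow h t (D.Circle s) →ₐ[R] B} {e : B}
    (H : ∀ p, e * f (dot h t (D.circle s p)) = e * g (dot h t (D.circle s p)))
    (v : TensorPow h t (D.Circle s)) : e * f v = e * g v :=
  mul_algHom_congr (fun c => by
    obtain ⟨p, rfl⟩ := Quotient.exists_rep c
    exact H p) v

variable {l : List Slot}

/-- The loop of a vertically resolved kink is a circle of its own. -/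
lemma kink_loop {x : Slot} (hk : x.kink = true) {s : (closure (x :: l)).State}
    (hx : headState s ≠ x.positive) {i : Fin (l.length + 1)} {m : Mark}
    (h : (closure (x :: l)).circle s (i, m) =
      (closure (x :: l)).circle s ((0 : Fin (l.length + 1)), .P)) :
    i = 0 ∧ (m = .P ∨ m = .Q) := by
  have := closure_eq_of_circle_eq (s := s)
    (g := fun p => p.1 = (0 : Fin (l.length + 1)) ∧ (p.2 = .P ∨ p.2 = .Q)) (fun j => ?_) h
  · simpa using this
  · refine Fin.cases ?_ (fun j => ?_) j
    · have h0 : (x :: l).get (0 : Fin (l.length + 1)) = x := rfl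
      rw [SlotConst, h0, if_neg (show ¬ s (0 : Fin (l.length + 1)) = _ from hx), hk]
      simp
    · have : (Fin.succ j : Fin (l.length + 1)) ≠ 0 := Fin.succ_ne_zero j
      rw [SlotConst]
      split_ifs <;> simp [this]

lemma kink_circle_Q {x : Slot} (hk : x.kink = true) (s : (closure (x :: l)).State) :
    (closure (x :: l)).circle s ((0 : Fin (l.length + 1)), .Q) =
      (closure (x :: l)).circle s ((0 : Fin (l.length + 1)), .P) := by
  have h := circle_slotConst s (0 : Fin (l.length + 1))
  have h0 : (x :: l).get (0 : Fin (l.length + 1)) = x := rfl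
  rw [SlotConst, h0, hk] at h
  exact h.1.2

/-- Contracting a vertically resolved positive kink. -/
lemma circle_lower {y : Slot} {s : (closure (y :: l)).State} {p q : (closure (.posKink :: y :: l)).Pt}
    (h : (closure (.posKink :: y :: l)).circle (consState .posKink false s) p =
      (closure (.posKink :: y :: l)).circle (consState .posKink false s) q) :
    (closure (y :: l)).circle s (lower .posKink y p) =
      (closure (y :: l)).circle s (lower .posKink y q) := by
  refine closure_eq_of_circle_eq (s := consState .posKink false s)
    (g := fun p => (closure (y :: l)).circle s (lower .posKink y p)) (fun i => ?_) h
  refine Fin.cases ?_ (fun j => ?_) i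
  · have h0 : finRotate (Slot.posKink :: y :: l).length (0 : Fin (l.length + 2)) =
      (0 : Fin (l.length + 1)).succ := finRotate_zero' _
    rw [h0]
    exact ⟨⟨rfl, rfl⟩, rfl, rfl⟩
  · have hj := circle_slotConst s j
    have key : ∀ m, m = .L ∨ m = .R → lower (l := l) .posKink y
        (finRotate (Slot.posKink :: y :: l).length j.succ, m) =
        (finRotate (y :: l).length j, m) := by
      intro m hm
      by_cases hjl : j = Fin.last l.length
      · have e1 : finRotate (Slot.posKink :: y :: l).length j.succ = (0 : Fin (l.length + 2)) := by
          rw [hjl]; exact finRotate_succ_last _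
        have e2 : finRotate (y :: l).length j = (0 : Fin (l.length + 1)) := by
          rw [hjl]; exact finRotate_last
        rw [e1, e2]
        obtain rfl | rfl := hm <;> rfl
      · have e1 : finRotate (Slot.posKink :: y :: l).length j.succ =
          (finRotate (y :: l).length j).succ := finRotate_succ_of_ne hjl
        rw [e1]
        rfl
    rw [key .L (Or.inl rfl), key .R (Or.inr rfl)]
    exact hj

end Moves

/-! ### The embedded step on chains. -/

section Moves

variable {R : Type*} [CommRing R] {h t : R}

lemma carry_dot_of_circle {D D' : Diagram} {f : D.Pt → D'.Pt} {s : D.State} {s' : D'.State}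
    (H : ∀ p q, D.circle s p = D.circle s q → D'.circle s' (f p) = D'.circle s' (f q)) (p : D.Pt) :
    carry h t D D' f s s' (dot h t (D.circle s p)) = dot h t (D'.circle s' (f p)) :=
  carry_dot (fun p q hpq => H p q hpq.circle_eq) p

lemma mapR1_apply (l : List Slot) (v : Chain h t (closure l))
    (s : (closure (.negKink :: l)).State) : mapR1 h t l v s =
      if headState s = true then carry h t (closure l) (closure (.negKink :: l)) (raise .negKink)
        (tailState s) s (v (tailState s)) else 0 := by
  rw [mapR1, LinearMap.pi_apply]
  split_ifs <;> rfl

lemma mapR2_apply_vertical (x : Slot) (l : List Slot) (v : Chain h t (closure (x :: l)))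
    {s : (closure (.pos :: .neg :: x :: l)).State} (h1 : headState s = false)
    (h2 : headState (tailState s) = true) : mapR2 h t x l v s =
      carry h t (closure (x :: l)) (closure (.pos :: .neg :: x :: l))
        (fun p => raise .pos (raise .neg p)) (tailState (tailState s)) s
        (v (tailState (tailState s))) := by
  rw [mapR2, LinearMap.pi_apply, if_pos ⟨h1, h2⟩]
  rfl

lemma mapR2_apply_horizontal (x : Slot) (l : List Slot) (v : Chain h t (closure (x :: l)))
    {s : (closure (.pos :: .neg :: x :: l)).State} (h1 : headState s = true)
    (h2 : headState (tailState s) = false) : mapR2 h t x l v s =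
      saddle h t (closure (x :: l)) (closure (.pos :: .neg :: x :: l))
        (fun p => raise .pos (raise .neg p)) (tailState (tailState s)) s
          (pt (l := x :: l) (0 : Fin (l.length + 1)) .L)
          (pt (l := x :: l) (0 : Fin (l.length + 1)) .R)
          (pt (l := .pos :: .neg :: x :: l) (0 : Fin (l.length + 3)) .L)
          (pt (l := .pos :: .neg :: x :: l) (2 : Fin (l.length + 3)) .L)
        (v (tailState (tailState s))) := by
  rw [mapR2, LinearMap.pi_apply, if_neg (fun hh => by rw [h1] at hh; simp at hh), if_pos ⟨h1, h2⟩]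
  rfl

lemma mapR2_apply_of_eq (x : Slot) (l : List Slot) (v : Chain h t (closure (x :: l)))
    {s : (closure (.pos :: .neg :: x :: l)).State} (h1 : headState s = headState (tailState s)) :
    mapR2 h t x l v s = 0 := by
  rw [mapR2, LinearMap.pi_apply, if_neg (fun hh => by rw [h1, hh.2] at hh; simp at hh),
    if_neg (fun hh => by rw [h1, hh.2] at hh; simp at hh)]
  rfl

lemma SlotConst.map {β γ : Sort*} {x : Slot} {b : Bool} {g : Mark → β} {gL gR : β} (f : β → γ)
    (hg : SlotConst x b g gL gR) : SlotConst x b (fun m => f (g m)) (f gL) (f gR) := by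
  obtain ⟨h1, h2⟩ := hg
  constructor
  · split_ifs at h1 ⊢ <;> exact ⟨congrArg f h1.1, congrArg f h1.2⟩
  · split_ifs at h2 ⊢ <;> exact ⟨congrArg f h2.1, congrArg f h2.2⟩

lemma slotConst_neg_true {β : Sort*} {g : Mark → β} {gL gR : β} :
    SlotConst .neg true g gL gR ↔ (g .R = g .P ∧ g .Q = gR) ∧ g .P = g .Q ∧ g .L = gL := by
  simp [SlotConst, Slot.kink, Slot.positive]

lemma slotConst_neg_false {β : Sort*} {g : Mark → β} {gL gR : β} :
    SlotConst .neg false g gL gR ↔ (g .R = g .P ∧ g .Q = gR) ∧ g .L = g .P ∧ g .Q = gL := by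
  simp [SlotConst, Slot.kink, Slot.positive]

lemma slotConst_negKink_true {β : Sort*} {g : Mark → β} {gL gR : β} :
    SlotConst .negKink true g gL gR ↔ (g .R = gR ∧ g .Q = g .P) ∧ g .P = g .Q ∧ g .L = gL := by
  simp [SlotConst, Slot.kink, Slot.positive]

lemma carry_carry {D₀ D₁ D₂ : Diagram} {s₀ : D₀.State} {s₁ : D₁.State} {s₂ : D₂.State}
    {f : D₀.Pt → D₁.Pt} {g : D₁.Pt → D₂.Pt} {k : D₀.Pt → D₂.Pt}
    (hf : ∀ p q, D₀.circle s₀ p = D₀.circle s₀ q → D₁.circle s₁ (f p) = D₁.circle s₁ (f q))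
    (hg : ∀ p q, D₁.circle s₁ p = D₁.circle s₁ q → D₂.circle s₂ (g p) = D₂.circle s₂ (g q))
    (hk : ∀ p, D₂.circle s₂ (k p) = D₂.circle s₂ (g (f p))) (z : TensorPow h t (D₀.Circle s₀)) :
    carry h t D₁ D₂ g s₁ s₂ (carry h t D₀ D₁ f s₀ s₁ z) = carry h t D₀ D₂ k s₀ s₂ z := by
  suffices H : (carry h t D₁ D₂ g s₁ s₂).comp (carry h t D₀ D₁ f s₀ s₁) =
    carry h t D₀ D₂ k s₀ s₂ from DFunLike.congr_fun H z
  refine circle_algHom_ext fun p => ?_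
  rw [AlgHom.comp_apply, carry_dot_of_circle hf, carry_dot_of_circle hg,
    carry_dot_of_circle (fun p q hpq => by rw [hk, hk]; exact hg _ _ (hf _ _ hpq)), hk]

/-- Splitting a circle off and capping it. -/
lemma counitAt_saddle {D₀ D₁ D₂ : Diagram} {s₀ : D₀.State} {s₁ : D₁.State} {s₂ : D₂.State}
    {f : D₀.Pt → D₁.Pt} {g : D₁.Pt → D₂.Pt} {pR pQ : D₁.Pt} {pR' pQ' pP' : D₂.Pt}
    (hf : ∀ p q, D₀.circle s₀ p = D₀.circle s₀ q → D₁.circle s₁ (f p) = D₁.circle s₁ (f q))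
    (hgf : ∀ p q, D₀.circle s₀ p = D₀.circle s₀ q →
      D₂.circle s₂ (g (f p)) = D₂.circle s₂ (g (f q)))
    (h1 : D₁.circle s₁ pR = D₁.circle s₁ pQ) (hR : D₂.circle s₂ pR' ≠ D₂.circle s₂ pP')
    (hQ : D₂.circle s₂ pQ' = D₂.circle s₂ pP')
    (hne : ∀ p, D₂.circle s₂ (g (f p)) ≠ D₂.circle s₂ pP')
    (hg : ∀ {g' : D₂.Circle s₂ → TensorPow h t (D₂.Circle s₂)},
      g' (D₂.circle s₂ pR') = g' (D₂.circle s₂ pP') →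
      ∀ p q, D₁.Joined s₁ p q → g' (D₂.circle s₂ (g p)) = g' (D₂.circle s₂ (g q)))
    (z : TensorPow h t (D₀.Circle s₀)) :
    counitAt h t (D₂.circle s₂ pP')
      (saddle h t D₁ D₂ g s₁ s₂ pR pQ pR' pQ' (carry h t D₀ D₁ f s₀ s₁ z)) =
      carry h t D₀ D₂ (fun p => g (f p)) s₀ s₂ z := by
  rw [saddle_of_split h1 (by rwa [hQ]), hQ]
  set e : TensorPow h t (D₂.Circle s₂) := dot h t (D₂.circle s₂ pR') +
    dot h t (D₂.circle s₂ pP') - algebraMap R _ h with he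
  -- Splitting breaks a circle of `D₁`, so `g` need not respect circles; after multiplication by `e`
  -- the two halves carry equal dots and the choice of half is immaterial.
  have key : e * carry h t D₁ D₂ g s₁ s₂ (carry h t D₀ D₁ f s₀ s₁ z) =
      e * carry h t D₀ D₂ (fun p => g (f p)) s₀ s₂ z := by
    refine mul_circle_algHom_congr (f := (carry h t D₁ D₂ g s₁ s₂).comp
      (carry h t D₀ D₁ f s₀ s₁)) (fun p => ?_) z
    rw [AlgHom.comp_apply, carry_dot_of_circle hf, carry_dot_of_circle hgf]
    exact mul_carry_dot (hg (g' := fun c => e * dot h t c) (split_mul_dot _ _)) _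
  -- None of the incoming labels lies on the capped circle, so they can be taken out of the counit.
  have hG : ∀ w : TensorPow h t (D₂.Circle s₂), counitAt h t (D₂.circle s₂ pP')
      (carry h t D₀ D₂ (fun p => g (f p)) s₀ s₂ z * w) =
      carry h t D₀ D₂ (fun p => g (f p)) s₀ s₂ z * counitAt h t (D₂.circle s₂ pP') w := by
    clear key
    induction z using TensorPow.induction with
    | halg r =>
      intro w
      rw [AlgHom.commutes, ← Algebra.smul_def, map_smul, Algebra.smul_def]
    | hdot c =>
      intro w
      obtain ⟨p, rfl⟩ := Quotient.exists_rep c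
      change counitAt h t _ (carry h t D₀ D₂ _ s₀ s₂ (dot h t (D₀.circle s₀ p)) * w) =
        carry h t D₀ D₂ _ s₀ s₂ (dot h t (D₀.circle s₀ p)) * _
      rw [carry_dot_of_circle hgf]
      exact counitAt_label_mul_of_ne (hne p) _ _
    | hadd v w hv hw =>
      intro u
      rw [map_add, add_mul, map_add, hv, hw, add_mul]
    | hmul v w hv hw =>
      intro u
      rw [map_mul (carry h t D₀ D₂ (fun p => g (f p)) s₀ s₂), mul_assoc, hv, hw, mul_assoc]
  -- The counit axiom: capping one leg of the comultiplication gives the identity.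
  have hce : counitAt h t (D₂.circle s₂ pP') e = 1 := by
    have hR1 : counitAt h t (D₂.circle s₂ pP') (dot h t (D₂.circle s₂ pR')) = 0 := by
      have := counitAt_label_mul_of_ne (h := h) (t := t) hR (genX h t) 1
      rwa [mul_one, counitAt_one, mul_zero] at this
    rw [he, map_sub, map_add, counitAt_dot, hR1, Algebra.algebraMap_eq_smul_one, map_smul,
      counitAt_one, smul_zero, zero_add, sub_zero]
  rw [key, mul_comm, hG, hce, mul_one]

variable (L : List Slot)

/-- Splitting a loop off a strand and capping it. -/
lemma lower_counitAt_saddle (s : (closure (.neg :: .neg :: L)).State) (hs : headState s = true)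
    (z : TensorPow h t ((closure (.neg :: L)).Circle (tailState s))) :
    carry h t (closure (.posKink :: .neg :: .neg :: L)) (closure (.neg :: .neg :: L))
      (lower .posKink .neg) (consState .posKink false s) s
      (counitAt h t ((closure (.posKink :: .neg :: .neg :: L)).circle (consState .posKink false s)
          (pt (l := .posKink :: .neg :: .neg :: L) (0 : Fin (L.length + 3)) .P))
        (saddle h t (closure (.pos :: .neg :: .neg :: L)) (closure (.posKink :: .neg :: .neg :: L))
          id (consState .pos false s) (consState .posKink false s)
          (pt (l := .pos :: .neg :: .neg :: L) (0 : Fin (L.length + 3)) .R)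
          (pt (l := .pos :: .neg :: .neg :: L) (0 : Fin (L.length + 3)) .Q)
          (pt (l := .posKink :: .neg :: .neg :: L) (0 : Fin (L.length + 3)) .R)
          (pt (l := .posKink :: .neg :: .neg :: L) (0 : Fin (L.length + 3)) .Q)
          (carry h t (closure (.neg :: L)) (closure (.pos :: .neg :: .neg :: L))
            (fun p => raise .pos (raise .neg p)) (tailState s) (consState .pos false s) z))) =
    carry h t (closure (.neg :: L)) (closure (.neg :: .neg :: L)) (raise .neg) (tailState s) s z := by
  have hneg : headState s ≠ Slot.neg.positive := by rw [hs]; simp [Slot.positive]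
  have hv₁ : headState (l := .neg :: .neg :: L) (x := .pos) (consState .pos false s) ≠
    Slot.pos.positive := by change false ≠ true; simp
  have hv₂ : headState (l := .neg :: .neg :: L) (x := .posKink) (consState .posKink false s) ≠
    Slot.posKink.positive := by change false ≠ true; simp
  have hloop := fun i m => kink_loop (x := .posKink) (l := .neg :: .neg :: L) (i := i) (m := m)
    rfl hv₂
  have h1 := circle_slotConst (l := .pos :: .neg :: .neg :: L) (consState .pos false s)
    (0 : Fin (L.length + 3))
  have h2 := circle_slotConst (l := .posKink :: .neg :: .neg :: L) (consState .posKink false s)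
  have hr₂ : ∀ p q, (closure (.neg :: L)).circle (tailState s) p =
        (closure (.neg :: L)).circle (tailState s) q →
      (closure (.posKink :: .neg :: .neg :: L)).circle (consState .posKink false s)
        (raise .posKink (raise .neg p)) =
      (closure (.posKink :: .neg :: .neg :: L)).circle (consState .posKink false s)
        (raise .posKink (raise .neg q)) :=
    fun p q hpq => circle_raise (s' := consState .posKink false s) hv₂
      (circle_raise (s' := s) hneg hpq)
  refine (congrArg (carry h t (closure (.posKink :: .neg :: .neg :: L)) (closure (.neg :: .neg :: L))
      (lower .posKink .neg) (consState .posKink false s) s) (counitAt_saddle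
        (fun p q hpq => circle_raise (s' := consState .pos false s) hv₁
          (circle_raise (s' := s) hneg hpq)) hr₂ ?_ ?_ ?_ ?_ ?_ z)).trans ?_
  · obtain ⟨⟨a, b⟩, c, d⟩ := h1
    exact a.trans c
  · intro hh
    simpa using (hloop _ _ hh).2
  · exact kink_circle_Q rfl _
  · intro p hh
    exact absurd (hloop _ _ hh).1 (Fin.succ_ne_zero _)
  · intro g' hg'
    refine closure_const_iff (l := .pos :: .neg :: .neg :: L) (s := consState .pos false s)
      (g := fun p => g' ((closure (.posKink :: .neg :: .neg :: L)).circle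
        (consState .posKink false s) p)) |>.2 fun i => ?_
    refine Fin.cases ?_ (fun j => ?_) i
    · obtain ⟨⟨a1, a2⟩, a3, a4⟩ := h2 (0 : Fin (L.length + 3))
      exact ⟨⟨hg', (congrArg g' a2).trans (hg'.symm.trans (congrArg g' a1))⟩,
        congrArg g' a3, congrArg g' a4⟩
    · exact (h2 (Fin.succ j)).map g'
  · exact carry_carry (k := raise .neg) hr₂ (fun p q => circle_lower) (fun p => rfl) z

/-- The kink is exchanged for a crossing: a merge of its loop with the right strand. -/
lemma saddle_negKink (s' : (closure (.neg :: .neg :: .neg :: L)).State) (hs : headState s' = true)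
    (z : TensorPow h t ((closure (.neg :: .neg :: L)).Circle (tailState s'))) :
    saddle h t (closure (.negKink :: .neg :: .neg :: L)) (closure (.neg :: .neg :: .neg :: L))
      id s' s'
      (pt (l := .negKink :: .neg :: .neg :: L) (0 : Fin (L.length + 3)) .R)
      (pt (l := .negKink :: .neg :: .neg :: L) (0 : Fin (L.length + 3)) .Q)
      (pt (l := .neg :: .neg :: .neg :: L) (0 : Fin (L.length + 3)) .R)
      (pt (l := .neg :: .neg :: .neg :: L) (0 : Fin (L.length + 3)) .Q)
      (carry h t (closure (.neg :: .neg :: L)) (closure (.negKink :: .neg :: .neg :: L))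
        (raise .negKink) (tailState s') s' z) =
    carry h t (closure (.neg :: .neg :: L)) (closure (.neg :: .neg :: .neg :: L)) (raise .neg)
      (tailState s') s' z := by
  have hv : headState (l := .neg :: .neg :: L) (x := .negKink) s' ≠ Slot.negKink.positive := by
    rw [show headState (l := .neg :: .neg :: L) (x := .negKink) s' = true from hs]
    simp [Slot.positive]
  have h2 := circle_slotConst (l := .neg :: .neg :: .neg :: L) s'
  have hs0 : s' (0 : Fin (L.length + 3)) = true := hs
  have h20 := h2 (0 : Fin (L.length + 3))
  rw [hs0] at h20
  obtain ⟨⟨a1, a2⟩, a3, a4⟩ := slotConst_neg_true.1 h20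
  refine (saddle_of_merge (fun hh => ?_) (a1.trans a3) _).trans ?_
  · have := (kink_loop (x := .negKink) (l := .neg :: .neg :: L) rfl hv
      (hh.trans (kink_circle_Q (x := .negKink) (l := .neg :: .neg :: L) rfl s'))).2
    simp at this
  · have hf : ∀ p q, (closure (.neg :: .neg :: L)).circle (tailState s') p =
          (closure (.neg :: .neg :: L)).circle (tailState s') q →
        (closure (.negKink :: .neg :: .neg :: L)).circle s' (raise .negKink p) =
          (closure (.negKink :: .neg :: .neg :: L)).circle s' (raise .negKink q) :=
      fun p q hpq => circle_raise (x := .negKink) (s' := s') hv hpq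
    have hg : ∀ p q, (closure (.negKink :: .neg :: .neg :: L)).circle s' p =
          (closure (.negKink :: .neg :: .neg :: L)).circle s' q →
        (closure (.neg :: .neg :: .neg :: L)).circle s' p =
          (closure (.neg :: .neg :: .neg :: L)).circle s' q := by
      refine fun p q => closure_eq_of_circle_eq (l := .negKink :: .neg :: .neg :: L) (s := s')
        (g := fun p => (closure (.neg :: .neg :: .neg :: L)).circle s' p) fun i => ?_
      refine Fin.cases ?_ (fun j => ?_) i
      · rw [hs0]
        exact slotConst_negKink_true.2 ⟨⟨(a1.trans a3).trans a2, a3.symm⟩, a3, a4⟩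
      · exact h2 (Fin.succ j)
    exact carry_carry (D₀ := closure (.neg :: .neg :: L))
      (D₁ := closure (.negKink :: .neg :: .neg :: L))
      (D₂ := closure (.neg :: .neg :: .neg :: L)) (s₀ := tailState s') (s₁ := s') (s₂ := s')
      (f := raise .negKink) (g := id) (k := raise .neg) hf hg (fun p => rfl) z

/-- The map of the embedded step. -/
theorem embedded_apply (v : Chain h t (closure (.neg :: L)))
    (s' : (closure (.neg :: .neg :: .neg :: L)).State) :
    mapSaddle h t .negKink .neg (.neg :: .neg :: L) (mapR1 h t (.neg :: .neg :: L)
      (mapR1Inv h t .neg (.neg :: L) (mapSaddle h t .pos .posKink (.neg :: .neg :: L)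
        (mapR2 h t .neg L v)))) s' =
    if headState s' = true ∧ headState (tailState s') = true then
      carry h t (closure (.neg :: L)) (closure (.neg :: .neg :: .neg :: L))
        (fun p => raise .neg (raise .neg p)) (tailState (tailState s')) s'
        (v (tailState (tailState s'))) else 0 := by
  have e1 : ∀ w : Chain h t (closure (.negKink :: .neg :: .neg :: L)),
    mapSaddle h t .negKink .neg (.neg :: .neg :: L) w s' =
    saddle h t (closure (.negKink :: .neg :: .neg :: L)) (closure (.neg :: .neg :: .neg :: L))
      id s' s'
      (pt (l := .negKink :: .neg :: .neg :: L) (0 : Fin (L.length + 3)) .R)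
      (pt (l := .negKink :: .neg :: .neg :: L) (0 : Fin (L.length + 3)) .Q)
      (pt (l := .neg :: .neg :: .neg :: L) (0 : Fin (L.length + 3)) .R)
      (pt (l := .neg :: .neg :: .neg :: L) (0 : Fin (L.length + 3)) .Q) (w s') := fun w => rfl
  rw [e1]
  by_cases hs : headState s' = true
  · have hw : ∀ w : Chain h t (closure (.neg :: .neg :: L)), mapR1 h t (.neg :: .neg :: L) w s' =
      carry h t (closure (.neg :: .neg :: L)) (closure (.negKink :: .neg :: .neg :: L))
        (raise .negKink) (tailState s') s' (w (tailState s')) := fun w =>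
      (mapR1_apply (.neg :: .neg :: L) w s').trans (if_pos hs)
    rw [hw, saddle_negKink L s' hs]
    have hw2 : ∀ w : Chain h t (closure (.pos :: .neg :: .neg :: L)),
      mapR1Inv h t .neg (.neg :: L) (mapSaddle h t .pos .posKink (.neg :: .neg :: L) w)
        (tailState s') =
      carry h t (closure (.posKink :: .neg :: .neg :: L)) (closure (.neg :: .neg :: L))
        (lower .posKink .neg) (consState .posKink false (tailState s')) (tailState s')
        (counitAt h t ((closure (.posKink :: .neg :: .neg :: L)).circle
            (consState .posKink false (tailState s'))
          (pt (l := .posKink :: .neg :: .neg :: L) (0 : Fin (L.length + 3)) .P))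
        (saddle h t (closure (.pos :: .neg :: .neg :: L)) (closure (.posKink :: .neg :: .neg :: L))
          id (consState .pos false (tailState s')) (consState .posKink false (tailState s'))
          (pt (l := .pos :: .neg :: .neg :: L) (0 : Fin (L.length + 3)) .R)
          (pt (l := .pos :: .neg :: .neg :: L) (0 : Fin (L.length + 3)) .Q)
          (pt (l := .posKink :: .neg :: .neg :: L) (0 : Fin (L.length + 3)) .R)
          (pt (l := .posKink :: .neg :: .neg :: L) (0 : Fin (L.length + 3)) .Q)
          (w (consState .pos false (tailState s'))))) := fun w => rfl
    rw [hw2]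
    -- Removing the positive kink selects the `0`-resolution of the positive crossing. There the R2
    -- map is nonzero only if the negative crossing above is resolved vertically.
    by_cases hs2 : headState (tailState s') = true
    · rw [if_pos ⟨hs, hs2⟩]
      have h3 := mapR2_apply_vertical .neg L v
        (s := consState (l := .neg :: .neg :: L) .pos false (tailState s')) rfl hs2
      rw [h3]
      refine (congrArg _ (lower_counitAt_saddle L (tailState s') hs2
        (v (tailState (tailState s'))))).trans ?_
      exact carry_carry
        (fun p q hpq => circle_raise (s' := tailState s') (by rw [hs2]; simp [Slot.positive]) hpq)
        (fun p q hpq => circle_raise (s' := s') (by rw [hs]; simp [Slot.positive]) hpq)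
        (fun p => rfl) _
    · rw [if_neg (fun hh => hs2 hh.2)]
      have h3 := mapR2_apply_of_eq .neg L v
        (s := consState (l := .neg :: .neg :: L) .pos false (tailState s'))
        (show false = headState (tailState s') by simpa using hs2)
      rw [h3]
      simp only [map_zero]
  · have hw : ∀ w : Chain h t (closure (.neg :: .neg :: L)), mapR1 h t (.neg :: .neg :: L) w s' =
      0 := fun w => (mapR1_apply (.neg :: .neg :: L) w s').trans (if_neg hs)
    rw [hw, map_zero, if_neg (fun hh => hs hh.1)]

end Moves

/-! ### Product classes after two crossings are added. -/

section Shift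

variable {R : Type*} [CommRing R] {h t : R}

lemma mul_prod_congr {ι A : Type*} [CommRing A] {e : A} {S : Finset ι} {f g : ι → A}
    (H : ∀ i ∈ S, e * f i = e * g i) : e * ∏ i ∈ S, f i = e * ∏ i ∈ S, g i := by
  classical
  induction S using Finset.induction_on with
  | empty => simp
  | insert i S hi ih =>
    rw [Finset.prod_insert hi, Finset.prod_insert hi, ← mul_assoc, H i (by simp), mul_right_comm,
      ih fun j hj => H j (by simp [hj])]
    ring

lemma prod_ite_succ_succ {m : ℕ} {A : Type*} [CommMonoid A] (b : Fin (m + 3) → Bool)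
    (f : Fin (m + 3) → A) (p : Fin (m + 1)) :
    (∏ r, if b r = false ∧ r ≠ p.succ.succ then f r else 1) =
      (if b 0 = false then f 0 else 1) * ((if b 1 = false then f 1 else 1) *
        ∏ r : Fin (m + 1), if b r.succ.succ = false ∧ r ≠ p then f r.succ.succ else 1) := by
  rw [Fin.prod_univ_succ, Fin.prod_univ_succ]
  congr 1
  · simp [(Fin.succ_ne_zero _).symm]
  congr 1
  · refine if_congr ⟨fun hh => hh.1, fun hh => ⟨hh, fun e => ?_⟩⟩ rfl rfl
    exact Fin.succ_ne_zero _ (Fin.succ_injective _ e).symm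
  · simp

/-- The lower left end of a piece. -/
abbrev lowerLeft (l : List Slot) : Fin (closure l).n → (closure l).Pt := fun i => (i, .L)

/-- The lower right end of a piece. -/
abbrev lowerRight (l : List Slot) : Fin (closure l).n → (closure l).Pt := fun i => (i, .R)

variable {L : List Slot} {s' : (closure (.neg :: .neg :: .neg :: L)).State}
  {u : (closure (.neg :: L)).State}

variable (h t) in
/-- The dot on the lower left end of a piece of a stack of negative crossings. -/
noncomputable def leftDot (s' : (closure (.neg :: .neg :: .neg :: L)).State)
    (i : Fin (closure (.neg :: .neg :: .neg :: L)).n) :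
    TensorPow h t ((closure (.neg :: .neg :: .neg :: L)).Circle s') :=
  strandDot h t (lowerLeft (.neg :: .neg :: .neg :: L)) s' i

/-- The index of a piece after two pieces have been added below it. -/
def raiseIndex (p : Fin (closure (.neg :: L)).n) : Fin (closure (.neg :: .neg :: .neg :: L)).n :=
  Fin.succ (n := L.length + 2) (Fin.succ (n := L.length + 1) p)

variable (h t) in
/-- The factors of `strandProd` that come from the pieces above the bottom two. -/
noncomputable def upperProd (s' : (closure (.neg :: .neg :: .neg :: L)).State)
    (u : (closure (.neg :: L)).State) (p : Fin (closure (.neg :: L)).n) :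
    TensorPow h t ((closure (.neg :: .neg :: .neg :: L)).Circle s') :=
  ∏ r, if u r = false ∧ r ≠ p then
    leftDot h t s' (raiseIndex r) - leftDot h t s' (finRotate _ (raiseIndex r)) else 1

lemma strandProd_raiseIndex (p : Fin (closure (.neg :: L)).n) :
    strandProd h t (lowerLeft (.neg :: .neg :: .neg :: L)) s' (raiseIndex p) =
    (if headState s' = false then leftDot h t s' (0 : Fin (L.length + 3)) - leftDot h t s' (1 : Fin (L.length + 3)) else 1) *
      ((if headState (tailState s') = false then leftDot h t s' (1 : Fin (L.length + 3)) - leftDot h t s' (2 : Fin (L.length + 3)) else 1) *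
        upperProd h t s' (tailState (tailState s')) p) := by
  have h1 : finRotate (L.length + 3) 0 = 1 := by rw [finRotate_apply, zero_add]
  have h2 : finRotate (L.length + 3) (0 : Fin (L.length + 2)).succ = 2 := by
    rw [finRotate_apply]; rfl
  have e1 : leftDot h t s' (0 : Fin (L.length + 3)) -
      leftDot h t s' (finRotate (L.length + 3) (0 : Fin (L.length + 3))) =
      leftDot h t s' (0 : Fin (L.length + 3)) - leftDot h t s' (1 : Fin (L.length + 3)) :=
    congrArg (fun i => leftDot h t s' (0 : Fin (L.length + 3)) - leftDot h t s' i) h1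
  have e2 : leftDot h t s' (1 : Fin (L.length + 3)) -
      leftDot h t s' (finRotate (L.length + 3) (1 : Fin (L.length + 3))) =
      leftDot h t s' (1 : Fin (L.length + 3)) - leftDot h t s' (2 : Fin (L.length + 3)) :=
    congrArg (fun i => leftDot h t s' (1 : Fin (L.length + 3)) - leftDot h t s' i) h2
  rw [← e1, ← e2]
  exact prod_ite_succ_succ s' (fun r => leftDot h t s' r - leftDot h t s' (finRotate _ r)) p

/-- The only discrepancy is at the closing of the braid: above the last piece comes piece `0` of the
tall stack, but the bottom piece of the short stack has become piece `2`. The hypothesis on `e`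
identifies the dots at these two places. -/
lemma mul_map_strandClass {e : TensorPow h t ((closure (.neg :: .neg :: .neg :: L)).Circle s')}
    {φ : TensorPow h t ((closure (.neg :: L)).Circle u) →ₐ[R]
      TensorPow h t ((closure (.neg :: .neg :: .neg :: L)).Circle s')}
    (hφ : ∀ p, e * φ (dot h t ((closure (.neg :: L)).circle u p)) =
      e * dot h t ((closure (.neg :: .neg :: .neg :: L)).circle s' (raise .neg (raise .neg p))))
    (he : e * leftDot h t s' (0 : Fin (L.length + 3)) = e * leftDot h t s' (2 : Fin (L.length + 3))) (p : Fin (closure (.neg :: L)).n)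
    (a : FrobAlg R h t) :
    e * φ (strandClass h t (lowerLeft (.neg :: L)) u p a) =
      e * (label h t ((closure (.neg :: .neg :: .neg :: L)).circle s' (lowerLeft _ (raiseIndex p))) a *
        upperProd h t s' u p) := by
  have hl : e * φ (label h t ((closure (.neg :: L)).circle u (lowerLeft _ p)) a) =
      e * label h t ((closure (.neg :: .neg :: .neg :: L)).circle s' (lowerLeft _ (raiseIndex p))) a := by
    have := hφ (lowerLeft _ p)
    rw [map_label, label_eq, mul_add, mul_add, mul_left_comm, this, mul_left_comm]
    rfl
  have hd : ∀ r : Fin (L.length + 1), e * φ (strandDot h t (lowerLeft (.neg :: L)) u r) =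
    e * leftDot h t s' r.succ.succ := fun r => hφ (r, .L)
  have hprod : e * φ (strandProd h t (lowerLeft (.neg :: L)) u p) = e * upperProd h t s' u p := by
    rw [strandProd, map_prod]
    refine mul_prod_congr fun r _ => ?_
    revert r
    change ∀ r : Fin (L.length + 1), _
    intro r _
    split_ifs
    · rw [map_sub, mul_sub, mul_sub, hd]
      congr 1
      refine (hd (finRotate (L.length + 1) r)).trans ?_
      by_cases hr : r = Fin.last L.length
      · have e1 : finRotate (L.length + 3) r.succ.succ = 0 := by
          rw [hr, Fin.succ_last]; exact finRotate_succ_last _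
        have e2 : finRotate (L.length + 1) r = 0 := by rw [hr]; exact finRotate_last
        rw [e2]
        exact he.symm.trans (congrArg (fun i => e * leftDot h t s' i) e1.symm)
      · have hr' : r.succ ≠ Fin.last (L.length + 1) := fun hh => hr (by
          rw [← Fin.succ_last] at hh
          exact Fin.succ_injective _ hh)
        exact congrArg (fun i => e * leftDot h t s' i) ((finRotate_succ_of_ne hr').trans
          (congrArg Fin.succ (finRotate_succ_of_ne hr))).symm
    · rw [map_one]
  rw [strandClass_apply, map_mul, ← mul_assoc, hl, mul_right_comm, hprod]
  ring

end Shift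

/-! ### The immersed step on chains. -/

section Immersed

variable {R : Type*} [CommRing R] {h t : R} {L : List Slot}

lemma slotConst_pos_true {β : Sort*} {g : Mark → β} {gL gR : β} :
    SlotConst .pos true g gL gR ↔ SlotConst .neg false g gL gR := by
  simp [SlotConst, Slot.kink, Slot.positive]

/-- Pieces above the two new ones are unchanged, so the relation must only be repaired where the
closure arcs run into piece `0` instead of piece `2`. -/
lemma eq_raise_raise_of_joined {β : Sort*} {x y z : Slot} {u : (closure (z :: L)).State}
    {G : (closure (x :: y :: z :: L)).Pt → β}
    (hG : ∀ j : Fin (L.length + 1), SlotConst ((z :: L).get j) (u j)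
      (fun m => G ((j.succ.succ : Fin (L.length + 3)), m))
      (G (finRotate (L.length + 3) j.succ.succ, .L)) (G (finRotate (L.length + 3) j.succ.succ, .R)))
    (hL : G ((0 : Fin (L.length + 3)), .L) = G ((2 : Fin (L.length + 3)), .L))
    (hR : G ((0 : Fin (L.length + 3)), .R) = G ((2 : Fin (L.length + 3)), .R))
    (p q : (closure (z :: L)).Pt) (hpq : (closure (z :: L)).Joined u p q) :
    G (raise x (raise y p)) = G (raise x (raise y q)) := by
  refine (closure_const_iff (g := fun p => G (raise x (raise y p)))).2 (fun i => ?_) p q hpq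
  revert i
  change ∀ i : Fin (L.length + 1), SlotConst ((z :: L).get i) (u i)
    (fun m => G ((i.succ.succ : Fin (L.length + 3)), m))
    (G (((finRotate (L.length + 1) i).succ.succ : Fin (L.length + 3)), .L))
    (G (((finRotate (L.length + 1) i).succ.succ : Fin (L.length + 3)), .R))
  intro i
  have hi := hG i
  by_cases hil : i = Fin.last L.length
  · have e1 : finRotate (L.length + 3) i.succ.succ = 0 := by
      rw [hil, Fin.succ_last]; exact finRotate_succ_last _
    have e2 : (finRotate (L.length + 1) i).succ.succ = (2 : Fin (L.length + 3)) := by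
      rw [hil, finRotate_last]; rfl
    rw [e1] at hi
    rw [e2]
    rwa [← hL, ← hR]
  · have hi' : i.succ ≠ Fin.last (L.length + 1) := fun hh => hil (by
      rw [← Fin.succ_last] at hh
      exact Fin.succ_injective _ hh)
    have e1 : finRotate (L.length + 3) i.succ.succ = (finRotate (L.length + 1) i).succ.succ := by
      rw [finRotate_succ_of_ne hi', finRotate_succ_of_ne hil]
    rwa [e1] at hi

variable (hL : ∀ i : Fin L.length, L.get i = .neg)

section Circles

variable {s : (closure (.pos :: .neg :: .neg :: L)).State} (h0 : headState s = true)
  (h1 : headState (tailState s) = false)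

include hL

lemma kink_eq_false_pos (i : Fin (L.length + 3)) :
    ((.pos :: .neg :: .neg :: L : List Slot).get i).kink = false := by
  refine Fin.cases rfl (Fin.cases rfl (Fin.cases rfl fun j => ?_)) i
  exact (congrArg Slot.kink (hL j)).trans rfl

lemma vertical_upper {u : (closure (.neg :: L)).State} (i : Fin (L.length + 1)) :
    u i ≠ ((.neg :: L : List Slot).get i).positive ↔ u i = true := by
  have : ((.neg :: L : List Slot).get i).positive = false :=
    Fin.cases rfl (fun j => (congrArg Slot.positive (hL j)).trans rfl) i
  rw [this]
  simp

/-- The left strand that leaves piece `2` upwards meets only vertical crossings before the closure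
brings it to piece `0`. -/
lemma circle_two_eq_zero (hu : ∀ i, tailState (tailState s) i = true) :
    (closure (.pos :: .neg :: .neg :: L)).circle s ((0 : Fin (L.length + 3)), .L) =
      (closure (.pos :: .neg :: .neg :: L)).circle s ((2 : Fin (L.length + 3)), .L) := by
  have key : ∀ i : Fin (L.length + 3), i = 1 ∨
      (closure (.pos :: .neg :: .neg :: L)).circle s (i, .L) =
        (closure (.pos :: .neg :: .neg :: L)).circle s ((2 : Fin (L.length + 3)), .L) := by
    refine finRotate_induction (1 : Fin (L.length + 3)) (Or.inr ?_) (fun i hi1 hi => ?_)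
    · have : finRotate (L.length + 3) 1 = 2 := by rw [finRotate_apply]; rfl
      rw [this]
    · by_cases hi0 : i = 0
      · left
        rw [hi0, finRotate_apply, zero_add]
      · right
        obtain ⟨j, rfl⟩ : ∃ j : Fin (L.length + 1), i = j.succ.succ := by
          obtain ⟨i', rfl⟩ := Fin.exists_succ_eq.2 hi0
          have : i' ≠ 0 := fun e => hi1 (by rw [e]; rfl)
          obtain ⟨j, rfl⟩ := Fin.exists_succ_eq.2 this
          exact ⟨j, rfl⟩
        have hv := (circle_of_vertical (l := .pos :: .neg :: .neg :: L) (kink_eq_false_pos hL)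
          (i := (j.succ.succ : Fin (L.length + 3))) (s := s)
          ((vertical_upper (u := tailState (tailState s)) hL j).2 (hu j))).1
        exact hv.symm.trans (hi.resolve_left hi1)
  exact (key 0).resolve_left (by simp)

include h0 h1

lemma circle_two_ne_zero (hu : ∃ i, tailState (tailState s) i = false) :
    (closure (.pos :: .neg :: .neg :: L)).circle s ((0 : Fin (L.length + 3)), .L) ≠
      (closure (.pos :: .neg :: .neg :: L)).circle s ((2 : Fin (L.length + 3)), .L) := by
  obtain ⟨(z : Fin (L.length + 1)), hz⟩ := hu
  intro hc
  -- The test function marks the positions from piece `2` up to the first horizontal crossing `≥ 2`.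
  -- It holds at piece `2` and fails at piece `0`.
  have := eq_of_circle_eq_of_vertical (l := .pos :: .neg :: .neg :: L) (kink_eq_false_pos hL)
    (s := s) (y := fun i : Fin (L.length + 3) => 2 ≤ i.val ∧ ∀ j : Fin (L.length + 1),
      j.val + 2 < i.val → tailState (tailState s) j = true) ?_ (by simp) (by simp) hc
  · have h2 : ((2 : Fin (L.length + 3)) : ℕ) = 2 := by
      rw [Fin.val_two]
    rw [h2] at this
    simp at this
  · change ∀ i : Fin (L.length + 3), _
    refine Fin.cases (fun hh => absurd h0 hh) (Fin.cases (fun hh => absurd h1 hh)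
      fun i hi => propext ?_)
    have hi' := (vertical_upper (u := tailState (tailState s)) hL i).1 hi
    by_cases hil : i = Fin.last L.length
    · have e1 : finRotate (L.length + 3) i.succ.succ = 0 := by
        rw [hil, Fin.succ_last]; exact finRotate_succ_last _
      have hzi : z.val < i.val := by
        have h3 : z ≠ i := fun e => by rw [e] at hz; rw [hz] at hi'; simp at hi'
        rw [hil] at h3 ⊢
        exact lt_of_le_of_ne (Fin.le_last z) (fun e => h3 (Fin.ext e))
      constructor
      · rintro ⟨-, h4⟩
        have := h4 z (by simpa using hzi)
        rw [hz] at this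
        simp at this
      · rintro ⟨h4, -⟩
        have e1' : ((finRotate (L.length + 3) i.succ.succ : Fin (L.length + 3)) : ℕ) = 0 := by
          rw [e1]; rfl
        have h4' : 2 ≤ ((finRotate (L.length + 3) i.succ.succ : Fin (L.length + 3)) : ℕ) := h4
        omega
    · have hl2 : i.succ.succ ≠ Fin.last (L.length + 2) := fun hh => hil (by
        rw [← Fin.succ_last, ← Fin.succ_last] at hh
        exact Fin.succ_injective _ (Fin.succ_injective _ hh))
      have e1 : ((finRotate (L.length + 3) i.succ.succ : Fin (L.length + 3)) : ℕ) = i.val + 3 := by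
        rw [coe_finRotate_of_ne_last hl2]
        simp
      change (2 ≤ (i.succ.succ : Fin (L.length + 3)).val ∧ _) ↔
        (2 ≤ ((finRotate (L.length + 3) i.succ.succ : Fin (L.length + 3)) : ℕ) ∧
        ∀ j : Fin (L.length + 1),
          j.val + 2 < ((finRotate (L.length + 3) i.succ.succ : Fin (L.length + 3)) : ℕ) → _)
      rw [e1]
      constructor
      · rintro ⟨h4, h5⟩
        refine ⟨by omega, fun j hj => ?_⟩
        by_cases hji : j = i
        · rw [hji]; exact hi'
        · refine h5 j ?_
          have : j.val ≠ i.val := fun e => hji (Fin.ext e)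
          change j.val + 2 < i.val + 2
          omega
      · rintro ⟨h4, h5⟩
        refine ⟨Nat.le_add_left 2 i.val, fun j hj => h5 j ?_⟩
        have hj' : j.val + 2 < i.val + 2 := hj
        omega

end Circles

lemma mapCrossingChange_apply (up : Bool) (w : Chain h t (closure (.pos :: .neg :: .neg :: L)))
    {s' : (closure (.neg :: .neg :: .neg :: L)).State} (h0 : headState s' = false) :
    mapCrossingChange h t up (.neg :: .neg :: L) w s' =
      (if up then
        dot h t ((closure (.neg :: .neg :: .neg :: L)).circle s' ((0 : Fin (L.length + 3)), .P)) -
        dot h t ((closure (.neg :: .neg :: .neg :: L)).circle s' ((0 : Fin (L.length + 3)), .Q))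
      else
        dot h t ((closure (.neg :: .neg :: .neg :: L)).circle s' ((0 : Fin (L.length + 3)), .Q)) -
        dot h t ((closure (.neg :: .neg :: .neg :: L)).circle s' ((0 : Fin (L.length + 3)), .P))) *
      carry h t (closure (.pos :: .neg :: .neg :: L)) (closure (.neg :: .neg :: .neg :: L)) id
        (consState .pos true (tailState s')) s' (w (consState .pos true (tailState s'))) := by
  rw [mapCrossingChange, LinearMap.pi_apply, if_pos h0]
  rfl

/-- The map of the immersed step at a vertex where not both of the new crossings are resolved
horizontally. -/
lemma immersed_apply_of_ne (up : Bool) (v : Chain h t (closure (.neg :: L)))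
    {s' : (closure (.neg :: .neg :: .neg :: L)).State}
    (hs : ¬ (headState s' = false ∧ headState (tailState s') = false)) :
    mapCrossingChange h t up (.neg :: .neg :: L) (mapR2 h t .neg L v) s' = 0 := by
  by_cases h0 : headState s' = false
  · have h1 : headState (tailState s') = true := by
      by_contra hh
      exact hs ⟨h0, by simpa using hh⟩
    rw [mapCrossingChange_apply up _ h0, mapR2_apply_of_eq, map_zero, mul_zero]
    exact h1.symm
  · rw [mapCrossingChange, LinearMap.pi_apply, if_neg h0]
    rfl

include hL

omit hL in
lemma carry_mul_dot_eq {D D' : Diagram} {s : D.State} {s' : D'.State} {g : D.Pt → D'.Pt}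
    (hg : ∀ p q, D.circle s p = D.circle s q → D'.circle s' (g p) = D'.circle s' (g q))
    {e : TensorPow h t (D.Circle s)} {p q : D.Pt}
    (he : e * dot h t (D.circle s p) = e * dot h t (D.circle s q)) :
    carry h t D D' g s s' e * dot h t (D'.circle s' (g p)) =
      carry h t D D' g s s' e * dot h t (D'.circle s' (g q)) := by
  rw [← carry_dot_of_circle hg, ← carry_dot_of_circle hg, ← map_mul, he, map_mul]

omit hL in
lemma carry_split {D D' : Diagram} {s : D.State} {s' : D'.State} {g : D.Pt → D'.Pt}
    (hg : ∀ p q, D.circle s p = D.circle s q → D'.circle s' (g p) = D'.circle s' (g q))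
    (p q : D.Pt) :
    carry h t D D' g s s' (dot h t (D.circle s p) + dot h t (D.circle s q) - algebraMap R _ h) =
      dot h t (D'.circle s' (g p)) + dot h t (D'.circle s' (g q)) - algebraMap R _ h := by
  rw [map_sub, map_add, carry_dot_of_circle hg, carry_dot_of_circle hg, AlgHom.commutes]

omit hL in
lemma mul_carry_carry_dot {D D₁ D' : Diagram} {u : D.State} {s₁ : D₁.State} {s' : D'.State}
    {r : D.Pt → D₁.Pt} {g : D₁.Pt → D'.Pt} {e : TensorPow h t (D₁.Circle s₁)}
    (hr : ∀ p q, D.Joined u p q →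
      e * dot h t (D₁.circle s₁ (r p)) = e * dot h t (D₁.circle s₁ (r q)))
    (hg : ∀ p q, D₁.circle s₁ p = D₁.circle s₁ q → D'.circle s' (g p) = D'.circle s' (g q))
    (p : D.Pt) :
    carry h t D₁ D' g s₁ s' e *
        (carry h t D₁ D' g s₁ s').comp (carry h t D D₁ r u s₁) (dot h t (D.circle u p)) =
      carry h t D₁ D' g s₁ s' e * dot h t (D'.circle s' (g (r p))) := by
  rw [AlgHom.comp_apply, ← map_mul, mul_carry_dot hr, map_mul, carry_dot_of_circle hg]

/-- The map of the immersed step at a vertex where both of the new crossings are resolved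
horizontally. -/
theorem exists_immersed_apply {s' : (closure (.neg :: .neg :: .neg :: L)).State}
    (h0 : headState s' = false) (h1 : headState (tailState s') = false) :
    ∃ (φ : TensorPow h t ((closure (.neg :: L)).Circle (tailState (tailState s'))) →ₐ[R]
      TensorPow h t ((closure (.neg :: .neg :: .neg :: L)).Circle s'))
      (e : TensorPow h t ((closure (.neg :: .neg :: .neg :: L)).Circle s')),
      (∀ p, e * φ (dot h t ((closure (.neg :: L)).circle (tailState (tailState s')) p)) =
        e * dot h t ((closure (.neg :: .neg :: .neg :: L)).circle s'
          (raise .neg (raise .neg p)))) ∧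
      e * leftDot h t s' (0 : Fin (L.length + 3)) = e * leftDot h t s' (2 : Fin (L.length + 3)) ∧
      (((∀ i, tailState (tailState s') i = true) ∧ e = 1) ∨
        ((∃ i, tailState (tailState s') i = false) ∧
          e = leftDot h t s' (0 : Fin (L.length + 3)) + leftDot h t s' (2 : Fin (L.length + 3)) -
            algebraMap R _ h)) ∧
      ∀ up v, mapCrossingChange h t up (.neg :: .neg :: L) (mapR2 h t .neg L v) s' =
        (if up then leftDot h t s' (0 : Fin (L.length + 3)) -
            leftDot h t s' (1 : Fin (L.length + 3))
          else leftDot h t s' (1 : Fin (L.length + 3)) -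
            leftDot h t s' (0 : Fin (L.length + 3))) *
          (e * φ (v (tailState (tailState s')))) := by
  have c' := circle_slotConst (l := .neg :: .neg :: .neg :: L) s'
  have c1 := circle_slotConst (l := .pos :: .neg :: .neg :: L) (consState .pos true (tailState s'))
  have c10 := c1 (0 : Fin (L.length + 3))
  have c11 := c1 (1 : Fin (L.length + 3))
  have r0 : finRotate (L.length + 3) 0 = 1 := by rw [finRotate_apply, zero_add]
  have r1 : finRotate (L.length + 3) 1 = 2 := by rw [finRotate_apply]; rfl
  obtain ⟨⟨a1, a2⟩, a3, a4⟩ := slotConst_neg_false.1 (slotConst_pos_true.1 c10)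
  have hs1 : (consState .pos true (tailState s') :
    (closure (.pos :: .neg :: .neg :: L)).State) (1 : Fin (L.length + 3)) = false := h1
  rw [hs1] at c11
  obtain ⟨⟨b1, b2⟩, b3, b4⟩ := slotConst_neg_false.1 c11
  have c'0 := c' (0 : Fin (L.length + 3))
  have hs0 : s' (0 : Fin (L.length + 3)) = false := h0
  rw [hs0] at c'0
  obtain ⟨⟨d1, d2⟩, d3, d4⟩ := slotConst_neg_false.1 c'0
  -- The `1`-resolution of the positive crossing and the `0`-resolution of the negative one are the
  -- same planar diagram.
  have hid : ∀ p q, (closure (.pos :: .neg :: .neg :: L)).circle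
        (consState .pos true (tailState s')) p =
      (closure (.pos :: .neg :: .neg :: L)).circle (consState .pos true (tailState s')) q →
      (closure (.neg :: .neg :: .neg :: L)).circle s' p =
      (closure (.neg :: .neg :: .neg :: L)).circle s' q := by
    refine fun p q => closure_eq_of_circle_eq (l := .pos :: .neg :: .neg :: L)
      (s := consState .pos true (tailState s'))
      (g := fun p => (closure (.neg :: .neg :: .neg :: L)).circle s' p) fun i => ?_
    exact Fin.cases (slotConst_pos_true.2 c'0) (fun j => c' (Fin.succ j)) i
  have hdP : dot h t ((closure (.neg :: .neg :: .neg :: L)).circle s'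
      ((0 : Fin (L.length + 3)), .P)) = leftDot h t s' (0 : Fin (L.length + 3)) :=
    congrArg (dot h t) d3.symm
  have hdQ : dot h t ((closure (.neg :: .neg :: .neg :: L)).circle s'
      ((0 : Fin (L.length + 3)), .Q)) = leftDot h t s' (1 : Fin (L.length + 3)) :=
    congrArg (dot h t) (d4.trans (congrArg (fun i => (closure (.neg :: .neg :: .neg :: L)).circle s'
      (i, .L)) r0))
  have hR0 : (closure (.pos :: .neg :: .neg :: L)).circle (consState .pos true (tailState s'))
      ((0 : Fin (L.length + 3)), .R) =
      (closure (.pos :: .neg :: .neg :: L)).circle (consState .pos true (tailState s'))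
      ((0 : Fin (L.length + 3)), .L) := a1.trans a3.symm
  have hR2 : (closure (.pos :: .neg :: .neg :: L)).circle (consState .pos true (tailState s'))
      ((2 : Fin (L.length + 3)), .R) =
      (closure (.pos :: .neg :: .neg :: L)).circle (consState .pos true (tailState s'))
      ((2 : Fin (L.length + 3)), .L) := by
    have h3 := b2.symm.trans b4
    rw [show finRotate (Slot.pos :: .neg :: .neg :: L).length (1 : Fin (L.length + 3)) =
      (2 : Fin (L.length + 3)) from r1] at h3
    exact h3
  -- The saddle inside the R2 map merges the two parallel circles if all older crossings are
  -- vertical, and otherwise splits the circle that contains both strands. The factor `e` treats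
  -- both cases together.
  obtain ⟨e, he0, he, hsad⟩ : ∃ e : TensorPow h t ((closure (.pos :: .neg :: .neg :: L)).Circle
      (consState .pos true (tailState s'))),
      (((∀ i, tailState (tailState s') i = true) ∧ e = 1) ∨
        ((∃ i, tailState (tailState s') i = false) ∧ e =
          dot h t ((closure (.pos :: .neg :: .neg :: L)).circle
            (consState .pos true (tailState s')) ((0 : Fin (L.length + 3)), .L)) +
          dot h t ((closure (.pos :: .neg :: .neg :: L)).circle
            (consState .pos true (tailState s')) ((2 : Fin (L.length + 3)), .L)) -
          algebraMap R _ h)) ∧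
      e * dot h t ((closure (.pos :: .neg :: .neg :: L)).circle
            (consState .pos true (tailState s')) ((0 : Fin (L.length + 3)), .L)) =
        e * dot h t ((closure (.pos :: .neg :: .neg :: L)).circle
            (consState .pos true (tailState s')) ((2 : Fin (L.length + 3)), .L)) ∧
      ∀ v : Chain h t (closure (.neg :: L)), mapR2 h t .neg L v (consState .pos true (tailState s'))
        = e * carry h t (closure (.neg :: L)) (closure (.pos :: .neg :: .neg :: L))
          (fun p => raise .pos (raise .neg p)) (tailState (tailState s'))
          (consState .pos true (tailState s')) (v (tailState (tailState s'))) := by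
    have hR2v := fun v : Chain h t (closure (.neg :: L)) => mapR2_apply_horizontal .neg L v
      (s := consState .pos true (tailState s')) rfl h1
    by_cases hu : ∀ i, tailState (tailState s') i = true
    · have h02 := circle_two_eq_zero hL (s := consState .pos true (tailState s')) hu
      refine ⟨1, Or.inl ⟨hu, rfl⟩, by rw [h02], fun v => ?_⟩
      rw [hR2v v, one_mul]
      exact saddle_of_merge (circle_L_ne_R (l := .neg :: L)
        (fun i => (vertical_upper (u := tailState (tailState s')) hL i).2 (hu i)) _ _) h02 _
    · have hu' : ∃ i, tailState (tailState s') i = false := by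
        by_contra hh
        exact hu fun i => by
          by_contra hi
          exact hh ⟨i, by simpa using hi⟩
      have h02 := circle_two_ne_zero hL (s := consState .pos true (tailState s')) rfl h1 hu'
      refine ⟨_, Or.inr ⟨hu', rfl⟩, split_mul_dot _ _, fun v => ?_⟩
      rw [hR2v v]
      refine saddle_of_split ?_ h02 _
      obtain ⟨i, hi⟩ := hu'
      have hkL : ∀ i : Fin (L.length + 1), ((.neg :: L : List Slot).get i).kink = false :=
        Fin.cases rfl fun j => (congrArg Slot.kink (hL j)).trans rfl
      refine (circle_R_eq_L (l := .neg :: L) hkL ⟨i, ?_⟩ _).symm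
      by_contra hh
      have := ((vertical_upper hL i).1 hh).symm.trans hi
      simp at this
  refine ⟨_, carry h t (closure (.pos :: .neg :: .neg :: L)) (closure (.neg :: .neg :: .neg :: L))
    id (consState .pos true (tailState s')) s' e, mul_carry_carry_dot (r := fun p =>
      raise .pos (raise .neg p)) ?_ hid, ?_, ?_, fun up v => ?_⟩
  · refine eq_raise_raise_of_joined (x := .pos) (y := .neg) (z := .neg)
      (G := fun p => e * dot h t ((closure (.pos :: .neg :: .neg :: L)).circle
        (consState .pos true (tailState s')) p)) (fun j => ?_) he ?_
    · exact (c1 (j.succ.succ : Fin (L.length + 3))).map (fun c => e * dot h t c)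
    · exact (congrArg (fun c => e * dot h t c) hR0).trans
        (he.trans (congrArg (fun c => e * dot h t c) hR2).symm)
  · exact carry_mul_dot_eq (D := closure (.pos :: .neg :: .neg :: L))
      (D' := closure (.neg :: .neg :: .neg :: L)) (s := consState .pos true (tailState s'))
      (s' := s') (g := id) hid he
  · refine he0.imp (fun hh => ⟨hh.1, by rw [hh.2, map_one]⟩) (fun hh => ⟨hh.1, ?_⟩)
    rw [hh.2]
    exact carry_split (D := closure (.pos :: .neg :: .neg :: L))
      (D' := closure (.neg :: .neg :: .neg :: L)) (s := consState .pos true (tailState s'))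
      (s' := s') (g := id) hid ((0 : Fin (L.length + 3)), .L) ((2 : Fin (L.length + 3)), .L)
  · rw [mapCrossingChange_apply up _ h0, hsad v, map_mul, hdP, hdQ]
    rfl

end Immersed

/-! ### Labels on one circle, and the identity behind the immersed step. -/

section Labels

variable {R : Type*} [CommRing R] {h t : R}

lemma exists_eq_label {ι : Type} [Finite ι] [Subsingleton ι] (c : ι) (v : TensorPow h t ι) :
    ∃ a, v = label h t c a := by
  induction v using TensorPow.induction with
  | halg r => exact ⟨algebraMap R _ r, (AlgHom.commutes _ _).symm⟩
  | hdot d => exact ⟨genX h t, by rw [Subsingleton.elim d c]; rfl⟩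
  | hadd v w hv hw =>
    obtain ⟨⟨a, rfl⟩, b, rfl⟩ := And.intro hv hw
    exact ⟨a + b, (map_add _ _ _).symm⟩
  | hmul v w hv hw =>
    obtain ⟨⟨a, rfl⟩, b, rfl⟩ := And.intro hv hw
    exact ⟨a * b, (map_mul _ _ _).symm⟩

lemma label_injective {ι : Type} [Finite ι] (c : ι) : Function.Injective (label h t c) := by
  have H : (liftDots (fun _ : ι => genX h t) (fun _ => genX_mul_genX)).comp (label h t c) =
      AlgHom.id R _ := FrobAlg.algHom_ext (by
    rw [AlgHom.comp_apply]
    exact liftDots_dot _ _ _)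
  exact Function.LeftInverse.injective (g := liftDots (fun _ : ι => genX h t)
    (fun _ => genX_mul_genX)) fun a => DFunLike.congr_fun H a

lemma carry_label {D D' : Diagram} {f : D.Pt → D'.Pt} {s : D.State} {s' : D'.State}
    (H : ∀ p q, D.circle s p = D.circle s q → D'.circle s' (f p) = D'.circle s' (f q)) (p : D.Pt)
    (a : FrobAlg R h t) :
    carry h t D D' f s s' (label h t (D.circle s p) a) = label h t (D'.circle s' (f p)) a := by
  rw [map_label, carry_dot_of_circle H, ← label_eq]

/-- Write `x_c + x_e - h` as `(x_c + x_d - h) - (x_d - x_e)`; the first part is annihilated by `x_c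
- x_d`. This turns the crossing change factor and the split factor into the factors of the two new
horizontal crossings. -/
lemma dot_sub_mul_split {ι : Type} (c d e : ι) :
    (dot h t c - dot h t d) * (dot h t c + dot h t e - algebraMap R _ h) =
      -((dot h t c - dot h t d) * (dot h t d - dot h t e)) := by
  linear_combination dot_mul_dot (h := h) (t := t) c - dot_mul_dot (h := h) (t := t) d

end Labels

/-! ### The image of the composed map. -/

section Ranges

variable {R : Type*} [CommRing R] {h t : R}

/-- The submodules of `CKh` of the closure of `l` that occur as images of the maps of the immersed
cobordisms with `m / 2` double points. -/
def IsLowRange (l : List Slot) (m : ℕ) (N : Submodule R (Chain h t (closure l))) : Prop :=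
  ∃ s : (closure l).State, (Finset.univ.filter fun i => s i = false).card = m ∧
    (((∀ i, s i = true) ∧ ∃ i, ∀ v, v ∈ N ↔
      ∃ a, v = Pi.single s (label h t ((closure l).circle s (lowerLeft l i)) a)) ∨
    ∃ p, s p = false ∧ ∀ v, v ∈ N ↔ ∃ a, v = Pi.single s (strandClass h t (lowerLeft l) s p a))

lemma mem_map_iff_single {D D' : Diagram} {N : Submodule R (Chain h t D)}
    {F : Chain h t D →ₗ[R] Chain h t D'} {u : D.State} {s : D'.State}
    {κ : FrobAlg R h t → TensorPow h t (D.Circle u)}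
    {κ' : FrobAlg R h t → TensorPow h t (D'.Circle s)}
    {Φ : TensorPow h t (D.Circle u) → TensorPow h t (D'.Circle s)}
    (hN : ∀ v, v ∈ N ↔ ∃ a, v = Pi.single u (κ a))
    (hF : ∀ x, F (Pi.single u x) = Pi.single s (Φ x))
    (h1 : ∀ a, ∃ a', Φ (κ a) = κ' a') (h2 : ∀ a', ∃ a, Φ (κ a) = κ' a') (v : Chain h t D') :
    v ∈ N.map F ↔ ∃ a, v = Pi.single s (κ' a) := by
  constructor
  · rintro ⟨w, hw, rfl⟩
    obtain ⟨a, rfl⟩ := (hN w).1 hw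
    obtain ⟨a', ha'⟩ := h1 a
    exact ⟨a', by rw [hF, ha']⟩
  · rintro ⟨a', rfl⟩
    obtain ⟨a, ha⟩ := h2 a'
    exact ⟨_, (hN _).2 ⟨a, rfl⟩, by rw [hF, ha]⟩

variable {L : List Slot}

lemma consState_consState_eq (s' : (closure (.neg :: .neg :: .neg :: L)).State) :
    consState .neg (headState s') (consState .neg (headState (tailState s'))
      (tailState (tailState s'))) = s' := by
  funext i
  revert i
  change ∀ i : Fin (L.length + 3), _
  exact Fin.cases rfl (Fin.cases rfl fun i => rfl)

lemma apply_single_eq_single {F : Chain h t (closure (.neg :: L)) →ₗ[R]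
      Chain h t (closure (.neg :: .neg :: .neg :: L))} {b : Bool} {u : (closure (.neg :: L)).State}
    {Φ : TensorPow h t ((closure (.neg :: L)).Circle u) → TensorPow h t
      ((closure (.neg :: .neg :: .neg :: L)).Circle (consState .neg b (consState .neg b u)))}
    (h1 : ∀ v, F v (consState .neg b (consState .neg b u)) = Φ (v u))
    (h2 : ∀ v s', ¬ (headState s' = b ∧ headState (tailState s') = b) → F v s' = 0)
    (h3 : ∀ v s', v (tailState (tailState s')) = 0 → F v s' = 0)
    (x : TensorPow h t ((closure (.neg :: L)).Circle u)) :
    F (Pi.single u x) = Pi.single (consState .neg b (consState .neg b u)) (Φ x) := by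
  funext s'
  by_cases hs : s' = consState .neg b (consState .neg b u)
  · subst hs
    rw [h1, Pi.single_eq_same, Pi.single_eq_same]
  · rw [Pi.single_eq_of_ne hs]
    by_cases hb : headState s' = b ∧ headState (tailState s') = b
    · refine h3 _ _ (Pi.single_eq_of_ne (fun hu => hs ?_) _)
      rw [← consState_consState_eq s', hb.1, hb.2, hu]
    · exact h2 _ _ hb

lemma card_zeros_succ_succ {m : ℕ} {b : Bool} {f : Fin (m + 2) → Bool} (h0 : f 0 = b)
    (h1 : f 1 = b) : (Finset.univ.filter fun i => f i = false).card =
      (Finset.univ.filter fun i : Fin m => f i.succ.succ = false).card +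
        if b = false then 2 else 0 := by
  rw [Fin.card_filter_univ_succ, Fin.card_filter_univ_succ, h0, ← h1]
  split_ifs <;> simp_all

lemma card_zeros_consState (b : Bool) (u : (closure (.neg :: L)).State) :
    (Finset.univ.filter fun i => (consState .neg b (consState .neg b u) :
      (closure (.neg :: .neg :: .neg :: L)).State) i = false).card =
    (Finset.univ.filter fun i => u i = false).card + if b = false then 2 else 0 :=
  card_zeros_succ_succ (m := L.length + 1) rfl rfl

/-- The embedded step preserves the form of the images. -/
lemma IsLowRange.map_embedded {m : ℕ} {N : Submodule R (Chain h t (closure (.neg :: L)))}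
    (hN : IsLowRange (.neg :: L) m N) :
    IsLowRange (.neg :: .neg :: .neg :: L) m
      (N.map (mapSaddle h t .negKink .neg (.neg :: .neg :: L) ∘ₗ mapR1 h t (.neg :: .neg :: L) ∘ₗ
        mapR1Inv h t .neg (.neg :: L) ∘ₗ mapSaddle h t .pos .posKink (.neg :: .neg :: L) ∘ₗ
        mapR2 h t .neg L)) := by
  obtain ⟨u, hu, hN⟩ := hN
  have hr : ∀ p q, (closure (.neg :: L)).circle u p = (closure (.neg :: L)).circle u q →
      (closure (.neg :: .neg :: .neg :: L)).circle (consState .neg true (consState .neg true u))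
        (raise .neg (raise .neg p)) =
      (closure (.neg :: .neg :: .neg :: L)).circle (consState .neg true (consState .neg true u))
        (raise .neg (raise .neg q)) := fun p q hpq =>
    circle_raise (s' := consState .neg true (consState .neg true u))
      (by change true ≠ false; simp) (circle_raise (s' := consState .neg true u)
        (by change true ≠ false; simp) hpq)
  have hF := apply_single_eq_single (h := h) (t := t) (b := true) (u := u)
    (F := mapSaddle h t .negKink .neg (.neg :: .neg :: L) ∘ₗ mapR1 h t (.neg :: .neg :: L) ∘ₗ
        mapR1Inv h t .neg (.neg :: L) ∘ₗ mapSaddle h t .pos .posKink (.neg :: .neg :: L) ∘ₗ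
        mapR2 h t .neg L)
    (Φ := carry h t (closure (.neg :: L)) (closure (.neg :: .neg :: .neg :: L))
        (fun p => raise .neg (raise .neg p)) u (consState .neg true (consState .neg true u)))
    (fun v => (embedded_apply L v _).trans (if_pos ⟨rfl, rfl⟩))
    (fun v s' hs => (embedded_apply L v s').trans (if_neg hs))
    (fun v s' hs => (embedded_apply L v s').trans (by rw [hs, map_zero, ite_self]))
  refine ⟨consState .neg true (consState .neg true u), (card_zeros_consState true u).trans hu, ?_⟩
  obtain ⟨h1, i, hN⟩ | ⟨p, hp, hN⟩ := hN
  · refine Or.inl ⟨?_, raiseIndex i, mem_map_iff_single hN hF ?_ ?_⟩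
    · change ∀ i : Fin (L.length + 3), _
      exact Fin.cases rfl (Fin.cases rfl fun i => h1 i)
    · exact fun a => ⟨a, carry_label hr _ _⟩
    · exact fun a => ⟨a, carry_label hr _ _⟩
  · have key : ∀ a, carry h t (closure (.neg :: L)) (closure (.neg :: .neg :: .neg :: L))
        (fun p => raise .neg (raise .neg p)) u (consState .neg true (consState .neg true u))
        (strandClass h t (lowerLeft (.neg :: L)) u p a) =
      strandClass h t (lowerLeft (.neg :: .neg :: .neg :: L)) _ (raiseIndex p) a := by
      intro a
      -- Both new crossings are vertical, so the strand runs straight from piece `0` to piece `2`.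
      have h02 : leftDot h t (consState .neg true (consState .neg true u))
          (0 : Fin (L.length + 3)) = leftDot h t (consState .neg true (consState .neg true u))
          (2 : Fin (L.length + 3)) := by
        have hv : headState (l := .neg :: .neg :: L) (x := .neg)
            (consState .neg true (consState .neg true u)) ≠ Slot.neg.positive := by
          change true ≠ false; simp
        have hv' : headState (l := .neg :: L) (x := .neg) (consState .neg true u) ≠
          Slot.neg.positive := by change true ≠ false; simp
        exact congrArg (dot h t) ((circle_head_vertical hv).1.trans
          (circle_raise hv (circle_head_vertical hv').1))
      have := mul_map_strandClass (e := 1) (fun p => by rw [carry_dot_of_circle hr])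
        (by rw [h02]) p a
      rw [one_mul, one_mul] at this
      rw [this, strandClass_apply, strandProd_raiseIndex, if_neg (by change true ≠ false; simp),
        if_neg (by change true ≠ false; simp), one_mul, one_mul]
      rfl
    exact Or.inr ⟨raiseIndex p, hp, mem_map_iff_single hN hF (fun a => ⟨a, key a⟩)
      (fun a => ⟨a, key a⟩)⟩

/-- The immersed step preserves the form of the images. -/
lemma IsLowRange.map_immersed (hL : ∀ i : Fin L.length, L.get i = .neg) (up : Bool) {m : ℕ}
    {N : Submodule R (Chain h t (closure (.neg :: L)))} (hN : IsLowRange (.neg :: L) m N) :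
    IsLowRange (.neg :: .neg :: .neg :: L) (m + 2)
      (N.map (mapCrossingChange h t up (.neg :: .neg :: L) ∘ₗ mapR2 h t .neg L)) := by
  obtain ⟨u, hu, hN⟩ := hN
  obtain ⟨φ, e, hφ, he, hcase, hF'⟩ := exists_immersed_apply (h := h) (t := t) hL
    (s' := consState .neg false (consState .neg false u)) rfl rfl
  have hF := apply_single_eq_single (h := h) (t := t) (b := false) (u := u)
    (F := mapCrossingChange h t up (.neg :: .neg :: L) ∘ₗ mapR2 h t .neg L)
    (Φ := fun x => (if up then
          leftDot h t (consState .neg false (consState .neg false u)) (0 : Fin (L.length + 3)) -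
            leftDot h t (consState .neg false (consState .neg false u)) (1 : Fin (L.length + 3))
        else leftDot h t (consState .neg false (consState .neg false u)) (1 : Fin (L.length + 3)) -
            leftDot h t (consState .neg false (consState .neg false u)) (0 : Fin (L.length + 3))) *
        (e * φ x)) (hF' up)
    (fun v s' hs => immersed_apply_of_ne up v hs)
    (fun v s' hs => by
      by_cases hb : headState s' = false ∧ headState (tailState s') = false
      · obtain ⟨φ', e', -, -, -, hF''⟩ := exists_immersed_apply (h := h) (t := t) hL hb.1 hb.2
        refine (hF'' up v).trans ?_
        rw [hs, map_zero, mul_zero, mul_zero]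
      · exact immersed_apply_of_ne up v hb)
  refine ⟨consState .neg false (consState .neg false u), ?_, Or.inr ?_⟩
  · rw [card_zeros_consState, hu, if_pos rfl]
  have hD : (closure (.neg :: .neg :: .neg :: L)).IsNegTwoBraid
      (lowerLeft (.neg :: .neg :: .neg :: L)) (lowerRight (.neg :: .neg :: .neg :: L)) := by
    refine closure_isNegTwoBraid ?_
    change ∀ i : Fin (L.length + 3), _
    exact Fin.cases rfl (Fin.cases rfl (Fin.cases rfl hL))
  -- The direction of the double point only changes a sign, which is a unit and does not affect the
  -- image.
  obtain ⟨σ, hσ, hσF⟩ : ∃ σ : R, σ * σ = 1 ∧ (if up then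
          leftDot h t (consState .neg false (consState .neg false u)) (0 : Fin (L.length + 3)) -
            leftDot h t (consState .neg false (consState .neg false u)) (1 : Fin (L.length + 3))
        else leftDot h t (consState .neg false (consState .neg false u)) (1 : Fin (L.length + 3)) -
            leftDot h t (consState .neg false (consState .neg false u)) (0 : Fin (L.length + 3))) =
        algebraMap R _ σ * (
          leftDot h t (consState .neg false (consState .neg false u)) (0 : Fin (L.length + 3)) -
            leftDot h t (consState .neg false (consState .neg false u)) (1 : Fin (L.length + 3))) := by
    cases up
    · exact ⟨-1, by ring, by rw [map_neg, map_one]; simp⟩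
    · exact ⟨1, by ring, by rw [map_one]; simp⟩
  simp only [hσF] at hF
  obtain ⟨h1, i, hN⟩ | ⟨p, hp, hN⟩ := hN
  -- The first immersed step: no older crossing is horizontal, so the saddle is a merge and
  -- contributes no factor.
  · obtain ⟨-, rfl⟩ := hcase.resolve_right fun hh => by
      obtain ⟨⟨j, hj⟩, -⟩ := hh
      have := (h1 j).symm.trans hj
      simp at this
    -- With base point `1` the product consists of the factor of crossing `0` alone, the factor of
    -- the crossing change. The label, which sits on the other circle, is then moved to the base
    -- strand.
    have hP : strandProd h t (lowerLeft (.neg :: .neg :: .neg :: L))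
        (consState .neg false (consState .neg false u)) (1 : Fin (L.length + 3)) =
        leftDot h t (consState .neg false (consState .neg false u)) (0 : Fin (L.length + 3)) -
          leftDot h t (consState .neg false (consState .neg false u)) (1 : Fin (L.length + 3)) := by
      refine (Finset.prod_eq_single (0 : Fin (L.length + 3)) ?_
        fun hh => absurd (Finset.mem_univ _) hh).trans ?_
      · change ∀ r : Fin (L.length + 3), _
        refine Fin.cases (fun _ hr => absurd rfl hr) (Fin.cases (fun _ _ => if_neg fun hh => hh.2 rfl)
          fun r _ _ => if_neg fun hh => ?_)
        have := (h1 r).symm.trans hh.1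
        simp at this
      · refine (if_pos ⟨rfl, ?_⟩).trans ?_
        · refine congrArg (fun i => leftDot h t (consState .neg false (consState .neg false u))
            (0 : Fin (L.length + 3)) - leftDot h t _ i) ?_
          exact (finRotate_apply (0 : Fin (L.length + 3))).trans (zero_add _)
        · exact (Fin.succ_ne_zero (0 : Fin (L.length + 2))).symm
    have hlab : ∀ a, φ (label h t ((closure (.neg :: L)).circle u (lowerLeft (.neg :: L) i)) a) =
        label h t ((closure (.neg :: .neg :: .neg :: L)).circle
          (consState .neg false (consState .neg false u)) (lowerLeft _ (raiseIndex i))) a := by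
      intro a
      have := hφ (lowerLeft (.neg :: L) i)
      rw [one_mul, one_mul] at this
      refine (map_label φ _ a).trans ?_
      rw [label_eq]
      refine congrArg (fun x => _ + _ * x) this
    have hval : ∀ a, algebraMap R _ σ * (
          leftDot h t (consState .neg false (consState .neg false u)) (0 : Fin (L.length + 3)) -
            leftDot h t (consState .neg false (consState .neg false u)) (1 : Fin (L.length + 3))) *
          (1 * φ (label h t ((closure (.neg :: L)).circle u (lowerLeft (.neg :: L) i)) a)) =
        algebraMap R _ σ * (label h t ((closure (.neg :: .neg :: .neg :: L)).circle
          (consState .neg false (consState .neg false u)) (lowerLeft _ (raiseIndex i))) a *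
          strandProd h t (lowerLeft (.neg :: .neg :: .neg :: L))
            (consState .neg false (consState .neg false u)) (1 : Fin (L.length + 3))) := by
      intro a
      rw [hP, one_mul, mul_assoc]
      refine congrArg _ ((congrArg _ (hlab a)).trans (mul_comm _ _))
    refine ⟨(1 : Fin (L.length + 3)), rfl, mem_map_iff_single hN hF (fun a => ?_) fun a => ?_⟩
    · obtain ⟨a', ha'⟩ := exists_label_mul_strandProd (h := h) (t := t) hD
        (s := consState .neg false (consState .neg false u)) (p := (1 : Fin (L.length + 3)))
        (raiseIndex i) (1 : Fin (L.length + 3)) a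
      refine ⟨σ • a', ?_⟩
      rw [hval, ha', ← Algebra.smul_def, map_smul]
      rfl
    · obtain ⟨a', ha'⟩ := exists_label_mul_strandProd (h := h) (t := t) hD
        (s := consState .neg false (consState .neg false u)) (p := (1 : Fin (L.length + 3)))
        (1 : Fin (L.length + 3)) (raiseIndex i) a
      refine ⟨σ • a', ?_⟩
      rw [hval, map_smul, smul_mul_assoc, ← ha', ← Algebra.smul_def, smul_smul, hσ, one_smul]
      rfl
  · obtain ⟨-, hee⟩ := hcase.resolve_left fun hh => by
      have := hp.symm.trans (hh.1 p)
      simp at this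
    have hval : ∀ a, algebraMap R _ σ * (
          leftDot h t (consState .neg false (consState .neg false u)) (0 : Fin (L.length + 3)) -
            leftDot h t (consState .neg false (consState .neg false u)) (1 : Fin (L.length + 3))) *
          (e * φ (strandClass h t (lowerLeft (.neg :: L)) u p a)) =
        strandClass h t (lowerLeft (.neg :: .neg :: .neg :: L))
          (consState .neg false (consState .neg false u)) (raiseIndex p) ((-σ) • a) := by
      intro a
      have h3 := mul_map_strandClass hφ he p a
      refine (congrArg _ h3).trans ?_
      rw [map_smul, strandClass_apply, strandProd_raiseIndex,
        if_pos (show headState (consState .neg false (consState .neg false u)) = false from rfl),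
        if_pos (show headState (tailState (consState .neg false (consState .neg false u))) = false
          from rfl), Algebra.smul_def, map_neg, hee]
      have hx : (leftDot h t (consState .neg false (consState .neg false u))
            (0 : Fin (L.length + 3)) - leftDot h t (consState .neg false (consState .neg false u))
            (1 : Fin (L.length + 3))) * (leftDot h t (consState .neg false (consState .neg false u))
            (0 : Fin (L.length + 3)) + leftDot h t (consState .neg false (consState .neg false u))
            (2 : Fin (L.length + 3)) - algebraMap R _ h) =
          -((leftDot h t (consState .neg false (consState .neg false u))
            (0 : Fin (L.length + 3)) - leftDot h t (consState .neg false (consState .neg false u))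
            (1 : Fin (L.length + 3))) * (leftDot h t (consState .neg false (consState .neg false u))
            (1 : Fin (L.length + 3)) - leftDot h t (consState .neg false (consState .neg false u))
            (2 : Fin (L.length + 3)))) := dot_sub_mul_split _ _ _
      have key : ∀ {A : Type _} [CommRing A] {c x y e l w : A}, x * e = -(x * y) →
          c * x * (e * (l * w)) = -c * (l * (x * (y * w))) := fun {A} _ {c x y e l w} hxy => by
        linear_combination (c * l * w) * hxy
      exact key hx
    refine ⟨raiseIndex p, hp, mem_map_iff_single hN hF (fun a => ⟨_, hval a⟩) fun a =>
      ⟨(-σ) • a, ?_⟩⟩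
    rw [hval, smul_smul, neg_mul_neg, hσ, one_smul]

/-- The only state of the crossingless unknot. -/
def unknotState : unknot.State := Fin.elim0

lemma mapR1Unknot_apply (v : Chain h t unknot) (s' : (torusLink 1).State) :
    mapR1Unknot h t v s' = if s' (0 : Fin 1) = true then
      carry h t unknot (torusLink 1) (fun _ => pt (l := [.neg]) 0 .L) unknotState s' (v unknotState)
      else 0 := by
  change (if s' (0 : Fin 1) = true then
    (carry h t unknot (torusLink 1) (fun _ => pt (l := [.neg]) 0 .L) unknotState s').toLinearMap ∘ₗ
      LinearMap.proj unknotState else 0 : Chain h t unknot →ₗ[R] _) v = _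
  split_ifs <;> rfl

lemma subsingleton_unknot_circle (s : unknot.State) : Subsingleton (unknot.Circle s) := by
  refine ⟨fun c d => ?_⟩
  obtain ⟨⟨⟩, rfl⟩ := Quotient.exists_rep c
  obtain ⟨⟨⟩, rfl⟩ := Quotient.exists_rep d
  rfl

/-- The unknot has one circle and hence chains `A`; its label is placed on the left circle and the
newborn right circle carries `1`. -/
lemma isLowRange_mapR1Unknot : IsLowRange [.neg] 0 (LinearMap.range (mapR1Unknot h t)) := by
  have hF : ∀ x, mapR1Unknot h t (Pi.single unknotState x) =
      Pi.single (M := fun s : (torusLink 1).State => TensorPow h t ((torusLink 1).Circle s))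
        (fun _ => true)
        (carry h t unknot (torusLink 1) (fun _ => pt (l := [.neg]) 0 .L) unknotState
          (fun _ => true) x) := by
    intro x
    funext s'
    rw [mapR1Unknot_apply]
    by_cases hs : s' = fun _ => true
    · subst hs
      rw [Pi.single_eq_same, if_pos rfl, Pi.single_eq_same]
    · rw [Pi.single_eq_of_ne hs, if_neg fun hh => hs ?_]
      funext i
      revert i
      change ∀ i : Fin 1, _
      intro i
      rw [Subsingleton.elim i 0]
      exact hh
  have hlab : ∀ a, carry h t unknot (torusLink 1) (fun _ => pt (l := [.neg]) 0 .L) unknotState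
      (fun _ => true) (label h t (unknot.circle unknotState ()) a) =
      label h t ((torusLink 1).circle (fun _ => true) (pt (l := [.neg]) 0 .L)) a :=
    carry_label (fun _ _ _ => rfl) _
  refine ⟨fun _ => true, ?_, Or.inl ⟨fun _ => rfl, (0 : Fin 1), ?_⟩⟩
  · rw [Finset.card_eq_zero, Finset.filter_eq_empty_iff]
    simp
  · have hR : ∀ v : Chain h t (torusLink 1), v ∈ LinearMap.range (mapR1Unknot h t) ↔
        ∃ a, v = Pi.single (fun _ => true)
          (label h t ((torusLink 1).circle (fun _ => true) (pt (l := [.neg]) 0 .L)) a) := ?_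
    · exact hR
    rw [LinearMap.range_eq_map]
    refine mem_map_iff_single (D' := torusLink 1) (u := unknotState)
      (κ := label h t (unknot.circle unknotState ())) (fun v => ⟨fun _ => ?_, fun _ => trivial⟩) hF
      (fun a => ⟨a, hlab a⟩) (fun a => ⟨a, hlab a⟩)
    have := subsingleton_unknot_circle unknotState
    obtain ⟨a, ha⟩ := exists_eq_label (unknot.circle unknotState ()) (v unknotState)
    refine ⟨a, ?_⟩
    funext s
    have hs : s = unknotState := Subsingleton.elim (α := Fin 0 → Bool) _ _
    subst hs
    rw [ha, Pi.single_eq_same]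

/-- The image of the map of the immersed cobordism. -/
theorem isLowRange_mapLow (k : ℕ) (S : Fin k → Step) :
    IsLowRange (List.replicate (2 * k + 1) .neg)
      (2 * (Finset.univ.filter fun i => (S i).isImmersed = true).card)
      (LinearMap.range (mapLow h t k S)) := by
  induction k with
  | zero => exact isLowRange_mapR1Unknot
  | succ k ih =>
    have hL : ∀ i : Fin (List.replicate (2 * k) Slot.neg).length,
      (List.replicate (2 * k) Slot.neg).get i = .neg := by simp
    have h1 := ih fun i => S i.castSucc
    have hcard : (Finset.univ.filter fun i => (S i).isImmersed = true).card =
        (Finset.univ.filter fun i : Fin k => (S i.castSucc).isImmersed = true).card +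
          if (S (Fin.last k)).isImmersed = true then 1 else 0 := by
      rw [Finset.card_filter, Finset.card_filter, Fin.sum_univ_castSucc]
    rw [hcard]
    have h3 := congrArg (fun N : Submodule R (Chain h t (torusLink (2 * k + 3))) =>
      IsLowRange (List.replicate (2 * k + 3) .neg)
        (2 * ((Finset.univ.filter fun i : Fin k => (S i.castSucc).isImmersed = true).card +
          if (S (Fin.last k)).isImmersed = true then 1 else 0)) N)
      (LinearMap.range_comp (mapLow h t k fun i => S i.castSucc)
          (mapStep h t (S (Fin.last k)) (2 * k)))
    refine Eq.mpr h3 ?_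
    cases hS : S (Fin.last k) with
    | embedded =>
      have h2 := IsLowRange.map_embedded (L := List.replicate (2 * k) .neg) h1
      exact h2
    | immersed up =>
      have h2 := IsLowRange.map_immersed hL up h1
      exact h2

end Ranges

/-! ### Homology in degrees with horizontal crossings. -/

section Single

variable {R : Type*} [CommRing R] {h t : R} {D : Diagram} {pL pR : Fin D.n → D.Pt}

lemma differential_single_apply {s s' : D.State} {q : Fin D.n} (hq : s q = false)
    (hs' : s' = Function.update s q true) (x : TensorPow h t (D.Circle s)) :
    differential h t D (Pi.single s x) s' = edgeSign D s' q • edgeMap h t q s s' x := by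
  have hs : Function.update s' q false = s := by
    rw [hs', Function.update_idem, ← hq, Function.update_eq_self]
  rw [differential_apply, Finset.sum_eq_single q]
  · rw [if_pos (by rw [hs', Function.update_self]), hs, Pi.single_eq_same]
  · intro i _ hiq
    split_ifs with hi
    · rw [Pi.single_eq_of_ne, map_zero, smul_zero]
      intro hh
      have h1 := congrFun hh q
      rw [Function.update_of_ne hiq.symm, hs', Function.update_self, hq] at h1
      simp at h1
    · rfl
  · exact fun hh => absurd (Finset.mem_univ _) hh

lemma differential_single_apply_of_ne {s s' : D.State}
    (hs' : ∀ q, s q = false → s' ≠ Function.update s q true) (x : TensorPow h t (D.Circle s)) :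
    differential h t D (Pi.single s x) s' = 0 := by
  rw [differential_apply]
  refine Finset.sum_eq_zero fun i _ => ?_
  split_ifs with hi
  · rw [Pi.single_eq_of_ne, map_zero, smul_zero]
    intro hh
    refine hs' i (by rw [← hh, Function.update_self]) ?_
    rw [← hh, Function.update_idem, ← hi, Function.update_eq_self]
  · rfl

lemma edgeSign_smul_self {M : Type*} [AddCommGroup M] (s : D.State) (i : Fin D.n) (x : M) :
    edgeSign D s i • edgeSign D s i • x = x := by
  rw [smul_smul, edgeSign_eq, countSign_mul_self, one_smul]

lemma edgeSign_smul_eq_zero {M : Type*} [AddCommGroup M] {s : D.State} {i : Fin D.n} {x : M}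
    (hx : edgeSign D s i • x = 0) : x = 0 := by
  rw [← edgeSign_smul_self s i x, hx, smul_zero]

lemma eq_of_ones_subset {s s₁ : D.State} (hs : ∀ i, s₁ i = true → s i = true)
    (hc : onesCard s = onesCard s₁) : s = s₁ := by
  have : (Finset.univ.filter fun i => s₁ i = true) = Finset.univ.filter fun i => s i = true :=
    Finset.eq_of_subset_of_card_le (fun i hi => by simpa using hs i (by simpa using hi)) hc.le
  funext i
  have h1 := Finset.ext_iff.1 this i
  simp only [Finset.mem_filter, Finset.mem_univ, true_and] at h1
  exact Bool.eq_iff_iff.2 h1.symm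

variable (hD : D.IsNegTwoBraid pL pR) {s : D.State} {p : Fin D.n}

include hD

/-- A chain of degree `onesCard s` can be moved to the vertex `s`. -/
lemma exists_sub_differential_eq_single {V : Finset (Fin D.n)} (hV : ∀ i, i ∈ V ↔ s i = true)
    {v : Chain h t D} (hv : ∀ s', v s' ≠ 0 → onesCard s' = onesCard s)
    (hd : ∀ s', (∃ p ∈ V, s' p = false) → differential h t D v s' = 0) :
    ∃ u x, v = Pi.single s x + differential h t D u := by
  have hVs : V = Finset.univ.filter fun i => s i = true := by
    ext i
    simp [hV]
  -- The prescribed vertical crossings exhaust the degree, so `s` is the only vertex left.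
  obtain ⟨u, hu⟩ := exists_sub_differential hD (V := V) (o := onesCard s)
    (by rw [hVs, onesCard]) hv hd
  refine ⟨u, (v - differential h t D u) s, ?_⟩
  rw [← sub_eq_iff_eq_add]
  funext s'
  by_cases hs : s' = s
  · subst hs
    rw [Pi.single_eq_same]
  · rw [Pi.single_eq_of_ne hs]
    by_contra hne
    obtain ⟨h1, h2⟩ := hu s' hne
    exact hs (eq_of_ones_subset (fun i hi => h1 i ((hV i).2 hi)) h2)

/-- A cycle at one vertex is killed by the merges at the crossings other than `p`. -/
lemma merge_eq_zero_of_differential {x : TensorPow h t (D.Circle s)} {q : Fin D.n}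
    (hp : s p = false) (hq : s q = false) (hqp : q ≠ p)
    (hd : differential h t D (Pi.single s x) (Function.update s q true) = 0) :
    merge h t D s (Function.update s q true) x = 0 := by
  rw [differential_single_apply hq rfl] at hd
  have h1 := edgeSign_smul_eq_zero hd
  rwa [edgeMap_eq_merge hD (by rw [Function.update_idem, ← hq, Function.update_eq_self])
    (Function.update_self _ _ _) ⟨p, by rw [Function.update_of_ne hqp.symm, hp]⟩] at h1

lemma differential_single_strandClass (hp : s p = false)
    (he : Even (Finset.univ.filter fun r => s r = false).card) (a : FrobAlg R h t) :
    differential h t D (Pi.single s (strandClass h t pL s p a)) = 0 := by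
  -- A second horizontal crossing guarantees that every outgoing edge is a merge rather than a
  -- split.
  obtain ⟨r, hr, hrp⟩ : ∃ r, s r = false ∧ r ≠ p := by
    by_contra hne
    push Not at hne
    have hodd := card_zeros_ne hp
    rw [Finset.filter_eq_empty_iff.2 fun r _ hr => hr.2 (hne r hr.1)] at hodd
    rw [← hodd] at he
    simp at he
  funext s'
  by_cases hs : ∃ q, s q = false ∧ s' = Function.update s q true
  · obtain ⟨q, hq, hs'⟩ := hs
    have h0 : ∃ r, s' r = false := by
      by_cases hqp : q = p
      · exact ⟨r, by rw [hs', hqp, Function.update_of_ne hrp, hr]⟩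
      · exact ⟨p, by rw [hs', Function.update_of_ne (Ne.symm hqp), hp]⟩
    rw [differential_single_apply hq hs', edgeMap_eq_merge hD
      (by rw [hs', Function.update_idem, ← hq, Function.update_eq_self])
      (by rw [hs', Function.update_self]) h0]
    subst hs'
    rw [merge_strandClass hD hp he hq, smul_zero]
    rfl
  · exact differential_single_apply_of_ne (fun q hq hs' => hs ⟨q, hq, hs'⟩) _

/-- The homology classes at a vertex with an even number of horizontal resolutions. -/
lemma exists_eq_single_strandClass_add (hp : s p = false) {v : Chain h t D}
    (hv : ∀ s', v s' ≠ 0 → onesCard s' = onesCard s) (hd : differential h t D v = 0) :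
    ∃ a u, v = Pi.single s (strandClass h t pL s p a) + differential h t D u := by
  obtain ⟨u, x, hx⟩ := exists_sub_differential_eq_single hD (s := s)
    (V := Finset.univ.filter fun i => s i = true) (by simp) hv (fun s' _ => by rw [hd]; rfl)
  have hdx : differential h t D (Pi.single s x) = 0 := by
    have := congrArg (differential h t D) hx
    rwa [hd, map_add, differential_comp_self hD, add_zero, eq_comm] at this
  obtain ⟨a, rfl⟩ := exists_eq_strandClass hD hp x fun q hqp hq =>
    merge_eq_zero_of_differential hD hp hq hqp (by rw [hdx]; rfl)
  exact ⟨a, u, hx⟩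

/-- With base point `q`, every merge other than the one at `q` vanishes because its difference
factor occurs in the product. -/
lemma differential_single_update {q : Fin D.n} (hp : s p = false) (hq : s q = true)
    (b : FrobAlg R h t) : differential h t D (Pi.single (Function.update s q false)
      (strandClass h t pL (Function.update s q false) q b)) =
    Pi.single s (edgeSign D s q • merge h t D (Function.update s q false) s
      (strandClass h t pL (Function.update s q false) q b)) := by
  have hqp : q ≠ p := fun e => by rw [e, hp] at hq; simp at hq
  have hsq : Function.update s q false q = false := Function.update_self _ _ _
  have hs : s = Function.update (Function.update s q false) q true := by
    rw [Function.update_idem, ← hq, Function.update_eq_self]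
  funext s'
  by_cases hss : s' = s
  · subst hss
    rw [Pi.single_eq_same, differential_single_apply hsq hs,
      edgeMap_eq_merge hD rfl hq ⟨p, hp⟩]
  · rw [Pi.single_eq_of_ne hss]
    by_cases hex : ∃ i, Function.update s q false i = false ∧
      s' = Function.update (Function.update s q false) i true
    · obtain ⟨i, hi, rfl⟩ := hex
      have hiq : i ≠ q := fun e => hss (by rw [e, ← hs])
      rw [differential_single_apply hi rfl, edgeMap_eq_merge hD
        (by rw [Function.update_idem]; exact (Function.update_eq_self_iff.2 hi.symm).symm)
        (Function.update_self _ _ _) ⟨q, by rw [Function.update_of_ne hiq.symm, hsq]⟩,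
        merge_strandClass_of_ne hD hsq hi hiq, smul_zero]
    · exact differential_single_apply_of_ne (fun i hi hs' => hex ⟨i, hi, hs'⟩) _

/-- The boundaries among the cycles at a vertex with an even number of horizontal resolutions. -/
lemma single_strandClass_mem_range_iff (hp : s p = false)
    (he : Even (Finset.univ.filter fun r => s r = false).card) (h1 : ∃ q, s q = true)
    (a : FrobAlg R h t) :
    (∃ w, differential h t D w = Pi.single s (strandClass h t pL s p a)) ↔
      a ∈ LinearMap.range (mapU h t) := by
  obtain ⟨q, hq⟩ := h1
  have hqp : q ≠ p := fun e => by rw [e, hp] at hq; simp at hq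
  obtain ⟨hU1, hU2⟩ := exists_merge_strandClass_update (h := h) (t := t) hD hp he hq rfl
  constructor
  · rintro ⟨w, hw⟩
    -- Only the component of `w` one degree below `s` contributes to its boundary at degree `s`.
    let w' : Chain h t D := fun s' => if onesCard s' + 1 = onesCard s then w s' else 0
    have hw' : differential h t D w' = Pi.single s (strandClass h t pL s p a) := by
      funext s'
      by_cases hs' : onesCard s' = onesCard s
      · rw [← hw, differential_apply, differential_apply]
        refine Finset.sum_congr rfl fun i _ => ?_
        split_ifs with hi
        · simp only [w']
          rw [if_pos (by rw [onesCard_update_false s' hi, hs'])]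
        · rfl
      · rw [Pi.single_eq_of_ne (fun e => hs' (by rw [e])), differential_apply]
        refine Finset.sum_eq_zero fun i _ => ?_
        split_ifs with hi
        · simp only [w']
          rw [if_neg (by rwa [onesCard_update_false s' hi]), map_zero, smul_zero]
        · rfl
    have hoc : onesCard (Function.update s q false) + 1 = onesCard s := onesCard_update_false s hq
    -- The boundary of `w'` is concentrated at `s`, where all vertical crossings of the neighbouring
    -- vertex are vertical too. Hence `w'` can be moved to that vertex although it is not a cycle.
    obtain ⟨u, x, hx⟩ := exists_sub_differential_eq_single hD (s := Function.update s q false)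
      (V := Finset.univ.filter fun i => Function.update s q false i = true) (by simp)
      (v := w') (fun s' hs' => by
        have : onesCard s' + 1 = onesCard s := by
          by_contra hne
          exact hs' (if_neg hne)
        omega)
      (fun s' hs' => by
        obtain ⟨i, hi, hi'⟩ := hs'
        rw [hw', Pi.single_eq_of_ne]
        rintro rfl
        have hi2 : Function.update s' q false i = true := by simpa using hi
        by_cases hiq : i = q
        · rw [hiq, Function.update_self] at hi2
          simp at hi2
        · rw [Function.update_of_ne hiq, hi'] at hi2
          simp at hi2)
    have hdx : differential h t D (Pi.single (Function.update s q false) x) =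
        Pi.single s (strandClass h t pL s p a) := by
      rw [← hw', hx, map_add, differential_comp_self hD, add_zero]
    have hsq : Function.update s q false q = false := Function.update_self _ _ _
    -- Its boundary has no component away from `s`, so the merges at crossings other than `q`
    -- vanish; the remaining merge, at `q`, is `U`.
    obtain ⟨b, rfl⟩ := exists_eq_strandClass hD hsq x fun i hiq hi =>
      merge_eq_zero_of_differential hD hsq hi hiq (by
        rw [hdx, Pi.single_eq_of_ne]
        intro e
        have := congrFun e q
        rw [Function.update_of_ne hiq.symm, hsq, hq] at this
        simp at this)
    rw [differential_single_update hD hp hq] at hdx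
    obtain ⟨a', ha'⟩ := hU1 b
    have h2 := Pi.single_injective s hdx
    rw [ha', ← map_zsmul] at h2
    refine ⟨edgeSign D s q • a', ?_⟩
    rw [map_zsmul]
    exact strandClass_injective hD hp h2
  · rintro ⟨a', rfl⟩
    obtain ⟨b, hb⟩ := hU2 a'
    refine ⟨edgeSign D s q • Pi.single (Function.update s q false)
      (strandClass h t pL (Function.update s q false) q b), ?_⟩
    rw [map_zsmul, differential_single_update hD hp hq, hb, ← Pi.single_zsmul,
      edgeSign_smul_self]

end Single

/-! ### Homology in degree zero, at the all-vertical resolution. -/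

section AllOnes

variable {R : Type*} [CommRing R] {h t : R} {D : Diagram} {pL pR : Fin D.n → D.Pt}
  (hD : D.IsNegTwoBraid pL pR) {s : D.State} (hs : ∀ i, s i = true) (i : Fin D.n)

include hs

lemma differential_single_of_ones (x : TensorPow h t (D.Circle s)) :
    differential h t D (Pi.single s x) = 0 := by
  funext s'
  exact differential_single_apply_of_ne (fun q hq => by simp [hs q] at hq) x

include hD

/-- The factor identifies left and right dots, so on its own multiples it acts as `2x_L - h`. -/
lemma splitFactor_mul_self : splitFactor h t pL pR s i * splitFactor h t pL pR s i =
    splitFactor h t pL pR s i *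
      label h t (D.circle s (pL i)) (2 * genX h t - algebraMap R _ h) := by
  have h1 : splitFactor h t pL pR s i * strandDot h t pR s i =
      splitFactor h t pL pR s i * strandDot h t pL s i := splitFactor_mul_dot hD hs i i (pR i)
  have h2 : label h t (D.circle s (pL i)) (2 * genX h t - algebraMap R _ h) =
      2 * strandDot h t pL s i - algebraMap R _ h := by
    rw [map_sub, map_mul, map_ofNat, AlgHom.commutes]; rfl
  have h3 : splitFactor h t pL pR s i = strandDot h t pL s i + strandDot h t pR s i -
    algebraMap R _ h := rfl
  rw [h2]
  linear_combination (splitFactor h t pL pR s i) * h3 + h1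

/-- For the vertical resolution, `A^{⊗2}` is the sum of the labels of the left circle and the image
of the split maps. -/
lemma exists_eq_label_add_splitFactor_mul (x : TensorPow h t (D.Circle s)) :
    ∃ a b, x = label h t (D.circle s (pL i)) a +
      splitFactor h t pL pR s i * label h t (D.circle s (pL i)) b := by
  induction x using TensorPow.induction with
  | halg r => exact ⟨algebraMap R _ r, 0, by rw [map_zero, mul_zero, add_zero, AlgHom.commutes]⟩
  | hdot c =>
    obtain ⟨p, rfl⟩ := Quotient.exists_rep c
    obtain ⟨j, hj | hj⟩ := hD.exists_L_or_R s p
    · refine ⟨genX h t, 0, ?_⟩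
      rw [map_zero, mul_zero, add_zero]
      exact (congrArg (dot h t) hj).trans (strandDot_eq_of_ones hD hs j i).1
    · refine ⟨algebraMap R _ h - genX h t, 1, ?_⟩
      have h1 : dot h t (D.circle s p) = strandDot h t pR s i :=
        (congrArg (dot h t) hj).trans (strandDot_eq_of_ones hD hs j i).2
      refine h1.trans ?_
      rw [map_one, mul_one, map_sub, AlgHom.commutes, splitFactor]
      change _ = _ - strandDot h t pL s i + _
      ring
  | hadd v w hv hw =>
    obtain ⟨⟨a, b, rfl⟩, a', b', rfl⟩ := And.intro hv hw
    exact ⟨a + a', b + b', by rw [map_add, map_add]; ring⟩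
  | hmul v w hv hw =>
    obtain ⟨⟨a, b, rfl⟩, a', b', rfl⟩ := And.intro hv hw
    refine ⟨a * a', a * b' + a' * b + (2 * genX h t - algebraMap R _ h) * (b * b'), ?_⟩
    have h1 := splitFactor_mul_self (h := h) (t := t) hD hs i
    simp only [map_add, map_mul] at h1 ⊢
    linear_combination (label h t (D.circle s (pL i)) b * label h t (D.circle s (pL i)) b') * h1

/-- Everything on the right circle can be pushed to the left one, so the ideal of the factor is a
cyclic module over the left labels. -/
lemma exists_splitFactor_mul (x : TensorPow h t (D.Circle s)) :
    ∃ b, splitFactor h t pL pR s i * x =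
      splitFactor h t pL pR s i * label h t (D.circle s (pL i)) b := by
  obtain ⟨a, b, rfl⟩ := exists_eq_label_add_splitFactor_mul hD hs i x
  refine ⟨a + (2 * genX h t - algebraMap R _ h) * b, ?_⟩
  have h1 := splitFactor_mul_self (h := h) (t := t) hD hs i
  rw [map_add, map_mul]
  linear_combination (label h t (D.circle s (pL i)) b) * h1

lemma exists_differential_eq_splitFactor_mul (b : FrobAlg R h t) :
    ∃ u, differential h t D u =
      Pi.single s (splitFactor h t pL pR s i * label h t (D.circle s (pL i)) b) := by
  have hup : Function.update s i false i = false := Function.update_self _ _ _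
  have hss : s = Function.update (Function.update s i false) i true := by
    rw [Function.update_idem]; exact (Function.update_eq_self_iff.2 (hs i).symm).symm
  refine ⟨edgeSign D s i • Pi.single (Function.update s i false)
    (label h t (D.circle _ (pL i)) b), ?_⟩
  rw [map_zsmul]
  funext s'
  by_cases hs' : s' = s
  · subst hs'
    rw [Pi.smul_apply, differential_single_apply hup hss, Pi.single_eq_same, edgeSign_smul_self,
      edgeMap_eq_split hD rfl hs i, map_label, label_eq, mul_add, mul_add]
    congr 1
    rw [mul_left_comm, splitFactor_mul_carry hD hs i i, mul_left_comm]
    rfl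
  · rw [Pi.smul_apply, Pi.single_eq_of_ne hs', differential_single_apply_of_ne, smul_zero]
    intro q hq e
    by_cases hqi : q = i
    · exact hs' (by rw [e, hqi, ← hss])
    · rw [Function.update_of_ne hqi, hs q] at hq
      simp at hq

/-- The all-vertical vertex is alone in its degree, so the complement of the left labels in `A ⊗ A`
has only to be recognised as boundaries. -/
lemma exists_eq_single_label_add {v : Chain h t D}
    (hv : ∀ s', v s' ≠ 0 → onesCard s' = onesCard s) :
    ∃ a u, v = Pi.single s (label h t (D.circle s (pL i)) a) + differential h t D u := by
  have hv1 : v = Pi.single s (v s) := by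
    funext s'
    by_cases hs' : s' = s
    · rw [hs', Pi.single_eq_same]
    · rw [Pi.single_eq_of_ne hs']
      by_contra hne
      exact hs' (eq_of_ones_subset (fun j _ => hs j) (hv s' hne).symm).symm
  obtain ⟨a, b, hab⟩ := exists_eq_label_add_splitFactor_mul hD hs i (v s)
  obtain ⟨u, hu⟩ := exists_differential_eq_splitFactor_mul (h := h) (t := t) hD hs i b
  exact ⟨a, u, by rw [hv1, hab, hu, Pi.single_add]⟩

lemma single_label_mem_range_iff (a : FrobAlg R h t) :
    (∃ w, differential h t D w = Pi.single s (label h t (D.circle s (pL i)) a)) ↔ a = 0 := by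
  classical
  constructor
  · rintro ⟨w, hw⟩
    obtain ⟨b, hb⟩ : ∃ b, differential h t D w s =
        splitFactor h t pL pR s i * label h t (D.circle s (pL i)) b := by
      rw [differential_apply]
      obtain ⟨b, hb⟩ := exists_splitFactor_mul hD hs i (∑ j, edgeSign D s j •
        carry h t D D id (Function.update s j false) s (w (Function.update s j false)))
      refine ⟨b, ?_⟩
      rw [← hb, Finset.mul_sum]
      refine Finset.sum_congr rfl fun j _ => ?_
      rw [if_pos (hs j), edgeMap_eq_split hD rfl hs i, mul_smul_comm]
    rw [hw, Pi.single_eq_same] at hb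
    -- View `A ⊗ A` as a quadratic extension of the left copy of `A`, generated by the right dot. In
    -- `a = (x_L + x_R - h) b` the coefficient of `x_R` forces `b = 0`, and then `a = 0`.
    let y : D.Circle s → QuadExt h t (FrobAlg R h t) :=
      fun c => if c = D.circle s (pL i) then ⟨genX h t, 0⟩ else ⟨0, 1⟩
    have hy : ∀ c, y c * y c = algebraMap R _ t + algebraMap R _ h * y c := by
      intro c
      have hx := genX_mul_genX (h := h) (t := t)
      simp only [y]
      split_ifs
      · ext <;> simp [IsScalarTower.algebraMap_apply R (FrobAlg R h t)
          (QuadExt h t (FrobAlg R h t)), hx]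
      · ext <;> simp [IsScalarTower.algebraMap_apply R (FrobAlg R h t)
          (QuadExt h t (FrobAlg R h t))]
    have hL : ∀ a, liftDots y hy (label h t (D.circle s (pL i)) a) = algebraMap _ _ a := by
      intro a
      have : (liftDots y hy).comp (label h t (D.circle s (pL i))) =
          IsScalarTower.toAlgHom R (FrobAlg R h t) (QuadExt h t (FrobAlg R h t)) := by
        refine FrobAlg.algHom_ext ?_
        rw [AlgHom.comp_apply, ← dot, liftDots_dot]
        simp [y]
        rfl
      exact DFunLike.congr_fun this a
    have hR : liftDots y hy (strandDot h t pR s i) = ⟨0, 1⟩ := by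
      rw [strandDot, liftDots_dot]
      exact if_neg (hD.L_ne_R s hs i i).symm
    have := congrArg (liftDots y hy) hb
    rw [map_mul, hL, hL, splitFactor, map_sub, map_add, hR, AlgHom.commutes, strandDot, dot, hL]
      at this
    have him := congrArg QuadraticAlgebra.im this
    have hre := congrArg QuadraticAlgebra.re this
    simp [IsScalarTower.algebraMap_apply R (FrobAlg R h t)
          (QuadExt h t (FrobAlg R h t))] at him hre
    rw [hre, ← him]
    simp
  · rintro rfl
    exact ⟨0, by rw [map_zero, map_zero, Pi.single_zero]⟩

end AllOnes

/-! ### Linear families of cycles and their classes. -/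

section Homology

variable {R : Type*} [CommRing R] {h t : R} {D D' : Diagram} {M : Type*} [AddCommGroup M]
  [Module R M]

/-- The classes of a linear family of cycles. -/
noncomputable def classMap (f : M →ₗ[R] Chain h t D) (hf : ∀ a, differential h t D (f a) = 0) :
    M →ₗ[R] Kh h t D :=
  (boundaries h t D).mkQ ∘ₗ f.codRestrict (cycles h t D) hf

lemma ker_classMap (f : M →ₗ[R] Chain h t D) (hf : ∀ a, differential h t D (f a) = 0)
    {K : Submodule R M} (hK : ∀ a, (∃ w, differential h t D w = f a) ↔ a ∈ K) :
    LinearMap.ker (classMap f hf) = K := by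
  ext a
  rw [← hK, LinearMap.mem_ker, classMap, LinearMap.comp_apply, Submodule.mkQ_apply,
    Submodule.Quotient.mk_eq_zero]
  rfl

lemma range_classMap (f : M →ₗ[R] Chain h t D) (hf : ∀ a, differential h t D (f a) = 0) {r : ℤ}
    (hr : ∀ a, f a ∈ chainGr h t D r)
    (hgen : ∀ v ∈ chainGr h t D r, differential h t D v = 0 →
      ∃ a u, v = f a + differential h t D u) :
    LinearMap.range (classMap f hf) = KhGr h t D r := by
  ext y
  constructor
  · rintro ⟨a, rfl⟩
    exact ⟨⟨f a, hf a⟩, hr a, rfl⟩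
  · rintro ⟨⟨v, hv⟩, hvr, rfl⟩
    obtain ⟨a, u, rfl⟩ := hgen v hvr hv
    refine ⟨a, ((Submodule.Quotient.eq (boundaries h t D)).2 ⟨-u, ?_⟩)⟩
    rw [map_neg]
    change _ = f a - (f a + _)
    abel

/-- As every chain of the source is a cycle, the image on homology is read off from the image on
chains. -/
lemma range_KhMap {φ : Chain h t D' →ₗ[R] Chain h t D} (hφ : IsChainMap h t φ)
    (hD' : ∀ v, differential h t D' v = 0) (f : M →ₗ[R] Chain h t D)
    (hf : ∀ a, differential h t D (f a) = 0)
    (hφf : ∀ v, v ∈ LinearMap.range φ ↔ ∃ a, v = f a) :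
    LinearMap.range (KhMap h t φ hφ) = LinearMap.range (classMap f hf) := by
  ext y
  constructor
  · rintro ⟨x, rfl⟩
    obtain ⟨⟨v, hv⟩, rfl⟩ := Submodule.mkQ_surjective _ x
    obtain ⟨a, ha⟩ := (hφf (φ v)).1 ⟨v, rfl⟩
    exact ⟨a, congrArg (boundaries h t D).mkQ (Subtype.ext ha.symm)⟩
  · rintro ⟨a, rfl⟩
    obtain ⟨v, hv⟩ := (hφf (f a)).2 ⟨a, rfl⟩
    exact ⟨(boundaries h t D').mkQ ⟨v, hD' v⟩,
      congrArg (boundaries h t D).mkQ (Subtype.ext hv)⟩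

end Homology

/-! ### The crossingless unknot. -/

section Unknot

variable {R : Type*} [CommRing R] {h t : R}

lemma differential_unknot (v : Chain h t unknot) : differential h t unknot v = 0 := by
  funext s
  rw [differential_apply]
  exact Finset.sum_of_isEmpty (ι := Fin 0) _

/-- The homology of the unknot. -/
theorem nonempty_Kh_unknot_equiv : Nonempty (Kh h t unknot ≃ₗ[R] FrobAlg R h t) := by
  let f : FrobAlg R h t →ₗ[R] Chain h t unknot :=
    LinearMap.single R (fun s => TensorPow h t (unknot.Circle s)) unknotState ∘ₗ
      (label h t (unknot.circle unknotState ())).toLinearMap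
  have hf : ∀ a, differential h t unknot (f a) = 0 := fun a => differential_unknot _
  have hfa : ∀ a, f a unknotState = label h t (unknot.circle unknotState ()) a :=
    fun a => Pi.single_eq_same (M := fun s => TensorPow h t (unknot.Circle s)) unknotState _
  refine ⟨(LinearEquiv.ofBijective (classMap f hf) ⟨?_, ?_⟩).symm⟩
  · rw [← LinearMap.ker_eq_bot]
    refine ker_classMap f hf fun a => ?_
    simp only [differential_unknot, Submodule.mem_bot]
    constructor
    · rintro ⟨-, hw⟩
      have h1 := congrFun hw unknotState
      refine label_injective (unknot.circle unknotState ()) ?_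
      rw [map_zero]
      exact ((hfa a).symm.trans h1.symm)
    · rintro rfl
      exact ⟨0, (map_zero f).symm⟩
  · intro y
    obtain ⟨⟨v, hv⟩, rfl⟩ := Submodule.mkQ_surjective _ y
    have := subsingleton_unknot_circle unknotState
    obtain ⟨a, ha⟩ := exists_eq_label (unknot.circle unknotState ()) (v unknotState)
    refine ⟨a, congrArg (boundaries h t unknot).mkQ (Subtype.ext ?_)⟩
    funext s
    have hs : s = unknotState := Subsingleton.elim (α := Fin 0 → Bool) _ _
    subst hs
    exact (hfa a).trans ha.symm

end Unknot

/-! ### Assembly for the torus links. -/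

section Torus

variable {R : Type*} [CommRing R] {h t : R}

lemma onesCard_add_zeros {D : Diagram} (s : D.State) :
    onesCard s + (Finset.univ.filter fun i => s i = false).card = D.n := by
  have := Finset.card_filter_add_card_filter_not (s := (Finset.univ : Finset (Fin D.n)))
    (fun i => s i = true)
  simp only [Bool.not_eq_true, Finset.card_univ, Fintype.card_fin] at this
  exact this

lemma degree_eq {D : Diagram} (hD : ∀ i, (D.crossing i).positive = false) (s : D.State) :
    D.degree s = -((Finset.univ.filter fun i => s i = false).card : ℤ) := by
  rw [Diagram.degree, Finset.filter_true_of_mem fun i _ => hD i]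
  have := onesCard_add_zeros s
  rw [onesCard] at this
  simp only [Finset.card_univ, Fintype.card_fin]
  omega

lemma mem_chainGr_iff {D : Diagram} (hD : ∀ i, (D.crossing i).positive = false) (s : D.State)
    (v : Chain h t D) :
    v ∈ chainGr h t D (-((Finset.univ.filter fun i => s i = false).card : ℤ)) ↔
      ∀ s', v s' ≠ 0 → onesCard s' = onesCard s := by
  refine forall_congr' fun s' => ?_
  rw [degree_eq hD, not_imp_comm, ne_eq]
  have h1 := onesCard_add_zeros s
  have h2 := onesCard_add_zeros s'
  refine imp_congr Iff.rfl ?_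
  omega

lemma single_mem_chainGr {D : Diagram} (hD : ∀ i, (D.crossing i).positive = false) (s : D.State)
    (x : TensorPow h t (D.Circle s)) :
    Pi.single s x ∈ chainGr h t D (-((Finset.univ.filter fun i => s i = false).card : ℤ)) := by
  rw [mem_chainGr_iff hD]
  intro s' hs'
  by_contra hne
  exact hs' (Pi.single_eq_of_ne (fun e => hne (by rw [e])) _)

/-- The image of the map of an immersed cobordism consists of cycles, and they generate the
homology of its degree. -/
lemma IsLowRange.exists_generator {l : List Slot} (hl : ∀ i : Fin l.length, l.get i = .neg)
    (ho : Odd l.length) {m : ℕ} {N : Submodule R (Chain h t (closure l))}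
    (hN : IsLowRange l (2 * m) N) :
    ∃ f : FrobAlg R h t →ₗ[R] Chain h t (closure l),
      (∀ v, v ∈ N ↔ ∃ a, v = f a) ∧ (∀ a, differential h t (closure l) (f a) = 0) ∧
      (∀ a, f a ∈ chainGr h t (closure l) (-2 * (m : ℤ))) ∧
      (∀ v ∈ chainGr h t (closure l) (-2 * (m : ℤ)), differential h t (closure l) v = 0 →
        ∃ a u, v = f a + differential h t (closure l) u) ∧
      (0 < m → ∀ a, (∃ w, differential h t (closure l) w = f a) ↔
        a ∈ LinearMap.range (mapU h t)) ∧
      (m = 0 → ∀ a, (∃ w, differential h t (closure l) w = f a) ↔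
        a ∈ (⊥ : Submodule R (FrobAlg R h t))) := by
  have hD := closure_isNegTwoBraid hl
  obtain ⟨s, hs, hN⟩ := hN
  have hdeg : -2 * (m : ℤ) = -((Finset.univ.filter fun i => s i = false).card : ℤ) := by
    rw [hs]; push_cast; ring
  have he : Even (Finset.univ.filter fun i => s i = false).card := hs ▸ even_two_mul m
  rw [hdeg]
  rcases hN with ⟨h1, i, hN⟩ | ⟨p, hp, hN⟩
  · have hm : m = 0 := by
      rw [Finset.filter_eq_empty_iff.2 fun i _ => by simp [h1 i], Finset.card_empty] at hs
      omega
    refine ⟨LinearMap.single R (fun s => TensorPow h t ((closure l).Circle s)) s ∘ₗ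
      (label h t ((closure l).circle s (lowerLeft l i))).toLinearMap, hN,
      fun a => differential_single_of_ones h1 _,
      fun a => single_mem_chainGr hD.positive_eq _ _, fun v hv _ =>
        exists_eq_single_label_add hD h1 i ((mem_chainGr_iff hD.positive_eq s v).1 hv),
      fun h0 => absurd hm h0.ne', fun _ a => single_label_mem_range_iff hD h1 i a⟩
  · have hm : m ≠ 0 := by
      rintro rfl
      rw [mul_zero, Finset.card_eq_zero, Finset.filter_eq_empty_iff] at hs
      exact hs (Finset.mem_univ p) hp
    -- An even number of horizontal crossings cannot exhaust an odd number of crossings. Without a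
    -- vertical crossing no boundary would arrive at `s`, and `U` would not enter.
    have h1 : ∃ q, s q = true := by
      by_contra hne
      have hz := onesCard_add_zeros s
      rw [onesCard, Finset.filter_eq_empty_iff.2 fun q _ hq => hne ⟨q, hq⟩, Finset.card_empty,
        zero_add] at hz
      rw [hz] at he
      exact Nat.not_even_iff_odd.2 ho he
    exact ⟨LinearMap.single R (fun s => TensorPow h t ((closure l).Circle s)) s ∘ₗ
      strandClass h t (lowerLeft l) s p, hN,
      fun a => differential_single_strandClass hD hp he a,
      fun a => single_mem_chainGr hD.positive_eq _ _, fun v hv hd =>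
        exists_eq_single_strandClass_add hD hp ((mem_chainGr_iff hD.positive_eq s v).1 hv) hd,
      fun _ a => single_strandClass_mem_range_iff hD hp he h1 a, fun h0 => absurd h0 hm⟩

end Torus

end Khovanov

theorem corollary3 {R : Type*} [CommRing R] (h t : R) (k s : ℕ) (hk : 0 < k)
    (S : Fin k → Khovanov.Step)
    (hS : (Finset.univ.filter fun i => (S i).isImmersed = true).card = s) :
    Nonempty (Khovanov.Kh h t Khovanov.unknot ≃ₗ[R] Khovanov.FrobAlg R h t) ∧
    (∃ hφ : Khovanov.IsChainMap h t (Khovanov.mapLow h t k S),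
      LinearMap.range (Khovanov.KhMap h t (Khovanov.mapLow h t k S) hφ) =
        Khovanov.KhGr h t (Khovanov.torusLink (2 * k + 1)) (-2 * (s : ℤ))) ∧
    (0 < s → Nonempty (Khovanov.KhGr h t (Khovanov.torusLink (2 * k + 1)) (-2 * (s : ℤ)) ≃ₗ[R]
      Khovanov.FrobAlg R h t ⧸ LinearMap.range (Khovanov.mapU h t))) ∧
    (s = 0 → Nonempty (Khovanov.KhGr h t (Khovanov.torusLink (2 * k + 1)) (-2 * (s : ℤ)) ≃ₗ[R]
      Khovanov.FrobAlg R h t)) := by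
  have hlow := Khovanov.isLowRange_mapLow (h := h) (t := t) k S
  rw [hS] at hlow
  obtain ⟨f, hf, hcyc, hgr, hgen, hpos, hzero⟩ := hlow.exists_generator
    (by simp) (by simp)
  have hrange := Khovanov.range_classMap f hcyc hgr hgen
  refine ⟨Khovanov.nonempty_Kh_unknot_equiv, ⟨fun v => ?_, ?_⟩, fun h0 => ?_, fun h0 => ?_⟩
  -- The source has zero differential, so being a chain map means that the image consists of cycles.
  · rw [Khovanov.differential_unknot, map_zero]
    obtain ⟨a, ha⟩ := (hf _).1 ⟨v, rfl⟩
    exact (((congrArg _ ha).trans (hcyc a))).symm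
  · exact (Khovanov.range_KhMap _ Khovanov.differential_unknot f hcyc hf).trans hrange
  · have hker := Khovanov.ker_classMap f hcyc (hpos h0)
    exact ⟨(LinearEquiv.ofEq _ _ hrange.symm).trans
      ((LinearMap.quotKerEquivRange _).symm.trans (Submodule.quotEquivOfEq _ _ hker))⟩
  · have hker := Khovanov.ker_classMap f hcyc (hzero h0)
    exact ⟨(LinearEquiv.ofEq _ _ hrange.symm).trans
      (LinearEquiv.ofInjective _ (LinearMap.ker_eq_bot.1 hker)).symm⟩
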